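/- Let $n,m\ge 0$ be integers, $T>0$, let $N:[0,T]\to\mathbb R^{n\times n}$ be continuous, $B\in\mathbb R^{n\times m}$, and let $Q=Q^*\ge 0$, $Q_0=Q_0^*\ge 0$ be real $n\times n$ matrices. For $\tau\in[0,T]$ and a state $X_\tau=(\hat x,\tilde x)\in M^2_\tau=\mathbb R^n\times L^2(0,\tau;\mathbb R^n)$, and for $u\in L^2(\tau,T;\mathbb R^m)$, let $x$ be the (absolutely continuous) solution on $[\tau,T]$ of $$x'(t)=\int_\tau^t N(t-s)x(s)\,ds+Bu(t)+\int_0^\tau N(t-s)\tilde x(s)\,ds,\qquad x(\tau)=\hat x,$$ and put $$J_\tau(X_\tau,u)=\int_\tau^T\big[x^*(t)Qx(t)+|u(t)|^2\big]dt+x^*(T)Q_0x(T).$$ Then for every $\tau\in[0,T]$ and $X_\tau\in M^2_\tau$ the minimum $W(\tau;X_\tau)=\min_{u\in L^2(\tau,T;\mathbb R^m)}J_\tau(X_\tau,u)$ exists, and there are real $n\times n$ matrix functions $P_0(\tau)$ $(0\le\tau\le T)$, $P_1(\tau,\xi)$ $(0\le\xi\le\tau\le T)$ and $K(\tau,\xi,r)$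 $(0\le \xi\le\tau\le T,\ 0\le r\le\tau)$, continuously differentiable in all their variables up to the boundary of these domains, with $P_0^*(\tau)=P_0(\tau)$ and $K(\tau,\xi,r)=K^*(\tau,r,\xi)$, such that $$W(\tau;X_\tau)=\hat x^*P_0(\tau)\hat x+\hat x^*\int_0^\tau P_1(\tau,\xi)\tilde x(\xi)\,d\xi+\Big[\int_0^\tau P_1(\tau,\xi)\tilde x(\xi)\,d\xi\Big]^*\hat x+\int_0^\tau\int_0^\tau\tilde x^*(r)K(\tau,\xi,r)\tilde x(\xi)\,d\xi\,dr$$ for all $\tau\in[0,T]$ and all $X_\tau=(\hat x,\tilde x)\in M^2_\tau$, and such that for all $\tau\in[0,T]$ and $\xi,r\in[0,\tau]$ $$P_0'(\tau)-P_0(\tau)BB^*P_0(\tau)+Q+P_1(\tau,\tau)+P_1^*(\tau,\tau)=0,$$ $$\frac{\partial}{\partial\tau}P_1(\tau,\xi)-P_0(\tau)BB^*P_1(\tau,\xi)+P_0(\tau)N(\tau-\xi)+K(\tau,\xi,\tau)=0,$$ $$\frac{\partial}{\partial\tau}K(\tau,\xi,r)-P_1^*(\tau,r)BB^*P_1(\tau,\xi)+P_1^*(\tau,r)N(\tau-\xi)+N^*(\tau-r)P_1(\tau,\xi)=0,$$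 (derivatives at boundary points being the continuous extensions of those in the interior), together with the terminal conditions $P_0(T)=Q_0$, and $P_1(T,\xi)=0$, $K(T,\xi,r)=0$ for all $\xi,r\in[0,T]$. -/

import Mathlib

open MeasureTheory Set
open scoped ENNReal

noncomputable section

namespace VolterraLQ

/-- `ℝᵏ` with its Euclidean norm. Matrices of size `k × l` are linear maps `Vec l →L[ℝ] Vec k`,
and the transpose is the adjoint. -/
abbrev Vec (k : ℕ) : Type := EuclideanSpace ℝ (Fin k)

/-- `L²(a, b; ℝᵏ)`. -/
abbrev L2 (k : ℕ) (a b : ℝ) : Type := Lp (Vec k) 2 (volume.restrict (Ioo a b))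

/-- The state space `M²_τ = ℝⁿ × L²(0, τ; ℝⁿ)`. -/
abbrev StateSpace (n : ℕ) (τ : ℝ) : Type := Vec n × L2 n 0 τ

/-- `x` is the (absolutely continuous) solution on `[τ, T]` of
`x'(t) = ∫_τ^t N(t-s) x(s) ds + B u(t) + ∫_0^τ N(t-s) x̃(s) ds`, `x(τ) = x̂`,
where `X = (x̂, x̃)`; the equation is written in integrated form because `u` is only in `L²`. -/
structure IsTrajectory {n m : ℕ} (T : ℝ) (N : ℝ → Vec n →L[ℝ] Vec n) (B : Vec m →L[ℝ] Vec n)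
    (τ : ℝ) (X : StateSpace n τ) (u : L2 m τ T) (x : ℝ → Vec n) : Prop where
  continuousOn : ContinuousOn x (Icc τ T)
  eqn : ∀ t ∈ Icc τ T, x t = X.1 + ∫ s in τ..t,
    ((∫ r in τ..s, N (s - r) (x r)) + B (u s) + ∫ r in (0 : ℝ)..τ, N (s - r) (X.2 r))

/-- `∫_τ^T [x* Q x + |u|²] dt + x*(T) Q₀ x(T)`. -/
def cost {n m : ℕ} (T : ℝ) (Q Q₀ : Vec n →L[ℝ] Vec n)
    (τ : ℝ) (u : L2 m τ T) (x : ℝ → Vec n) : ℝ :=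
  (∫ t in τ..T, (inner ℝ (x t) (Q (x t)) + ‖u t‖ ^ 2)) + inner ℝ (x T) (Q₀ (x T))

/-- All values `J_τ(X, u)` of the cost, for `u ∈ L²(τ, T; ℝᵐ)`. -/
def costValues {n m : ℕ} (T : ℝ) (N : ℝ → Vec n →L[ℝ] Vec n) (B : Vec m →L[ℝ] Vec n)
    (Q Q₀ : Vec n →L[ℝ] Vec n) (τ : ℝ) (X : StateSpace n τ) : Set ℝ :=
  {c | ∃ (u : L2 m τ T) (x : ℝ → Vec n), IsTrajectory T N B τ X u x ∧ c = cost T Q Q₀ τ u x}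

/-- The value function `W(τ; X)`. -/
def valueFunction {n m : ℕ} (T : ℝ) (N : ℝ → Vec n →L[ℝ] Vec n) (B : Vec m →L[ℝ] Vec n)
    (Q Q₀ : Vec n →L[ℝ] Vec n) (τ : ℝ) (X : StateSpace n τ) : ℝ :=
  sInf (costValues T N B Q Q₀ τ X)

/-- `x̂* P₀ x̂ + x̂* ∫ P₁(ξ) x̃(ξ) dξ + [∫ P₁(ξ) x̃(ξ) dξ]* x̂ + ∫∫ x̃*(r) K(ξ, r) x̃(ξ) dξ dr`,
with all integrals over `(0, τ)`; here `P₀`, `P₁`, `K` are the kernels at the time `τ`. -/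
def quadForm {n : ℕ} (τ : ℝ) (P₀ : Vec n →L[ℝ] Vec n) (P₁ : ℝ → Vec n →L[ℝ] Vec n)
    (K : ℝ → ℝ → Vec n →L[ℝ] Vec n) (X : StateSpace n τ) : ℝ :=
  inner ℝ X.1 (P₀ X.1)
    + inner ℝ X.1 (∫ ξ in (0 : ℝ)..τ, P₁ ξ (X.2 ξ))
    + inner ℝ (∫ ξ in (0 : ℝ)..τ, P₁ ξ (X.2 ξ)) X.1
    + ∫ r in (0 : ℝ)..τ, ∫ ξ in (0 : ℝ)..τ, inner ℝ (X.2 r) (K ξ r (X.2 ξ))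

/-- The set of all `(τ, ξ)` with `0 ≤ ξ ≤ τ ≤ T`. -/
def dom₂ (T : ℝ) : Set (ℝ × ℝ) := {p | 0 ≤ p.2 ∧ p.2 ≤ p.1 ∧ p.1 ≤ T}

/-- The set of all `(τ, ξ, r)` with `0 ≤ ξ ≤ τ`, `0 ≤ r ≤ τ`, `τ ≤ T`. -/
def dom₃ (T : ℝ) : Set (ℝ × ℝ × ℝ) :=
  {p | 0 ≤ p.2.1 ∧ p.2.1 ≤ p.1 ∧ 0 ≤ p.2.2 ∧ p.2.2 ≤ p.1 ∧ p.1 ≤ T}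

/-- `∂P₁/∂τ (τ, ξ)` for a `C¹` function `P₁` on `dom₂ T`. The derivative is taken relative to that
closed set: this is the usual partial derivative inside and its continuous extension on the
boundary, which includes the diagonal `ξ = τ`. -/
def dτ₂ {n : ℕ} (T : ℝ) (P₁ : ℝ → ℝ → Vec n →L[ℝ] Vec n) (τ ξ : ℝ) : Vec n →L[ℝ] Vec n :=
  fderivWithin ℝ (fun p : ℝ × ℝ => P₁ p.1 p.2) (dom₂ T) (τ, ξ) (1, 0)

/-- `∂K/∂τ (τ, ξ, r)` for a `C¹` function `K` on `dom₃ T`, in the same sense. -/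
def dτ₃ {n : ℕ} (T : ℝ) (K : ℝ → ℝ → ℝ → Vec n →L[ℝ] Vec n) (τ ξ r : ℝ) : Vec n →L[ℝ] Vec n :=
  fderivWithin ℝ (fun p : ℝ × ℝ × ℝ => K p.1 p.2.1 p.2.2) (dom₃ T) (τ, ξ, r) (1, 0, 0)

end VolterraLQ

end

/-! The heart is completing the square. Suppose kernels solving the Riccati system exist, and let
the costate at time `s` be the operator with the kernels at time `s` applied to the state at time
`s`, with present component `p(s)`. Then for every control the cost equals the quadratic form at the
initial state plus `∫ |u + B* p|²` (`Data.form_add_integral_deviation`). So the form is a lower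
bound for the cost, and the feedback `u = -B* p`, whose closed loop is a linear Volterra equation
(`Data.exists_closed_loop`), attains it. It remains to solve the Riccati system on all of `[0, T]`
with `C¹` kernels.

Solvability: the kernels are sought for history points in all of `[0, T]`, not only in `[0, τ]`,
with `N` extended to a bounded continuous function on the line. The system is then an ordinary
differential equation with locally Lipschitz field in one fixed Banach space, so an a-priori bound
gives a global solution. The bound comes from the control problem itself: on `[τ, T]`, where a
solution is given, the identity shows that the form is nonnegative and at most the cost of the zero
control. To extract pointwise bounds on the kernels from this, the identity is proved for histories
that are integrable functions `f` on an arbitrary measure space, placed at points `π ω`. An `L²`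
history is one instance; two atoms are another, and polarization with them bounds `P₀`, `P₁` and `K`
(`Data.norm_le_bound`).

Regularity: differentiability in `τ` is part of the construction. For fixed `ξ` the pair `(P₁(·, ξ),
K(·, ξ, ·))` solves a linear equation in which `ξ` enters only through a forcing term with `N(τ -
ξ)`. Although `N` is merely continuous, the solution is differentiable in `ξ`: a derivative in `ξ`
of `N(τ - ξ)` is minus one in `τ`, and integration by parts in `τ` removes it
(`exists_parameter_derivative`). Differentiability of `K` in `r` follows from the symmetry of `K`.
-/

section
open MeasureTheory Set
open scoped ENNReal NNReal Topology

namespace VolterraLQ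
-- Global solvability of nonlinear equations in a Banach space from an a-priori bound
section ODE

variable {X : Type*} [NormedAddCommGroup X] [NormedSpace ℝ X]

/-- The radial retraction of a normed space onto the ball of radius `R`. -/
noncomputable def radialClamp (R : ℝ) (x : X) : X := (R / max R ‖x‖) • x

theorem radialClamp_of_norm_le {R : ℝ} (hR : 0 < R) {x : X} (hx : ‖x‖ ≤ R) :
    radialClamp R x = x := by
  rw [radialClamp, max_eq_left hx, div_self hR.ne', one_smul]

theorem norm_radialClamp_le {R : ℝ} (hR : 0 < R) (x : X) : ‖radialClamp R x‖ ≤ R := by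
  have hm : 0 < max R ‖x‖ := lt_max_of_lt_left hR
  rw [radialClamp, norm_smul, Real.norm_of_nonneg (by positivity), div_mul_eq_mul_div,
    div_le_iff₀ hm]
  exact mul_le_mul_of_nonneg_left (le_max_right _ _) hR.le

theorem norm_radialClamp_sub_le {R : ℝ} (hR : 0 < R) (x y : X) :
    ‖radialClamp R x - radialClamp R y‖ ≤ 2 * ‖x - y‖ := by
  have hx : 0 < max R ‖x‖ := lt_max_of_lt_left hR
  have hy : 0 < max R ‖y‖ := lt_max_of_lt_left hR
  have h1 : radialClamp R x - radialClamp R y =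
      (R / max R ‖x‖) • (x - y) + (R / max R ‖x‖ - R / max R ‖y‖) • y := by
    simp only [radialClamp, smul_sub, sub_smul]; abel
  have h2 : ‖(R / max R ‖x‖) • (x - y)‖ ≤ ‖x - y‖ := by
    rw [norm_smul, Real.norm_of_nonneg (by positivity)]
    exact mul_le_of_le_one_left (norm_nonneg _) ((div_le_one hx).2 (le_max_left _ _))
  have h3 : ‖(R / max R ‖x‖ - R / max R ‖y‖) • y‖ ≤ ‖x - y‖ := by
    have : R / max R ‖x‖ - R / max R ‖y‖ =
        (max R ‖y‖ - max R ‖x‖) * (R / max R ‖x‖) / max R ‖y‖ := by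
      field_simp
    rw [norm_smul, this, norm_div, norm_mul, Real.norm_of_nonneg hy.le,
      Real.norm_of_nonneg (div_nonneg hR.le hx.le), div_mul_eq_mul_div, div_le_iff₀ hy]
    have h4 : ‖max R ‖y‖ - max R ‖x‖‖ ≤ ‖x - y‖ := by
      have := abs_max_sub_max_le_abs ‖y‖ ‖x‖ R
      rw [max_comm R, max_comm R, Real.norm_eq_abs]
      exact this.trans ((abs_norm_sub_norm_le y x).trans_eq (norm_sub_rev _ _))
    have h5 : R / max R ‖x‖ ≤ 1 := (div_le_one hx).2 (le_max_left _ _)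
    calc _ ≤ ‖x - y‖ * 1 * max R ‖y‖ := by
          gcongr
          exact le_max_right _ _
      _ = _ := by ring
  rw [h1]
  linarith [norm_add_le ((R / max R ‖x‖) • (x - y)) ((R / max R ‖x‖ - R / max R ‖y‖) • y)]

theorem continuous_radialClamp {R : ℝ} (hR : 0 < R) : Continuous (radialClamp R : X → X) := by
  refine Continuous.smul (continuous_const.div (by fun_prop) fun x => ?_) continuous_id
  exact (lt_max_of_lt_left hR).ne'

variable [CompleteSpace X]

/-- Picard–Lindelöf covers the whole interval in one step here, since a field bounded by `L` cannot
leave the ball of radius `L (b - a)`. The integral form and the extension of the solution to the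
line are what the later arguments use. -/
theorem exists_integral_solution_of_bounded {f : ℝ → X → X}
    (hf : Continuous (fun p : ℝ × X => f p.1 p.2)) {a b : ℝ} (hab : a ≤ b) {K L : ℝ≥0}
    (hK : ∀ t ∈ Icc a b, LipschitzWith K (f t)) (hL : ∀ t ∈ Icc a b, ∀ x, ‖f t x‖ ≤ L) (x₀ : X) :
    ∃ y : ℝ → X, Continuous y ∧ ∀ t ∈ Icc a b, y t = x₀ + ∫ s in a..t, f s (y s) := by
  have hPL : IsPicardLindelof f (⟨a, left_mem_Icc.2 hab⟩ : Icc a b) x₀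
      (L * (Real.toNNReal (b - a))) 0 L K :=
    { lipschitzOnWith := fun t ht => (hK t ht).lipschitzOnWith
      continuousOn := fun x _ => (hf.comp (by fun_prop : Continuous fun t => (t, x))).continuousOn
      norm_le := fun t ht x _ => hL t ht x
      mul_max_le := by simp [Real.coe_toNNReal _ (sub_nonneg.2 hab), sub_nonneg.2 hab] }
  obtain ⟨α, hα0, hα⟩ := hPL.exists_eq_forall_mem_Icc_hasDerivWithinAt₀
  have hc : ContinuousOn α (Icc a b) := fun t ht => (hα t ht).continuousWithinAt
  refine ⟨IccExtend hab ((Icc a b).domRestrict α), hc.domRestrict.Icc_extend', fun t ht => ?_⟩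
  have hαt : ∀ s ∈ Icc a b, IccExtend hab ((Icc a b).domRestrict α) s = α s := fun s hs => by
    rw [IccExtend_of_mem hab _ hs]; rfl
  rw [hαt t ht, ← hα0]
  have hsub : uIcc a t ⊆ Icc a b := by rw [uIcc_of_le ht.1]; exact Icc_subset_Icc_right ht.2
  have hc' : ContinuousOn (fun s => f s (α s)) (Icc a b) :=
    hf.comp_continuousOn (continuousOn_id.prodMk hc)
  have h2 := intervalIntegral.integral_eq_sub_of_hasDeriv_right_of_le (f := α)
    (f' := fun s => f s (α s)) ht.1 (hc.mono (Icc_subset_Icc_right ht.2))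
    (fun s hs => ((hα s ⟨hs.1.le, hs.2.le.trans ht.2⟩).hasDerivAt
      (Icc_mem_nhds hs.1 (hs.2.trans_le ht.2))).hasDerivWithinAt)
    (hc'.mono hsub).intervalIntegrable
  rw [intervalIntegral.integral_congr (g := fun s => f s (α s))
    (fun s hs => by simp only [hαt s (hsub hs)]), h2]
  simp

/-- Composing the field with the retraction onto the ball of radius `C + 1` makes it bounded and
Lipschitz. Its solution never reaches norm `C + 1`: up to the first time at which it would, it
solves the original equation, so its norm there is at most `C`. Hence the truncation is never
active. -/
theorem exists_integral_solution_of_apriori {f : ℝ → X → X}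
    (hf : Continuous (fun p : ℝ × X => f p.1 p.2)) {a b : ℝ} (hab : a ≤ b)
    (hK : ∀ R : ℝ, ∃ K : ℝ, ∀ t ∈ Icc a b, ∀ x y, ‖x‖ ≤ R → ‖y‖ ≤ R →
      ‖f t x - f t y‖ ≤ K * ‖x - y‖)
    (hL : ∀ R : ℝ, ∃ L : ℝ, ∀ t ∈ Icc a b, ∀ x, ‖x‖ ≤ R → ‖f t x‖ ≤ L) (x₀ : X) (C : ℝ)
    (hC : ∀ t₁ ∈ Icc a b, ∀ y : ℝ → X, Continuous y →
      (∀ t ∈ Icc a t₁, y t = x₀ + ∫ s in a..t, f s (y s)) → ‖y t₁‖ ≤ C) :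
    ∃ y : ℝ → X, Continuous y ∧ ∀ t ∈ Icc a b, y t = x₀ + ∫ s in a..t, f s (y s) := by
  -- The a-priori bound on the degenerate interval `[a, a]`, where the constant `x₀` is a solution.
  have hC0 : 0 ≤ C := (norm_nonneg _).trans
    (hC a (left_mem_Icc.2 hab) (fun _ => x₀) continuous_const (fun t ht => by
      rw [le_antisymm ht.2 ht.1]; simp))
  have hR : 0 < C + 1 := by linarith
  obtain ⟨K, hK⟩ := hK (C + 1)
  obtain ⟨L, hL⟩ := hL (C + 1)
  obtain ⟨y, hyc, hy⟩ := exists_integral_solution_of_bounded (f := fun t x => f t (radialClamp (C + 1) x))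
    (hf.comp (continuous_fst.prodMk ((continuous_radialClamp hR).comp continuous_snd))) hab
    (K := Real.toNNReal (|K| * 2)) (L := Real.toNNReal |L|)
    (fun t ht => LipschitzWith.of_dist_le_mul fun x z => by
      rw [dist_eq_norm, dist_eq_norm, Real.coe_toNNReal _ (by positivity)]
      have h1 := hK t ht _ _ (norm_radialClamp_le hR x) (norm_radialClamp_le hR z)
      have h2 := norm_radialClamp_sub_le hR x z
      calc _ ≤ K * _ := h1
        _ ≤ |K| * (2 * ‖x - z‖) := by gcongr; exact le_abs_self K
        _ = _ := by ring)
    (fun t ht x => by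
      rw [Real.coe_toNNReal _ (abs_nonneg _)]
      exact (hL t ht _ (norm_radialClamp_le hR x)).trans (le_abs_self L)) x₀
  have key : ∀ t ∈ Icc a b, ‖y t‖ < C + 1 := by
    by_contra! hcon
    have hcomp : IsCompact {t ∈ Icc a b | C + 1 ≤ ‖y t‖} :=
      isCompact_Icc.inter_right (isClosed_le continuous_const hyc.norm)
    obtain ⟨t₁, ⟨ht₁, hyt⟩, hmin⟩ := hcomp.exists_isLeast hcon
    have hlt : ∀ s ∈ Ico a t₁, ‖y s‖ ≤ C + 1 := fun s hs => by
      by_contra! h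
      exact absurd (hmin ⟨⟨hs.1, hs.2.le.trans ht₁.2⟩, h.le⟩) (not_le.2 hs.2)
    have := hC t₁ ht₁ y hyc (fun t ht => by
      rw [hy t ⟨ht.1, ht.2.trans ht₁.2⟩]
      congr 1
      -- Minimality of `t₁` controls `y` only before `t₁`; the endpoint is discarded as a null set.
      refine intervalIntegral.integral_congr_ae ?_
      have hne : ∀ᵐ s : ℝ, s ≠ t₁ := by simp [ae_iff, measure_singleton]
      filter_upwards [hne] with s hs hst
      rw [uIoc_of_le ht.1] at hst
      rw [radialClamp_of_norm_le hR (hlt s ⟨hst.1.le, lt_of_le_of_ne (hst.2.trans ht.2) hs⟩)])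
    linarith
  refine ⟨y, hyc, fun t ht => ?_⟩
  rw [hy t ht]
  congr 1
  refine intervalIntegral.integral_congr fun s hs => ?_
  rw [uIcc_of_le ht.1] at hs
  simp only [radialClamp_of_norm_le hR (key s ⟨hs.1, hs.2.trans ht.2⟩).le]

omit [CompleteSpace X] in
theorem integral_reverse (f : ℝ → X → X) (y : ℝ → X) (t b : ℝ) :
    ∫ s in (0:ℝ)..(b - t), f (b - s) (y s) = ∫ s in t..b, f s (y (b - s)) := by
  have := intervalIntegral.integral_comp_sub_left (a := 0) (b := b - t)
    (fun s => f s (y (b - s))) b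
  simpa using this

theorem exists_backward_solution_of_apriori {f : ℝ → X → X}
    (hf : Continuous (fun p : ℝ × X => f p.1 p.2)) {a b : ℝ} (hab : a ≤ b)
    (hK : ∀ R : ℝ, ∃ K : ℝ, ∀ t ∈ Icc a b, ∀ x y, ‖x‖ ≤ R → ‖y‖ ≤ R →
      ‖f t x - f t y‖ ≤ K * ‖x - y‖)
    (hL : ∀ R : ℝ, ∃ L : ℝ, ∀ t ∈ Icc a b, ∀ x, ‖x‖ ≤ R → ‖f t x‖ ≤ L) (x₀ : X) (C : ℝ)
    (hC : ∀ t₁ ∈ Icc a b, ∀ y : ℝ → X, Continuous y →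
      (∀ t ∈ Icc t₁ b, y t = x₀ - ∫ s in t..b, f s (y s)) → ‖y t₁‖ ≤ C) :
    ∃ y : ℝ → X, Continuous y ∧ ∀ t ∈ Icc a b, y t = x₀ - ∫ s in t..b, f s (y s) := by
  have hmem : ∀ {t}, t ∈ Icc 0 (b - a) → b - t ∈ Icc a b := fun ht =>
    ⟨by linarith [ht.2], by linarith [ht.1]⟩
  obtain ⟨y, hyc, hy⟩ := exists_integral_solution_of_apriori (f := fun t x => -f (b - t) x)
    (a := 0) (b := b - a)
    ((hf.comp ((continuous_const.sub continuous_fst).prodMk continuous_snd)).neg)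
    (sub_nonneg.2 hab)
    (fun R => (hK R).imp fun K h t ht x y hx hy => by
      rw [neg_sub_neg, norm_sub_rev]; exact h _ (hmem ht) x y hx hy)
    (fun R => (hL R).imp fun L h t ht x hx => by rw [norm_neg]; exact h _ (hmem ht) x hx)
    x₀ C (fun t₁ ht₁ y hyc hy => by
      have := hC (b - t₁) (hmem ht₁) (fun t => y (b - t)) (by fun_prop) (fun t ht => by
        rw [hy (b - t) ⟨by linarith [ht.2], by linarith [ht.1]⟩, intervalIntegral.integral_neg,
          integral_reverse, sub_eq_add_neg])
      simpa using this)
  refine ⟨fun t => y (b - t), by fun_prop, fun t ht => ?_⟩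
  simp only
  rw [hy (b - t) ⟨by linarith [ht.2], by linarith [ht.1]⟩, intervalIntegral.integral_neg,
    integral_reverse, sub_eq_add_neg]

end ODE
end VolterraLQ
end

section
open MeasureTheory Set
open scoped ENNReal NNReal Topology

namespace VolterraLQ
-- Linear equations: Grönwall bound, existence and backward uniqueness
section LinearODE

variable {X : Type*} [NormedAddCommGroup X] [NormedSpace ℝ X] {A : ℝ → X →L[ℝ] X} {g : ℝ → X}
  {a b c d : ℝ}

/-- Grönwall's inequality. Only joint continuity of `(t, x) ↦ A t x` is assumed, not continuity of
`A` in operator norm: the generators used later contain evaluation of a continuous function at a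
moving point, which is not norm continuous. -/
theorem norm_le_of_linear_integral_equation [CompleteSpace X]
    (hA : Continuous fun p : ℝ × X => A p.1 p.2) (hg : Continuous g) (hab : a ≤ b)
    (hc : ∀ t ∈ Icc a b, ‖A t‖ ≤ c) (hd : ∀ t ∈ Icc a b, ‖g t‖ ≤ d) {x₀ : X} {y : ℝ → X}
    (hyc : Continuous y) (hy : ∀ t ∈ Icc a b, y t = x₀ + ∫ s in a..t, (A s (y s) + g s)) :
    ‖y b‖ ≤ gronwallBound ‖x₀‖ c d (b - a) := by
  have hcont : Continuous fun s => A s (y s) + g s :=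
    (hA.comp (continuous_id.prodMk hyc)).add hg
  have hder : ∀ x, HasDerivAt (fun t => x₀ + ∫ s in a..t, (A s (y s) + g s)) (A x (y x) + g x) x :=
    fun x => (hcont.integral_hasStrictDerivAt a x).hasDerivAt.const_add x₀
  refine norm_le_gronwallBound_of_norm_deriv_right_le (f' := fun x => A x (y x) + g x)
    hyc.continuousOn (fun x hx => ?_) ?_ (fun x hx => ?_) b (right_mem_Icc.2 hab)
  · have h1 : HasDerivWithinAt y (A x (y x) + g x) (Icc x b) x :=
      (hder x).hasDerivWithinAt.congr (fun z hz => hy z ⟨hx.1.trans hz.1, hz.2⟩)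
        (hy x ⟨hx.1, hx.2.le⟩)
    exact h1.mono_of_mem_nhdsWithin (Icc_mem_nhdsGE hx.2)
  · rw [hy a (left_mem_Icc.2 hab)]; simp
  · refine (norm_add_le _ _).trans (add_le_add ?_ (hd x ⟨hx.1, hx.2.le⟩))
    exact (A x).le_of_opNorm_le (hc x ⟨hx.1, hx.2.le⟩) _

theorem exists_linear_integral_solution [CompleteSpace X]
    (hA : Continuous fun p : ℝ × X => A p.1 p.2) (hg : Continuous g) (hab : a ≤ b)
    (hc : ∀ t ∈ Icc a b, ‖A t‖ ≤ c) (hd : ∀ t ∈ Icc a b, ‖g t‖ ≤ d) (x₀ : X) :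
    ∃ y : ℝ → X, Continuous y ∧ (∀ t ∈ Icc a b, y t = x₀ + ∫ s in a..t, (A s (y s) + g s)) ∧
      ∀ t ∈ Icc a b, ‖y t‖ ≤ gronwallBound ‖x₀‖ c d (b - a) := by
  have hc0 : 0 ≤ c := (norm_nonneg _).trans (hc a (left_mem_Icc.2 hab))
  have hd0 : 0 ≤ d := (norm_nonneg _).trans (hd a (left_mem_Icc.2 hab))
  have hap : ∀ t₁ ∈ Icc a b, ∀ y : ℝ → X, Continuous y →
      (∀ t ∈ Icc a t₁, y t = x₀ + ∫ s in a..t, (A s (y s) + g s)) →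
      ‖y t₁‖ ≤ gronwallBound ‖x₀‖ c d (b - a) := fun t₁ ht₁ y hyc hy =>
    (norm_le_of_linear_integral_equation hA hg ht₁.1 (fun t ht => hc t ⟨ht.1, ht.2.trans ht₁.2⟩)
      (fun t ht => hd t ⟨ht.1, ht.2.trans ht₁.2⟩) hyc hy).trans
      (gronwallBound_mono (norm_nonneg _) hd0 hc0 (by linarith [ht₁.2]))
  obtain ⟨y, hyc, hy⟩ := exists_integral_solution_of_apriori (f := fun t x => A t x + g t)
    (hA.add (hg.comp continuous_fst)) hab
    (fun R => ⟨c, fun t ht x y _ _ => by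
      rw [add_sub_add_right_eq_sub, ← map_sub]
      exact (A t).le_of_opNorm_le (hc t ht) _⟩)
    (fun R => ⟨c * R + d, fun t ht x hx => (norm_add_le _ _).trans
      (add_le_add (((A t).le_of_opNorm_le (hc t ht) _).trans (by gcongr)) (hd t ht))⟩)
    x₀ _ hap
  exact ⟨y, hyc, hy, fun t ht => hap t ht y hyc fun s hs => hy s ⟨hs.1, hs.2.trans ht.2⟩⟩

theorem exists_linear_backward_solution [CompleteSpace X]
    (hA : Continuous fun p : ℝ × X => A p.1 p.2) (hg : Continuous g) (hab : a ≤ b)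
    (hc : ∀ t ∈ Icc a b, ‖A t‖ ≤ c) (x₀ : X) :
    ∃ y : ℝ → X, Continuous y ∧ ∀ t ∈ Icc a b, y t = x₀ - ∫ s in t..b, (A s (y s) + g s) := by
  obtain ⟨d, hd⟩ := isCompact_Icc.exists_bound_of_continuousOn (hg.continuousOn (s := Icc a b))
  have hmem : ∀ {t}, t ∈ Icc 0 (b - a) → b - t ∈ Icc a b := fun ht =>
    ⟨by linarith [ht.2], by linarith [ht.1]⟩
  obtain ⟨y, hyc, hy, -⟩ := exists_linear_integral_solution (A := fun t => -A (b - t))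
    (g := fun t => -g (b - t)) (a := 0) (b := b - a) (c := c) (d := d)
    ((hA.comp ((continuous_const.sub continuous_fst).prodMk continuous_snd)).neg)
    (by fun_prop) (sub_nonneg.2 hab) (fun t ht => by rw [norm_neg]; exact hc _ (hmem ht))
    (fun t ht => by rw [norm_neg]; exact hd _ (hmem ht)) x₀
  refine ⟨fun t => y (b - t), by fun_prop, fun t ht => ?_⟩
  simp only
  rw [hy (b - t) ⟨by linarith [ht.2], by linarith [ht.1]⟩, sub_eq_add_neg x₀,
    ← integral_reverse (fun s x => A s x + g s), ← intervalIntegral.integral_neg]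
  simp [add_comm]

/-- After time reversal this is the Grönwall bound with zero initial value and zero forcing. It is
the uniqueness statement that identifies the derivative of the kernels in the history variable. -/
theorem eq_zero_of_linear_backward_equation [CompleteSpace X]
    (hA : Continuous fun p : ℝ × X => A p.1 p.2) (hab : a ≤ b)
    (hc : ∀ t ∈ Icc a b, ‖A t‖ ≤ c) {y : ℝ → X} (hyc : Continuous y)
    (hy : ∀ t ∈ Icc a b, y t = - ∫ s in t..b, A s (y s)) : y a = 0 := by
  have hmem : ∀ {t}, t ∈ Icc 0 (b - a) → b - t ∈ Icc a b := fun ht =>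
    ⟨by linarith [ht.2], by linarith [ht.1]⟩
  have := norm_le_of_linear_integral_equation (A := fun t => -A (b - t))
    (g := fun t => 0) (a := 0) (b := b - a) (c := c) (d := 0) (x₀ := 0)
    (y := fun t => y (b - t))
    ((hA.comp ((continuous_const.sub continuous_fst).prodMk continuous_snd)).neg)
    (by fun_prop) (sub_nonneg.2 hab) (fun t ht => by rw [norm_neg]; exact hc _ (hmem ht))
    (by simp) (by fun_prop) (fun t ht => by
      rw [hy _ (hmem ht)]
      have := integral_reverse (fun s x => A s x) (fun t => y (b - t)) (b - t) b
      simp only [sub_sub_cancel] at this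
      simp [← this])
  simpa [gronwallBound_ε0_δ0] using this

end LinearODE

/-! ### Fubini on triangles and a product rule for weakly integrable functionals -/

section Triangle

variable {X W : Type*} [NormedAddCommGroup X] [NormedSpace ℝ X] [NormedAddCommGroup W]
  [NormedSpace ℝ W]

/-- The diagonal cuts the square into two triangles, and the variables are exchanged in the upper
one. The diagonal itself is counted in the lower triangle only, which the half-open interval
integrals do not notice. Integrability of the two inner integrals is part of the conclusion, because
for a merely integrable `h` it is not otherwise available. -/
theorem integral_square_eq_add_triangles {h : ℝ → ℝ → W} {a t : ℝ} (hat : a ≤ t)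
    (hh : Integrable (fun p : ℝ × ℝ => h p.1 p.2)
      ((volume.restrict (Ioc a t)).prod (volume.restrict (Ioc a t)))) :
    IntervalIntegrable (fun s => ∫ r in a..s, h s r) volume a t ∧
    IntervalIntegrable (fun s => ∫ r in a..s, h r s) volume a t ∧
    ∫ s in a..t, ∫ r in a..t, h s r =
      (∫ s in a..t, ∫ r in a..s, h s r) + ∫ s in a..t, ∫ r in a..s, h r s := by
  set μ : Measure ℝ := volume.restrict (Ioc a t) with hμ
  have hm1 : MeasurableSet {p : ℝ × ℝ | p.2 ≤ p.1} := measurableSet_le measurable_snd measurable_fst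
  have hm2 : MeasurableSet {p : ℝ × ℝ | p.1 < p.2} := measurableSet_lt measurable_fst measurable_snd
  have i1 := hh.indicator hm1
  have i2 := hh.indicator hm2
  have e1 : ∀ s ∈ Ioc a t, ∫ r, {p : ℝ × ℝ | p.2 ≤ p.1}.indicator (fun p => h p.1 p.2) (s, r) ∂μ =
      ∫ r in a..s, h s r := fun s hs => by
    rw [intervalIntegral.integral_of_le hs.1.le]
    have : (fun r => {p : ℝ × ℝ | p.2 ≤ p.1}.indicator (fun p => h p.1 p.2) (s, r)) =
        (Iic s).indicator (fun r => h s r) := by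
      ext r; simp [indicator]
    rw [this, integral_indicator measurableSet_Iic, hμ, Measure.restrict_restrict measurableSet_Iic]
    congr 2
    ext r
    simp only [mem_inter_iff, mem_Iic, mem_Ioc]
    constructor
    · rintro ⟨h1, h2, h3⟩; exact ⟨h2, h1⟩
    · rintro ⟨h1, h2⟩; exact ⟨h2, h1, h2.trans hs.2⟩
  have e2 : ∀ s ∈ Ioc a t, ∫ r, {p : ℝ × ℝ | p.1 < p.2}.indicator (fun p => h p.1 p.2) (r, s) ∂μ =
      ∫ r in a..s, h r s := fun s hs => by
    have : (fun r => {p : ℝ × ℝ | p.1 < p.2}.indicator (fun p => h p.1 p.2) (r, s)) =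
        (Iio s).indicator (fun r => h r s) := by
      ext r; simp [indicator]
    rw [this, integral_indicator measurableSet_Iio, hμ, Measure.restrict_restrict measurableSet_Iio,
      intervalIntegral.integral_of_le hs.1.le, integral_Ioc_eq_integral_Ioo]
    congr 2
    ext r
    simp only [mem_inter_iff, mem_Iio, mem_Ioc, mem_Ioo]
    constructor
    · rintro ⟨h1, h2, h3⟩; exact ⟨h2, h1⟩
    · rintro ⟨h1, h2⟩; exact ⟨h2, h1, h2.le.trans hs.2⟩
  have I1 : Integrable (fun s => ∫ r in a..s, h s r) μ :=
    i1.integral_prod_left.congr ((ae_restrict_iff' measurableSet_Ioc).2 (.of_forall e1))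
  have I2 : Integrable (fun s => ∫ r in a..s, h r s) μ :=
    i2.integral_prod_right.congr ((ae_restrict_iff' measurableSet_Ioc).2 (.of_forall e2))
  refine ⟨(intervalIntegrable_iff_integrableOn_Ioc_of_le hat).2 I1,
    (intervalIntegrable_iff_integrableOn_Ioc_of_le hat).2 I2, ?_⟩
  have hsum : (fun p : ℝ × ℝ => h p.1 p.2) =
      fun p => {p : ℝ × ℝ | p.2 ≤ p.1}.indicator (fun p => h p.1 p.2) p +
        {p : ℝ × ℝ | p.1 < p.2}.indicator (fun p => h p.1 p.2) p := by
    ext p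
    rcases le_or_gt p.2 p.1 with hp | hp
    · simp [hp, hp.not_gt]
    · simp [hp, hp.not_ge]
  simp only [intervalIntegral.integral_of_le hat, ← hμ]
  rw [integral_integral (f := h) hh]
  change ∫ z, (fun p : ℝ × ℝ => h p.1 p.2) z ∂(μ.prod μ) = _
  rw [hsum, integral_add i1 i2, integral_prod _ i1, integral_prod_symm _ i2]
  congr 1
  · exact setIntegral_congr_fun measurableSet_Ioc e1
  · exact setIntegral_congr_fun measurableSet_Ioc e2

variable [CompleteSpace X] [CompleteSpace W]

/-- The product rule for the pairing of `G = G₀ + ∫ g` with the functional `ℓ + ∫ κ`, where `κ` is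
integrable only in the weak sense. -/
theorem pairing_eq_add_integral {ℓ : X →L[ℝ] W} {κ : ℝ → X →L[ℝ] W} {g : ℝ → X} {a b : ℝ}
    (hg : IntervalIntegrable g volume a b)
    (hκ : ∀ x, IntervalIntegrable (fun s => κ s x) volume a b)
    (hκg : Integrable (fun p : ℝ × ℝ => κ p.1 (g p.2))
      ((volume.restrict (Ioc a b)).prod (volume.restrict (Ioc a b))))
    {G : ℝ → X} (hG : ∀ t ∈ Icc a b, G t = G a + ∫ s in a..t, g s) {t : ℝ} (ht : t ∈ Icc a b) :
    ℓ (G t) + ∫ s in a..t, κ s (G t) =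
      ℓ (G a) + ∫ s in a..t, (κ s (G s) + (ℓ (g s) + ∫ r in a..s, κ r (g s))) := by
  have hsub : uIcc a t ⊆ uIcc a b := by
    rw [uIcc_of_le ht.1, uIcc_of_le (ht.1.trans ht.2)]; exact Icc_subset_Icc_right ht.2
  have hgt : ∀ s ∈ Icc a b, IntervalIntegrable g volume a s := fun s hs => hg.mono_set (by
    rw [uIcc_of_le hs.1, uIcc_of_le (ht.1.trans ht.2)]; exact Icc_subset_Icc_right hs.2)
  have hκt := fun x => (hκ x).mono_set hsub
  have hh : Integrable (fun p : ℝ × ℝ => κ p.1 (g p.2))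
      ((volume.restrict (Ioc a t)).prod (volume.restrict (Ioc a t))) := by
    have hle : volume.restrict (Ioc a t) ≤ volume.restrict (Ioc a b) :=
      Measure.restrict_mono (Ioc_subset_Ioc_right ht.2) le_rfl
    exact hκg.mono_measure (Measure.prod_mono hle hle)
  -- The integral of `κ s (g r)` over the square is the product of the two increments, and its
  -- triangles are the two halves of the Leibniz rule.
  obtain ⟨j1, j2, hsq⟩ := integral_square_eq_add_triangles (h := fun s r => κ s (g r)) ht.1 hh
  have e1 : ∀ u ∈ Icc a b, ∀ s, κ s (G u) = κ s (G a) + ∫ r in a..u, κ s (g r) := fun u hu s => by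
    rw [hG u hu, map_add, (κ s).intervalIntegral_comp_comm (hgt u hu)]
  have e2 : IntervalIntegrable (fun s => ∫ r in a..t, κ s (g r)) volume a t := by
    rw [intervalIntegrable_iff_integrableOn_Ioc_of_le ht.1]
    refine hh.integral_prod_left.congr (.of_forall fun s => ?_)
    simp [intervalIntegral.integral_of_le ht.1]
  have e3 : IntervalIntegrable (fun s => κ s (G s)) volume a t :=
    ((hκt (G a)).add j1).congr fun s hs => by
      rw [uIoc_of_le ht.1] at hs
      exact (e1 s ⟨hs.1.le, hs.2.trans ht.2⟩ s).symm
  have e4 : IntervalIntegrable (fun s => ℓ (g s)) volume a t := by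
    have := hgt t ht
    rw [intervalIntegrable_iff_integrableOn_Ioc_of_le ht.1] at this ⊢
    exact ℓ.integrable_comp this
  rw [intervalIntegral.integral_add e3 (e4.add j2), intervalIntegral.integral_add e4 j2,
    ℓ.intervalIntegral_comp_comm (hgt t ht)]
  have l1 : ∫ s in a..t, κ s (G t) = (∫ s in a..t, κ s (G a)) + ∫ s in a..t, ∫ r in a..t, κ s (g r) := by
    rw [← intervalIntegral.integral_add (hκt (G a)) e2]
    exact intervalIntegral.integral_congr fun s _ => e1 t ht s
  have l2 : ∫ s in a..t, κ s (G s) = (∫ s in a..t, κ s (G a)) + ∫ s in a..t, ∫ r in a..s, κ s (g r) := by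
    rw [← intervalIntegral.integral_add (hκt (G a)) j1]
    refine intervalIntegral.integral_congr fun s hs => ?_
    rw [uIcc_of_le ht.1] at hs
    exact e1 s ⟨hs.1, hs.2.trans ht.2⟩ s
  rw [l1, l2, hsq, hG t ht, map_add]
  abel

end Triangle
end VolterraLQ
end

/-! ### The state as a functional, and the product rule along a trajectory -/

section
open MeasureTheory Set
open scoped ENNReal NNReal Topology

namespace VolterraLQ
/-- The space of bounded operators, with only its norm topology. (Spaces of functions with values in
`V →L[ℝ] W` do not unify with the generic ones.) -/
def Op (V W : Type*) [NormedAddCommGroup V] [NormedSpace ℝ V] [NormedAddCommGroup W]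
    [NormedSpace ℝ W] : Type _ := V →L[ℝ] W

namespace Op

variable {V W : Type*} [NormedAddCommGroup V] [NormedSpace ℝ V] [NormedAddCommGroup W]
  [NormedSpace ℝ W]

noncomputable instance : NormedAddCommGroup (Op V W) :=
  inferInstanceAs (NormedAddCommGroup (V →L[ℝ] W))

noncomputable instance : NormedSpace ℝ (Op V W) := inferInstanceAs (NormedSpace ℝ (V →L[ℝ] W))

instance [CompleteSpace W] : CompleteSpace (Op V W) := inferInstanceAs (CompleteSpace (V →L[ℝ] W))

noncomputable def toCLM : Op V W →L[ℝ] V →L[ℝ] W := ContinuousLinearMap.id ℝ (V →L[ℝ] W)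

noncomputable def ofCLM : (V →L[ℝ] W) →L[ℝ] Op V W := ContinuousLinearMap.id ℝ (V →L[ℝ] W)

@[simp] theorem toCLM_ofCLM (A : V →L[ℝ] W) : toCLM (ofCLM A) = A := rfl

end Op

section Pairing

variable {V W W' Z Ω : Type*} [NormedAddCommGroup V] [NormedSpace ℝ V]
  [NormedAddCommGroup W] [NormedSpace ℝ W] [NormedAddCommGroup W'] [NormedSpace ℝ W']
  [MetricSpace Z] [CompactSpace Z] [MeasurableSpace Z] [BorelSpace Z] [MeasurableSpace Ω]
  {σ : ℝ → Z} {μ : Measure Ω} {π : Ω → Z} {f : Ω → V} {x w : ℝ → V} {τ t b : ℝ}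

/-- The state at time `t` of a system started at time `τ` consists of the present value `x t`, the
given history `f` at the points `π`, and the past `x s`, `τ < s < t`, at the points `σ s`. This is
its pairing with a function on the disjoint union of a point and `Z`. -/
noncomputable def pairing (σ : ℝ → Z) (μ : Measure Ω) (π : Ω → Z) (f : Ω → V) (x : ℝ → V)
    (τ t : ℝ) (G₀ : V →L[ℝ] W) (G₁ : Z → V →L[ℝ] W) : W :=
  G₀ (x t) + (∫ ω, G₁ (π ω) (f ω) ∂μ + ∫ s in τ..t, G₁ (σ s) (x s))

theorem integrable_history (hπ : Measurable π) (hf : Integrable f μ) {G₁ : Z → V →L[ℝ] W}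
    (hG : Continuous G₁) : Integrable (fun ω => G₁ (π ω) (f ω)) μ := by
  obtain ⟨C, hC⟩ := isCompact_univ.exists_bound_of_continuousOn hG.continuousOn
  refine (hf.norm.const_mul C).mono' ?_ (.of_forall fun ω =>
    (G₁ (π ω)).le_of_opNorm_le (hC _ (mem_univ _)) _)
  have h1 : StronglyMeasurable fun ω => G₁ (π ω) := hG.stronglyMeasurable.comp_measurable hπ
  exact (ContinuousLinearMap.id ℝ (V →L[ℝ] W)).aestronglyMeasurable_comp₂
    h1.aestronglyMeasurable hf.aestronglyMeasurable

omit [CompactSpace Z] [MeasurableSpace Z] [BorelSpace Z] in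
theorem continuous_past (hσ : Continuous σ) (hx : Continuous x) {G₁ : Z → V →L[ℝ] W}
    (hG : Continuous G₁) : Continuous fun s => G₁ (σ s) (x s) :=
  (hG.comp hσ).clm_apply hx

theorem pairing_clm_comp [CompleteSpace W] [CompleteSpace W'] (hσ : Continuous σ)
    (hx : Continuous x) (hπ : Measurable π) (hf : Integrable f μ) (L : W →L[ℝ] W')
    (G₀ : V →L[ℝ] W) {G₁ : Z → V →L[ℝ] W} (hG : Continuous G₁) :
    pairing σ μ π f x τ t (L ∘L G₀) (fun z => L ∘L G₁ z) = L (pairing σ μ π f x τ t G₀ G₁) := by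
  simp only [pairing, map_add, ContinuousLinearMap.comp_apply]
  rw [L.integral_comp_comm (integrable_history hπ hf hG),
    L.intervalIntegral_comp_comm ((continuous_past hσ hx hG).intervalIntegrable _ _)]

theorem pairing_add (hσ : Continuous σ) (hx : Continuous x) (hπ : Measurable π)
    (hf : Integrable f μ) (G₀ H₀ : V →L[ℝ] W) {G₁ H₁ : Z → V →L[ℝ] W} (hG : Continuous G₁)
    (hH : Continuous H₁) :
    pairing σ μ π f x τ t (G₀ + H₀) (fun z => G₁ z + H₁ z) =
      pairing σ μ π f x τ t G₀ G₁ + pairing σ μ π f x τ t H₀ H₁ := by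
  simp only [pairing, add_apply]
  rw [integral_add (integrable_history hπ hf hG) (integrable_history hπ hf hH),
    intervalIntegral.integral_add ((continuous_past hσ hx hG).intervalIntegrable _ _)
      ((continuous_past hσ hx hH).intervalIntegrable _ _)]
  abel

theorem pairing_sub (hσ : Continuous σ) (hx : Continuous x) (hπ : Measurable π)
    (hf : Integrable f μ) (G₀ H₀ : V →L[ℝ] W) {G₁ H₁ : Z → V →L[ℝ] W} (hG : Continuous G₁)
    (hH : Continuous H₁) :
    pairing σ μ π f x τ t (G₀ - H₀) (fun z => G₁ z - H₁ z) =
      pairing σ μ π f x τ t G₀ G₁ - pairing σ μ π f x τ t H₀ H₁ := by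
  simp only [pairing, sub_apply]
  rw [integral_sub (integrable_history hπ hf hG) (integrable_history hπ hf hH),
    intervalIntegral.integral_sub ((continuous_past hσ hx hG).intervalIntegrable _ _)
      ((continuous_past hσ hx hH).intervalIntegrable _ _)]
  abel

/-- Integration of a history as a continuous linear map. -/
noncomputable def historyCLM (W : Type*) [NormedAddCommGroup W] [NormedSpace ℝ W]
    (hπ : Measurable π) (hf : Integrable f μ) : C(Z, Op V W) →L[ℝ] W :=
  LinearMap.mkContinuous
    { toFun := fun G : C(Z, Op V W) => ∫ ω, (G (π ω)).toCLM (f ω) ∂μ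
      map_add' := fun G H => integral_add
        (integrable_history hπ hf (Op.toCLM.continuous.comp G.continuous))
        (integrable_history hπ hf (Op.toCLM.continuous.comp H.continuous))
      map_smul' := fun c _ => integral_smul c _ }
    (∫ ω, ‖f ω‖ ∂μ) fun G => by
      change ‖∫ ω, (G (π ω)).toCLM (f ω) ∂μ‖ ≤ _
      rw [mul_comm, ← integral_const_mul]
      exact norm_integral_le_of_norm_le (hf.norm.const_mul _)
        (.of_forall fun ω => (G (π ω)).toCLM.le_of_opNorm_le (G.norm_coe_le_norm _) _)

/-- The derivative of the state, paired with a fixed function. -/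
noncomputable def rateCLM (W : Type*) [NormedAddCommGroup W] [NormedSpace ℝ W]
    (v : V) (z : Z) (v' : V) : (Op V W × C(Z, Op V W)) →L[ℝ] W :=
  (ContinuousLinearMap.apply ℝ W v) ∘L Op.toCLM ∘L ContinuousLinearMap.fst ℝ _ _ +
    (ContinuousLinearMap.apply ℝ W v') ∘L Op.toCLM ∘L (ContinuousMap.evalCLM ℝ z) ∘L
      ContinuousLinearMap.snd ℝ _ _

omit [CompactSpace Z] [MeasurableSpace Z] [BorelSpace Z] in
theorem rateCLM_apply (v : V) (z : Z) (v' : V) (G : Op V W × C(Z, Op V W)) :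
    rateCLM W v z v' G = G.1.toCLM v + (G.2 z).toCLM v' := rfl

/-- The pairing with the initial state. -/
noncomputable def initialCLM (W : Type*) [NormedAddCommGroup W] [NormedSpace ℝ W] (v : V)
    (hπ : Measurable π) (hf : Integrable f μ) : (Op V W × C(Z, Op V W)) →L[ℝ] W :=
  (ContinuousLinearMap.apply ℝ W v) ∘L Op.toCLM ∘L ContinuousLinearMap.fst ℝ _ _ +
    historyCLM W hπ hf ∘L ContinuousLinearMap.snd ℝ _ _

theorem initialCLM_apply (v : V) (hπ : Measurable π) (hf : Integrable f μ)
    (G : Op V W × C(Z, Op V W)) :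
    initialCLM W v hπ hf G = G.1.toCLM v + ∫ ω, (G.2 (π ω)).toCLM (f ω) ∂μ := rfl

/-- As time advances, the present value moves with velocity `w`, and the past acquires the value `x
s` at the point `σ s`. So, tested against a fixed function, the state is an absolutely continuous
functional with derivative `rateCLM`. In operator norm this would fail, because evaluation at `σ s`
is only weakly continuous in `s`. -/
theorem pairing_eq_add_integral_rate [CompleteSpace V] [CompleteSpace W] (hσ : Continuous σ)
    (hx : Continuous x) (hw : IntervalIntegrable w volume τ t) (hxw : x t = x τ + ∫ s in τ..t, w s)
    (hπ : Measurable π) (hf : Integrable f μ) (G : Op V W × C(Z, Op V W)) :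
    pairing σ μ π f x τ t G.1.toCLM (fun z => (G.2 z).toCLM) =
      initialCLM W (x τ) hπ hf G + ∫ s in τ..t, rateCLM W (w s) (σ s) (x s) G := by
  have h1 : IntervalIntegrable (fun s => G.1.toCLM (w s)) volume τ t := by
    rw [intervalIntegrable_iff] at hw ⊢
    exact G.1.toCLM.integrable_comp hw
  simp only [rateCLM_apply]
  rw [intervalIntegral.integral_add h1 ((continuous_past (G₁ := fun z => (G.2 z).toCLM) hσ hx
    (Op.toCLM.continuous.comp G.2.continuous)).intervalIntegrable _ _),
    G.1.toCLM.intervalIntegral_comp_comm hw]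
  simp only [initialCLM_apply, pairing, hxw, map_add]
  abel

/-- The product rule for the pairing of the state with a time-dependent function. -/
theorem pairing_eq_pairing_add_integral [CompleteSpace V] [CompleteSpace W] (hσ : Continuous σ)
    (hx : Continuous x) (hw : IntervalIntegrable w volume τ b)
    (hxw : ∀ t ∈ Icc τ b, x t = x τ + ∫ s in τ..t, w s)
    (hπ : Measurable π) (hf : Integrable f μ) {G g : ℝ → Op V W × C(Z, Op V W)}
    (hg : IntervalIntegrable g volume τ b) (hG : ∀ t ∈ Icc τ b, G t = G τ + ∫ s in τ..t, g s)
    (ht : t ∈ Icc τ b) :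
    pairing σ μ π f x τ t (G t).1.toCLM (fun z => ((G t).2 z).toCLM) =
      pairing σ μ π f x τ τ (G τ).1.toCLM (fun z => ((G τ).2 z).toCLM) +
      ∫ s in τ..t, ((G s).1.toCLM (w s) + ((G s).2 (σ s)).toCLM (x s) +
        pairing σ μ π f x τ s (g s).1.toCLM (fun z => ((g s).2 z).toCLM)) := by
  have hτb : τ ≤ b := ht.1.trans ht.2
  have hwt : ∀ s ∈ Icc τ b, IntervalIntegrable w volume τ s := fun s hs => hw.mono_set (by
    rw [uIcc_of_le hs.1, uIcc_of_le hτb]; exact Icc_subset_Icc_right hs.2)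
  have hκ : ∀ G : Op V W × C(Z, Op V W),
      IntervalIntegrable (fun s => rateCLM W (w s) (σ s) (x s) G) volume τ b := fun G => by
    have h1 : IntervalIntegrable (fun s => G.1.toCLM (w s)) volume τ b := by
      rw [intervalIntegrable_iff] at hw ⊢
      exact G.1.toCLM.integrable_comp hw
    exact h1.add ((continuous_past hσ hx
      (Op.toCLM.continuous.comp G.2.continuous)).intervalIntegrable _ _)
  have hw' := (intervalIntegrable_iff_integrableOn_Ioc_of_le hτb).1 hw
  have hg' := (intervalIntegrable_iff_integrableOn_Ioc_of_le hτb).1 hg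
  have hx' : IntegrableOn x (Ioc τ b) := hx.integrableOn_Ioc
  have hκg : Integrable (fun p : ℝ × ℝ => rateCLM W (w p.1) (σ p.1) (x p.1) (g p.2))
      ((volume.restrict (Ioc τ b)).prod (volume.restrict (Ioc τ b))) := by
    refine Integrable.add (f := fun p : ℝ × ℝ => (g p.2).1.toCLM (w p.1))
      (g := fun p : ℝ × ℝ => ((g p.2).2 (σ p.1)).toCLM (x p.1)) ?_ ?_
    · refine (hw'.norm.mul_prod hg'.norm).mono' ?_ (.of_forall fun p => ?_)
      · exact (Op.toCLM (V := V) (W := W)).aestronglyMeasurable_comp₂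
          hg'.aestronglyMeasurable.comp_snd.fst hw'.aestronglyMeasurable.comp_fst
      · rw [mul_comm]
        exact (g p.2).1.toCLM.le_of_opNorm_le (norm_fst_le _) _
    · refine (hx'.norm.mul_prod hg'.norm).mono' ?_ (.of_forall fun p => ?_)
      -- Joint measurability comes from the joint continuity of evaluation on `C(Z, ·) × Z`, with
      -- `Z` compact.
      · have h2 : AEStronglyMeasurable (fun p : ℝ × ℝ => (g p.2).2 (σ p.1))
            ((volume.restrict (Ioc τ b)).prod (volume.restrict (Ioc τ b))) :=
          (by fun_prop : Continuous fun q : C(Z, Op V W) × Z => q.1 q.2).comp_aestronglyMeasurable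
            (hg'.aestronglyMeasurable.comp_snd.snd.prodMk
              (hσ.comp continuous_fst).aestronglyMeasurable)
        exact (Op.toCLM (V := V) (W := W)).aestronglyMeasurable_comp₂
          h2 hx'.aestronglyMeasurable.comp_fst
      · rw [mul_comm]
        exact ((g p.2).2 (σ p.1)).toCLM.le_of_opNorm_le
          (((g p.2).2.norm_coe_le_norm _).trans (norm_snd_le _)) _
  -- The state is the initial functional `ℓ` plus the integral of the rates `κ`, so the abstract
  -- product rule applies; the inner integral that it produces is again a pairing with the state.
  have key := pairing_eq_add_integral (ℓ := initialCLM W (x τ) hπ hf) hg hκ hκg hG ht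
  rw [pairing_eq_add_integral_rate hσ hx (hwt t ht) (hxw t ht) hπ hf, key,
    pairing_eq_add_integral_rate hσ hx (hwt τ ⟨le_rfl, hτb⟩) (hxw τ ⟨le_rfl, hτb⟩) hπ hf,
    intervalIntegral.integral_same, add_zero]
  congr 1
  refine intervalIntegral.integral_congr fun s hs => ?_
  rw [uIcc_of_le ht.1] at hs
  have hs' : s ∈ Icc τ b := ⟨hs.1, hs.2.trans ht.2⟩
  rw [pairing_eq_add_integral_rate hσ hx (hwt s hs') (hxw s hs') hπ hf, rateCLM_apply]

end Pairing
end VolterraLQ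
end

/-! ### The Riccati system as an ordinary differential equation in a Banach space of kernels -/

section
open MeasureTheory Set ContinuousLinearMap
open scoped ENNReal NNReal Topology

namespace VolterraLQ

section Riccati

variable {V U : Type*} [NormedAddCommGroup V] [InnerProductSpace ℝ V] [CompleteSpace V]
  [NormedAddCommGroup U] [InnerProductSpace ℝ U] [CompleteSpace U]

/-- The adjoint as a real-linear map. -/
noncomputable def adjointCLM (V : Type*) [NormedAddCommGroup V] [InnerProductSpace ℝ V]
    [CompleteSpace V] : (V →L[ℝ] V) →L[ℝ] V →L[ℝ] V :=
  LinearMap.mkContinuous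
    { toFun := fun A => adjoint A
      map_add' := fun A B => map_add _ A B
      map_smul' := fun c A => by simp } 1 fun A => by simp

theorem adjointCLM_apply (A : V →L[ℝ] V) : adjointCLM V A = adjoint A := rfl

@[fun_prop]
theorem continuous_adjoint {X : Type*} [TopologicalSpace X] {A : X → V →L[ℝ] V}
    (hA : Continuous A) : Continuous fun x => adjoint (A x) := (adjointCLM V).continuous.comp hA

theorem norm_adjoint_le (A : V →L[ℝ] V) : ‖adjoint A‖ ≤ ‖A‖ := by simp

/-- The data of a linear-quadratic control problem for a Volterra equation, with the kernel extended
to the real line. -/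
structure Data (V U : Type*) [NormedAddCommGroup V] [InnerProductSpace ℝ V] [CompleteSpace V]
    [NormedAddCommGroup U] [InnerProductSpace ℝ U] [CompleteSpace U] where
  T : ℝ
  T_nonneg : 0 ≤ T
  N : ℝ → V →L[ℝ] V
  continuous_N : Continuous N
  c : ℝ
  norm_N_le : ∀ t, ‖N t‖ ≤ c
  B : U →L[ℝ] V
  Q : V →L[ℝ] V
  Q₀ : V →L[ℝ] V
  isPositive_Q : Q.IsPositive
  isPositive_Q₀ : Q₀.IsPositive

/-- The kernels `P₀`, `P₁`, `K` of a quadratic form on the state space, with the history given on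
the whole of `[0, T]`. -/
def Kernels (V : Type*) [NormedAddCommGroup V] [InnerProductSpace ℝ V] (T : ℝ) : Type _ :=
  Op V V × C(Icc (0 : ℝ) T, Op V V) × C(Icc (0 : ℝ) T, C(Icc (0 : ℝ) T, Op V V))

namespace Kernels

noncomputable instance (T : ℝ) : NormedAddCommGroup (Kernels V T) := inferInstanceAs
  (NormedAddCommGroup
    (Op V V × C(Icc (0 : ℝ) T, Op V V) × C(Icc (0 : ℝ) T, C(Icc (0 : ℝ) T, Op V V))))

noncomputable instance (T : ℝ) : NormedSpace ℝ (Kernels V T) := inferInstanceAs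
  (NormedSpace ℝ
    (Op V V × C(Icc (0 : ℝ) T, Op V V) × C(Icc (0 : ℝ) T, C(Icc (0 : ℝ) T, Op V V))))

instance (T : ℝ) : CompleteSpace (Kernels V T) := inferInstanceAs
  (CompleteSpace
    (Op V V × C(Icc (0 : ℝ) T, Op V V) × C(Icc (0 : ℝ) T, C(Icc (0 : ℝ) T, Op V V))))

noncomputable def toProd {T : ℝ} : Kernels V T →L[ℝ]
    Op V V × C(Icc (0 : ℝ) T, Op V V) × C(Icc (0 : ℝ) T, C(Icc (0 : ℝ) T, Op V V)) :=
  ContinuousLinearMap.id ℝ _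

noncomputable def ofProd {T : ℝ} :
    (Op V V × C(Icc (0 : ℝ) T, Op V V) × C(Icc (0 : ℝ) T, C(Icc (0 : ℝ) T, Op V V))) →L[ℝ]
    Kernels V T :=
  ContinuousLinearMap.id ℝ _

variable {T : ℝ} {X : Type*} [TopologicalSpace X]

noncomputable def P₀ (y : Kernels V T) : V →L[ℝ] V := y.toProd.1.toCLM

noncomputable def P₁ (y : Kernels V T) (ξ : Icc (0 : ℝ) T) : V →L[ℝ] V := (y.toProd.2.1 ξ).toCLM

noncomputable def K (y : Kernels V T) (ξ r : Icc (0 : ℝ) T) : V →L[ℝ] V :=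
  (y.toProd.2.2 ξ r).toCLM

omit [CompleteSpace V] in
@[fun_prop]
theorem continuous_P₀ {y : X → Kernels V T} (hy : Continuous y) : Continuous fun x => P₀ (y x) :=
  Op.toCLM.continuous.comp (toProd.continuous.comp hy).fst

omit [CompleteSpace V] in
@[fun_prop]
theorem continuous_P₁ {y : X → Kernels V T} {ξ : X → Icc (0 : ℝ) T} (hy : Continuous y)
    (hξ : Continuous ξ) : Continuous fun x => P₁ (y x) (ξ x) := by
  have := (toProd.continuous.comp hy).snd.fst
  exact Op.toCLM.continuous.comp (by fun_prop)

omit [CompleteSpace V] in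
@[fun_prop]
theorem continuous_K {y : X → Kernels V T} {ξ r : X → Icc (0 : ℝ) T} (hy : Continuous y)
    (hξ : Continuous ξ) (hr : Continuous r) : Continuous fun x => K (y x) (ξ x) (r x) := by
  have := (toProd.continuous.comp hy).snd.snd
  exact Op.toCLM.continuous.comp (by fun_prop)

omit [CompleteSpace V] in
theorem norm_P₀_le (y : Kernels V T) : ‖P₀ y‖ ≤ ‖y‖ := norm_fst_le y.toProd

omit [CompleteSpace V] in
theorem norm_P₁_le (y : Kernels V T) (ξ : Icc (0 : ℝ) T) : ‖P₁ y ξ‖ ≤ ‖y‖ :=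
  (y.toProd.2.1.norm_coe_le_norm ξ).trans ((norm_fst_le y.toProd.2).trans (norm_snd_le y.toProd))

omit [CompleteSpace V] in
theorem norm_K_le (y : Kernels V T) (ξ r : Icc (0 : ℝ) T) : ‖K y ξ r‖ ≤ ‖y‖ :=
  ((y.toProd.2.2 ξ).norm_coe_le_norm r).trans ((y.toProd.2.2.norm_coe_le_norm ξ).trans
    ((norm_snd_le y.toProd.2).trans (norm_snd_le y.toProd)))

omit [CompleteSpace V] in
theorem norm_le {y : Kernels V T} {C : ℝ} (hC : 0 ≤ C) (h₀ : ‖P₀ y‖ ≤ C) (h₁ : ∀ ξ, ‖P₁ y ξ‖ ≤ C)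
    (h₂ : ∀ ξ r, ‖K y ξ r‖ ≤ C) : ‖y‖ ≤ C :=
  max_le h₀ (max_le ((ContinuousMap.norm_le _ hC).2 h₁)
    ((ContinuousMap.norm_le _ hC).2 fun ξ => (ContinuousMap.norm_le _ hC).2 (h₂ ξ)))

omit [CompleteSpace V] in
theorem P₀_sub (x y : Kernels V T) : P₀ (x - y) = P₀ x - P₀ y := map_sub Op.toCLM _ _

omit [CompleteSpace V] in
theorem P₁_sub (x y : Kernels V T) (ξ : Icc (0 : ℝ) T) : P₁ (x - y) ξ = P₁ x ξ - P₁ y ξ :=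
  map_sub Op.toCLM _ _

omit [CompleteSpace V] in
theorem K_sub (x y : Kernels V T) (ξ r : Icc (0 : ℝ) T) : K (x - y) ξ r = K x ξ r - K y ξ r :=
  map_sub Op.toCLM _ _

noncomputable def P₀L : Kernels V T →L[ℝ] V →L[ℝ] V :=
  Op.toCLM ∘L ContinuousLinearMap.fst ℝ _ _ ∘L toProd

noncomputable def P₁L (ξ : Icc (0 : ℝ) T) : Kernels V T →L[ℝ] V →L[ℝ] V :=
  Op.toCLM ∘L ContinuousMap.evalCLM ℝ ξ ∘L ContinuousLinearMap.fst ℝ _ _ ∘L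
    ContinuousLinearMap.snd ℝ _ _ ∘L toProd

noncomputable def KL (ξ r : Icc (0 : ℝ) T) : Kernels V T →L[ℝ] V →L[ℝ] V :=
  Op.toCLM ∘L ContinuousMap.evalCLM ℝ r ∘L ContinuousMap.evalCLM ℝ ξ ∘L
    ContinuousLinearMap.snd ℝ _ _ ∘L ContinuousLinearMap.snd ℝ _ _ ∘L toProd

omit [CompleteSpace V] in
theorem P₀L_apply (y : Kernels V T) : P₀L y = P₀ y := rfl

omit [CompleteSpace V] in
theorem KL_apply (y : Kernels V T) (ξ r : Icc (0 : ℝ) T) : KL ξ r y = K y ξ r := rfl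

end Kernels

open Kernels

namespace Data

variable (D : Data V U)

noncomputable def σ (t : ℝ) : Icc (0 : ℝ) D.T := projIcc 0 D.T D.T_nonneg t

@[fun_prop]
theorem continuous_σ {X : Type*} [TopologicalSpace X] {f : X → ℝ} (hf : Continuous f) :
    Continuous fun x => D.σ (f x) :=
  continuous_projIcc.comp hf

@[fun_prop]
theorem continuous_N' {X : Type*} [TopologicalSpace X] {f : X → ℝ} (hf : Continuous f) :
    Continuous fun x => D.N (f x) :=
  D.continuous_N.comp hf

theorem σ_coe (ξ : Icc (0 : ℝ) D.T) : D.σ ξ = ξ := projIcc_val _ ξ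

theorem coe_σ {t : ℝ} (ht : t ∈ Icc 0 D.T) : (D.σ t : ℝ) = t := by
  rw [σ, projIcc_of_mem _ ht]

theorem c_nonneg : 0 ≤ D.c := (norm_nonneg _).trans (D.norm_N_le 0)

noncomputable def S : V →L[ℝ] V := D.B ∘L adjoint D.B

theorem adjoint_S : adjoint D.S = D.S := by simp [S, adjoint_comp]

theorem adjoint_Q : adjoint D.Q = D.Q := D.isPositive_Q.isSelfAdjoint.adjoint_eq

theorem adjoint_Q₀ : adjoint D.Q₀ = D.Q₀ := D.isPositive_Q₀.isSelfAdjoint.adjoint_eq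

/-- The last factor of the quadratic term is `adjoint (P₀ y)` and not `P₀ y`. This makes the value
self-adjoint for every `y`, so symmetry of `P₀` along a solution follows by integration, with no
uniqueness argument. -/
noncomputable def field₀ (t : ℝ) (y : Kernels V D.T) : V →L[ℝ] V :=
  P₀ y ∘L D.S ∘L adjoint (P₀ y) - D.Q - P₁ y (D.σ t) - adjoint (P₁ y (D.σ t))

noncomputable def field₁ (t : ℝ) (y : Kernels V D.T) (ξ : Icc (0 : ℝ) D.T) : V →L[ℝ] V :=
  P₀ y ∘L D.S ∘L P₁ y ξ - P₀ y ∘L D.N (t - ξ) - K y ξ (D.σ t)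

noncomputable def field₂ (t : ℝ) (y : Kernels V D.T) (ξ r : Icc (0 : ℝ) D.T) : V →L[ℝ] V :=
  adjoint (P₁ y r) ∘L D.S ∘L P₁ y ξ - adjoint (P₁ y r) ∘L D.N (t - ξ)
    - adjoint (D.N (t - r)) ∘L P₁ y ξ

@[fun_prop]
theorem continuous_field₀ {X : Type*} [TopologicalSpace X] {t : X → ℝ} {y : X → Kernels V D.T}
    (ht : Continuous t) (hy : Continuous y) : Continuous fun x => D.field₀ (t x) (y x) := by
  unfold field₀; fun_prop

@[fun_prop]
theorem continuous_field₁ {X : Type*} [TopologicalSpace X] {t : X → ℝ} {y : X → Kernels V D.T}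
    {ξ : X → Icc (0 : ℝ) D.T} (ht : Continuous t) (hy : Continuous y) (hξ : Continuous ξ) :
    Continuous fun x => D.field₁ (t x) (y x) (ξ x) := by
  unfold field₁; fun_prop

@[fun_prop]
theorem continuous_field₂ {X : Type*} [TopologicalSpace X] {t : X → ℝ} {y : X → Kernels V D.T}
    {ξ r : X → Icc (0 : ℝ) D.T} (ht : Continuous t) (hy : Continuous y) (hξ : Continuous ξ)
    (hr : Continuous r) : Continuous fun x => D.field₂ (t x) (y x) (ξ x) (r x) := by
  unfold field₂; fun_prop

/-- The right-hand side of the Riccati system. -/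
noncomputable def field (t : ℝ) (y : Kernels V D.T) : Kernels V D.T :=
  ofProd (Op.ofCLM (D.field₀ t y),
    ⟨fun ξ => Op.ofCLM (D.field₁ t y ξ), Op.ofCLM.continuous.comp (by fun_prop)⟩,
    ContinuousMap.curry ⟨fun p => Op.ofCLM (D.field₂ t y p.1 p.2),
      Op.ofCLM.continuous.comp (by fun_prop)⟩)

theorem P₀_field (t : ℝ) (y : Kernels V D.T) : P₀ (D.field t y) = D.field₀ t y := rfl

theorem P₁_field (t : ℝ) (y : Kernels V D.T) (ξ : Icc (0 : ℝ) D.T) :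
    P₁ (D.field t y) ξ = D.field₁ t y ξ := rfl

theorem K_field (t : ℝ) (y : Kernels V D.T) (ξ r : Icc (0 : ℝ) D.T) :
    K (D.field t y) ξ r = D.field₂ t y ξ r := rfl

@[fun_prop]
theorem continuous_field {X : Type*} [TopologicalSpace X] {t : X → ℝ} {y : X → Kernels V D.T}
    (ht : Continuous t) (hy : Continuous y) : Continuous fun x => D.field (t x) (y x) := by
  refine ofProd.continuous.comp (Continuous.prodMk (Op.ofCLM.continuous.comp (by fun_prop))
    (Continuous.prodMk ?_ ?_))
  · exact ContinuousMap.continuous_of_continuous_uncurry _ (Op.ofCLM.continuous.comp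
      (by fun_prop : Continuous fun q : X × Icc (0 : ℝ) D.T => D.field₁ (t q.1) (y q.1) q.2))
  · refine ContinuousMap.continuous_of_continuous_uncurry _
      (ContinuousMap.continuous_of_continuous_uncurry _ (Op.ofCLM.continuous.comp
      (by fun_prop : Continuous fun q : (X × Icc (0 : ℝ) D.T) × Icc (0 : ℝ) D.T =>
        D.field₂ (t q.1.1) (y q.1.1) q.1.2 q.2)))

omit [CompleteSpace V] in
theorem norm_comp_comp_sub_le {A A' C C' S : V →L[ℝ] V} {R : ℝ} (hA : ‖A‖ ≤ R) (hC : ‖C'‖ ≤ R) :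
    ‖A ∘L S ∘L C - A' ∘L S ∘L C'‖ ≤ R * ‖S‖ * ‖C - C'‖ + ‖A - A'‖ * ‖S‖ * R := by
  have : A ∘L S ∘L C - A' ∘L S ∘L C' = A ∘L S ∘L (C - C') + (A - A') ∘L S ∘L C' := by
    simp only [comp_sub, sub_comp]; abel
  rw [this]
  have h1 : ‖A ∘L S ∘L (C - C')‖ ≤ ‖A‖ * (‖S‖ * ‖C - C'‖) :=
    (opNorm_comp_le _ _).trans (by gcongr; exact opNorm_comp_le _ _)
  have h2 : ‖(A - A') ∘L S ∘L C'‖ ≤ ‖A - A'‖ * (‖S‖ * ‖C'‖) :=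
    (opNorm_comp_le _ _).trans (by gcongr; exact opNorm_comp_le _ _)
  refine (norm_add_le _ _).trans (add_le_add (h1.trans ?_) (h2.trans ?_))
  · rw [mul_assoc]; gcongr
  · rw [mul_assoc]; gcongr

/-- The field is quadratic in the kernels. One constant serves all three components: `2 R ‖S‖` from
the quadratic terms, `2 c` from the two products with `N` in the `K` component, and `2` from the
`P₁` terms in the `P₀` component. -/
theorem norm_field_sub_le {R : ℝ} (t : ℝ) {x y : Kernels V D.T} (hx : ‖x‖ ≤ R) (hy : ‖y‖ ≤ R) :
    ‖D.field t x - D.field t y‖ ≤ (2 * R * ‖D.S‖ + 2 * D.c + 2) * ‖x - y‖ := by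
  have hR : 0 ≤ R := (norm_nonneg _).trans hx
  have hc := D.c_nonneg
  have e0 : ‖P₀ x - P₀ y‖ ≤ ‖x - y‖ := by rw [← P₀_sub]; exact norm_P₀_le _
  have e1 : ∀ ξ, ‖P₁ x ξ - P₁ y ξ‖ ≤ ‖x - y‖ := fun ξ => by
    rw [← P₁_sub]; exact norm_P₁_le _ _
  have e2 : ∀ ξ r, ‖K x ξ r - K y ξ r‖ ≤ ‖x - y‖ := fun ξ r => by
    rw [← K_sub]; exact norm_K_le _ _ _
  have a0 : ‖adjoint (P₀ x) - adjoint (P₀ y)‖ ≤ ‖x - y‖ := by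
    rw [← map_sub]; exact (norm_adjoint_le _).trans e0
  have a1 : ∀ ξ, ‖adjoint (P₁ x ξ) - adjoint (P₁ y ξ)‖ ≤ ‖x - y‖ := fun ξ => by
    rw [← map_sub]; exact (norm_adjoint_le _).trans (e1 ξ)
  have hm : 0 ≤ ‖x - y‖ := norm_nonneg _
  refine Kernels.norm_le (by positivity) ?_ (fun ξ => ?_) fun ξ r => ?_
  · rw [P₀_sub, P₀_field, P₀_field, field₀, field₀]
    have h := norm_comp_comp_sub_le (A := P₀ x) (A' := P₀ y) (S := D.S) (C := adjoint (P₀ x))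
      (C' := adjoint (P₀ y)) ((norm_P₀_le x).trans hx)
      ((norm_adjoint_le _).trans ((norm_P₀_le y).trans hy))
    have e : P₀ x ∘L D.S ∘L adjoint (P₀ x) - D.Q - P₁ x (D.σ t) - adjoint (P₁ x (D.σ t)) -
        (P₀ y ∘L D.S ∘L adjoint (P₀ y) - D.Q - P₁ y (D.σ t) - adjoint (P₁ y (D.σ t))) =
        P₀ x ∘L D.S ∘L adjoint (P₀ x) - P₀ y ∘L D.S ∘L adjoint (P₀ y) -
        (P₁ x (D.σ t) - P₁ y (D.σ t)) - (adjoint (P₁ x (D.σ t)) - adjoint (P₁ y (D.σ t))) := by abel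
    rw [e]
    refine (norm_sub_le _ _).trans ((add_le_add ((norm_sub_le _ _).trans
      (add_le_add h (e1 _))) (a1 _)).trans ?_)
    have h1 : R * ‖D.S‖ * ‖adjoint (P₀ x) - adjoint (P₀ y)‖ ≤ R * ‖D.S‖ * ‖x - y‖ := by gcongr
    have h2 : ‖P₀ x - P₀ y‖ * ‖D.S‖ * R ≤ ‖x - y‖ * ‖D.S‖ * R := by gcongr
    nlinarith [mul_nonneg hc hm]
  · rw [P₁_sub, P₁_field, P₁_field, field₁, field₁]
    have h := norm_comp_comp_sub_le (A := P₀ x) (A' := P₀ y) (S := D.S) (C := P₁ x ξ)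
      (C' := P₁ y ξ) ((norm_P₀_le x).trans hx) ((norm_P₁_le y ξ).trans hy)
    have e : P₀ x ∘L D.S ∘L P₁ x ξ - P₀ x ∘L D.N (t - ξ) - K x ξ (D.σ t) -
        (P₀ y ∘L D.S ∘L P₁ y ξ - P₀ y ∘L D.N (t - ξ) - K y ξ (D.σ t)) =
        P₀ x ∘L D.S ∘L P₁ x ξ - P₀ y ∘L D.S ∘L P₁ y ξ -
        (P₀ x - P₀ y) ∘L D.N (t - ξ) - (K x ξ (D.σ t) - K y ξ (D.σ t)) := by
      rw [sub_comp]; abel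
    rw [e]
    have h3 : ‖(P₀ x - P₀ y) ∘L D.N (t - ξ)‖ ≤ ‖x - y‖ * D.c :=
      (opNorm_comp_le _ _).trans (by gcongr; exact D.norm_N_le _)
    refine (norm_sub_le _ _).trans ((add_le_add ((norm_sub_le _ _).trans
      (add_le_add h h3)) (e2 _ _)).trans ?_)
    have h1 : R * ‖D.S‖ * ‖P₁ x ξ - P₁ y ξ‖ ≤ R * ‖D.S‖ * ‖x - y‖ := by gcongr; exact e1 ξ
    have h2 : ‖P₀ x - P₀ y‖ * ‖D.S‖ * R ≤ ‖x - y‖ * ‖D.S‖ * R := by gcongr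
    nlinarith [mul_nonneg hc hm]
  · rw [K_sub, K_field, K_field, field₂, field₂]
    have h := norm_comp_comp_sub_le (A := adjoint (P₁ x r)) (A' := adjoint (P₁ y r)) (S := D.S)
      (C := P₁ x ξ) (C' := P₁ y ξ) ((norm_adjoint_le _).trans ((norm_P₁_le x r).trans hx))
      ((norm_P₁_le y ξ).trans hy)
    have e : adjoint (P₁ x r) ∘L D.S ∘L P₁ x ξ - adjoint (P₁ x r) ∘L D.N (t - ξ) -
          adjoint (D.N (t - r)) ∘L P₁ x ξ -
        (adjoint (P₁ y r) ∘L D.S ∘L P₁ y ξ - adjoint (P₁ y r) ∘L D.N (t - ξ) -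
          adjoint (D.N (t - r)) ∘L P₁ y ξ) =
        adjoint (P₁ x r) ∘L D.S ∘L P₁ x ξ - adjoint (P₁ y r) ∘L D.S ∘L P₁ y ξ -
        (adjoint (P₁ x r) - adjoint (P₁ y r)) ∘L D.N (t - ξ) -
        adjoint (D.N (t - r)) ∘L (P₁ x ξ - P₁ y ξ) := by
      rw [sub_comp, comp_sub]; abel
    rw [e]
    have h3 : ‖(adjoint (P₁ x r) - adjoint (P₁ y r)) ∘L D.N (t - ξ)‖ ≤ ‖x - y‖ * D.c :=
      (opNorm_comp_le _ _).trans (mul_le_mul (a1 r) (D.norm_N_le _) (norm_nonneg _) hm)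
    have h4 : ‖adjoint (D.N (t - r)) ∘L (P₁ x ξ - P₁ y ξ)‖ ≤ D.c * ‖x - y‖ :=
      (opNorm_comp_le _ _).trans (mul_le_mul ((norm_adjoint_le _).trans (D.norm_N_le _)) (e1 ξ)
        (norm_nonneg _) hc)
    refine (norm_sub_le _ _).trans ((add_le_add ((norm_sub_le _ _).trans
      (add_le_add h h3)) h4).trans ?_)
    have h1 : R * ‖D.S‖ * ‖P₁ x ξ - P₁ y ξ‖ ≤ R * ‖D.S‖ * ‖x - y‖ := by gcongr; exact e1 ξ
    have h2 : ‖adjoint (P₁ x r) - adjoint (P₁ y r)‖ * ‖D.S‖ * R ≤ ‖x - y‖ * ‖D.S‖ * R := by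
      gcongr; exact a1 r
    nlinarith [mul_nonneg hc hm]

theorem field_zero (t : ℝ) : D.field t 0 = ofProd (Op.ofCLM (-D.Q), 0, 0) := by
  have p0 : P₀ (0 : Kernels V D.T) = 0 := rfl
  have p1 : ∀ ξ, P₁ (0 : Kernels V D.T) ξ = 0 := fun ξ => rfl
  have p2 : ∀ ξ r, K (0 : Kernels V D.T) ξ r = 0 := fun ξ r => rfl
  refine congrArg ofProd (Prod.ext ?_ (Prod.ext ?_ ?_))
  · change Op.ofCLM (D.field₀ t 0) = Op.ofCLM (-D.Q)
    simp [field₀, p0, p1]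
  · ext1 ξ
    change Op.ofCLM (D.field₁ t 0 ξ) = Op.ofCLM 0
    simp [field₁, p0, p1, p2]
  · ext1 ξ; ext1 r
    change Op.ofCLM (D.field₂ t 0 ξ r) = Op.ofCLM 0
    simp [field₂, p1]

theorem norm_field_le {R : ℝ} (t : ℝ) {x : Kernels V D.T} (hx : ‖x‖ ≤ R) :
    ‖D.field t x‖ ≤ (2 * R * ‖D.S‖ + 2 * D.c + 2) * R + ‖D.Q‖ := by
  have hR : 0 ≤ R := (norm_nonneg _).trans hx
  have hc := D.c_nonneg
  have h1 := D.norm_field_sub_le t hx (y := 0) (by simpa using hR)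
  have h2 : ‖D.field t 0‖ ≤ ‖D.Q‖ := by
    rw [field_zero]
    refine Kernels.norm_le (norm_nonneg _) (norm_neg D.Q).le (fun ξ => ?_) fun ξ r => ?_
    · exact (norm_zero (E := V →L[ℝ] V)).le.trans (norm_nonneg _)
    · exact (norm_zero (E := V →L[ℝ] V)).le.trans (norm_nonneg _)
  have h3 := norm_sub_norm_le (D.field t x) (D.field t 0)
  rw [sub_zero] at h1
  have h4 : (2 * R * ‖D.S‖ + 2 * D.c + 2) * ‖x‖ ≤ (2 * R * ‖D.S‖ + 2 * D.c + 2) * R := by gcongr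
  linarith

/-- The terminal value of the kernels. -/
noncomputable def terminal : Kernels V D.T := ofProd (Op.ofCLM D.Q₀, 0, 0)

/-- `y` solves the Riccati system on `[τ, T]`. -/
structure IsRiccati (τ : ℝ) (y : ℝ → Kernels V D.T) : Prop where
  continuous : Continuous y
  eqn : ∀ t ∈ Icc τ D.T, y t = D.terminal - ∫ s in t..D.T, D.field s (y s)

namespace IsRiccati

variable {D} {τ t : ℝ} {y : ℝ → Kernels V D.T}

theorem continuous_field (h : D.IsRiccati τ y) : Continuous fun s => D.field s (y s) :=
  D.continuous_field continuous_id h.continuous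

theorem apply_T (h : D.IsRiccati τ y) (hτ : τ ≤ D.T) : y D.T = D.terminal := by
  rw [h.eqn _ ⟨hτ, le_rfl⟩]; simp

theorem eq_add_integral (h : D.IsRiccati τ y) (ht : t ∈ Icc τ D.T) :
    y t = y τ + ∫ s in τ..t, D.field s (y s) := by
  rw [h.eqn t ht, h.eqn τ ⟨le_rfl, ht.1.trans ht.2⟩,
    ← intervalIntegral.integral_add_adjacent_intervals
      (h.continuous_field.intervalIntegrable τ t) (h.continuous_field.intervalIntegrable t D.T)]
  abel

theorem adjoint_P₀ (h : D.IsRiccati τ y) (ht : t ∈ Icc τ D.T) :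
    adjoint (P₀ (y t)) = P₀ (y t) := by
  have hi := h.continuous_field.intervalIntegrable (μ := volume) t D.T
  have hc : Continuous fun s => D.field₀ s (y s) := by
    have := h.continuous; fun_prop
  rw [h.eqn t ht, ← P₀L_apply, map_sub, ← P₀L.intervalIntegral_comp_comm hi,
    ← adjointCLM_apply, map_sub]
  simp only [P₀L_apply, P₀_field]
  rw [← (adjointCLM V).intervalIntegral_comp_comm (hc.intervalIntegrable _ _)]
  congr 1
  · exact D.adjoint_Q₀
  · refine intervalIntegral.integral_congr fun s _ => ?_
    simp only [adjointCLM_apply, field₀, map_sub, adjoint_comp, adjoint_adjoint, adjoint_S,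
      adjoint_Q, comp_assoc]
    abel

/-- For arbitrary kernels, taking adjoints in `field₂` exchanges its two memory terms and preserves
the quadratic one, up to interchange of `ξ` and `r`. The terminal value vanishes, so integration
gives the symmetry. -/
theorem adjoint_K (h : D.IsRiccati τ y) (ht : t ∈ Icc τ D.T) (ξ r : Icc (0 : ℝ) D.T) :
    adjoint (K (y t) r ξ) = K (y t) ξ r := by
  have hi := h.continuous_field.intervalIntegrable (μ := volume) t D.T
  have hc : Continuous fun s => D.field₂ s (y s) r ξ := by
    have := h.continuous; fun_prop
  rw [h.eqn t ht, ← KL_apply, ← KL_apply, map_sub, map_sub (KL ξ r),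
    ← (KL r ξ).intervalIntegral_comp_comm hi, ← (KL ξ r).intervalIntegral_comp_comm hi,
    ← adjointCLM_apply, map_sub]
  simp only [KL_apply, K_field]
  rw [← (adjointCLM V).intervalIntegral_comp_comm (hc.intervalIntegrable _ _)]
  congr 1
  · exact map_zero (adjointCLM V)
  · refine intervalIntegral.integral_congr fun s _ => ?_
    simp only [adjointCLM_apply, field₂, map_sub, adjoint_comp, adjoint_adjoint, adjoint_S,
      comp_assoc]
    abel

end IsRiccati

end Data

end Riccati
end VolterraLQ
end

/-! ### Continuity of the pairing, and kernels as operators into costates -/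

section
open MeasureTheory Set ContinuousLinearMap
open scoped ENNReal NNReal Topology

namespace VolterraLQ

section

variable {V W Z Ω : Type*} [NormedAddCommGroup V] [NormedSpace ℝ V]
  [NormedAddCommGroup W] [NormedSpace ℝ W]
  [MetricSpace Z] [CompactSpace Z] [MeasurableSpace Z] [BorelSpace Z] [MeasurableSpace Ω]
  {σ : ℝ → Z} {μ : Measure Ω} {π : Ω → Z} {f : Ω → V} {x : ℝ → V} {τ t : ℝ}

theorem continuous_pairing (hσ : Continuous σ) (hx : Continuous x) (hπ : Measurable π)
    (hf : Integrable f μ) {G₀ : ℝ → V →L[ℝ] W} (hG₀ : Continuous G₀) {G₁ : ℝ → Z → V →L[ℝ] W}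
    (hG₁ : Continuous fun p : ℝ × Z => G₁ p.1 p.2) :
    Continuous fun t => pairing σ μ π f x τ t (G₀ t) (G₁ t) := by
  let g : C(ℝ, C(Z, Op V W)) :=
    ContinuousMap.curry ⟨fun p : ℝ × Z => Op.ofCLM (G₁ p.1 p.2), Op.ofCLM.continuous.comp hG₁⟩
  refine (hG₀.clm_apply hx).add (Continuous.add ?_ ?_)
  · exact (historyCLM W hπ hf).continuous.comp g.continuous
  · refine intervalIntegral.continuous_parametric_intervalIntegral_of_continuous
      (f := fun t s => G₁ t (σ s) (x s)) ?_ continuous_id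
    exact (hG₁.comp (continuous_fst.prodMk (hσ.comp continuous_snd))).clm_apply
      (hx.comp continuous_snd)

omit [MetricSpace Z] [CompactSpace Z] [MeasurableSpace Z] [BorelSpace Z] in
theorem pairing_zero_right (A : V →L[ℝ] W) :
    pairing σ μ π f x τ t A (fun _ => 0) = A (x t) := by
  simp [pairing]

theorem intervalIntegrable_clm_apply {A : ℝ → V →L[ℝ] W} (hA : Continuous A) {u : ℝ → V} {a b : ℝ}
    (hu : IntervalIntegrable u volume a b) :
    IntervalIntegrable (fun s => A s (u s)) volume a b := by
  obtain ⟨C, hC⟩ := isCompact_uIcc.exists_bound_of_continuousOn (hA.continuousOn (s := uIcc a b))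
  rw [intervalIntegrable_iff] at hu ⊢
  refine (hu.norm.const_mul C).mono' ?_ ?_
  · exact (ContinuousLinearMap.id ℝ (V →L[ℝ] W)).aestronglyMeasurable_comp₂
      hA.aestronglyMeasurable hu.aestronglyMeasurable
  · filter_upwards [ae_restrict_mem measurableSet_uIoc] with s hs
    exact (A s).le_of_opNorm_le (hC s (uIoc_subset_uIcc hs)) _

end

section Costate

variable {V U : Type*} [NormedAddCommGroup V] [InnerProductSpace ℝ V] [CompleteSpace V]
  [NormedAddCommGroup U] [InnerProductSpace ℝ U] [CompleteSpace U] {T : ℝ}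

/-- Costates: the values of a linear functional of the state on the present and on the history. -/
abbrev Costate (V : Type*) [NormedAddCommGroup V] (T : ℝ) : Type _ := V × C(Icc (0 : ℝ) T, V)

end Costate

section Slice

variable {V W Z : Type*} [NormedAddCommGroup V] [NormedSpace ℝ V] [NormedAddCommGroup W]
  [NormedSpace ℝ W] [MetricSpace Z] [CompactSpace Z]

omit [CompactSpace Z] in
theorem continuous_toCLM_apply (k : C(Z, Op V W)) (v : V) : Continuous fun ξ => (k ξ).toCLM v :=
  (Op.toCLM.continuous.comp k.continuous).clm_apply continuous_const

/-- The operator `v ↦ (ξ ↦ k ξ v)`. -/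
noncomputable def slice (k : C(Z, Op V W)) : Op V C(Z, W) :=
  Op.ofCLM <| LinearMap.mkContinuous
    { toFun := fun v => ⟨fun ξ => (k ξ).toCLM v, continuous_toCLM_apply k v⟩
      map_add' := fun v w => ContinuousMap.ext fun ξ => (k ξ).toCLM.map_add v w
      map_smul' := fun c v => ContinuousMap.ext fun ξ => (k ξ).toCLM.map_smul c v } ‖k‖ fun v =>
    (ContinuousMap.norm_le _ (by positivity)).2 fun ξ =>
      (k ξ).toCLM.le_of_opNorm_le (k.norm_coe_le_norm ξ) v

theorem norm_slice_le (k : C(Z, Op V W)) : ‖slice k‖ ≤ ‖k‖ :=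
  (slice k).toCLM.opNorm_le_bound (norm_nonneg _) fun v =>
    (ContinuousMap.norm_le _ (by positivity)).2 fun ξ =>
      (k ξ).toCLM.le_of_opNorm_le (k.norm_coe_le_norm ξ) v

theorem slice_add (k l : C(Z, Op V W)) : slice (k + l) = slice k + slice l :=
  ContinuousLinearMap.ext fun _ => ContinuousMap.ext fun _ => rfl

theorem slice_smul (c : ℝ) (k : C(Z, Op V W)) : slice (c • k) = c • slice k :=
  ContinuousLinearMap.ext fun _ => ContinuousMap.ext fun _ => rfl

noncomputable def sliceCLM : C(Z, Op V W) →L[ℝ] Op V C(Z, W) :=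
  LinearMap.mkContinuous
    { toFun := slice, map_add' := slice_add, map_smul' := slice_smul } 1 fun k => by
      rw [one_mul]; exact norm_slice_le k

/-- The operator `v ↦ (A v, ξ ↦ k ξ v)`. -/
noncomputable def column : (Op V V × C(Z, Op V W)) →L[ℝ] Op V (V × C(Z, W)) :=
  Op.ofCLM ∘L (ContinuousLinearMap.compL ℝ V V (V × C(Z, W)) (ContinuousLinearMap.inl ℝ _ _)) ∘L
      Op.toCLM ∘L ContinuousLinearMap.fst ℝ _ _ +
    Op.ofCLM ∘L (ContinuousLinearMap.compL ℝ V C(Z, W) (V × C(Z, W))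
      (ContinuousLinearMap.inr ℝ _ _)) ∘L Op.toCLM ∘L sliceCLM ∘L ContinuousLinearMap.snd ℝ _ _

theorem column_apply (p : Op V V × C(Z, Op V W)) (v : V) :
    (column p).toCLM v = (p.1.toCLM v, (slice p.2).toCLM v) := by
  change (p.1.toCLM v, (0 : C(Z, W))) + (0, (slice p.2).toCLM v) = _
  simp

theorem column_fst (p : Op V V × C(Z, Op V W)) (v : V) :
    ((column p).toCLM v).1 = p.1.toCLM v := by rw [column_apply]

theorem column_snd (p : Op V V × C(Z, Op V W)) (v : V) (ξ : Z) :
    ((column p).toCLM v).2 ξ = (p.2 ξ).toCLM v := by rw [column_apply]; rfl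

end Slice

section Columns

variable {V U : Type*} [NormedAddCommGroup V] [InnerProductSpace ℝ V] [CompleteSpace V]
  [NormedAddCommGroup U] [InnerProductSpace ℝ U] [CompleteSpace U] {T : ℝ}

noncomputable def adjointOp (V : Type*) [NormedAddCommGroup V] [InnerProductSpace ℝ V]
    [CompleteSpace V] : Op V V →L[ℝ] Op V V := Op.ofCLM ∘L adjointCLM V ∘L Op.toCLM

/-- The kernels of a quadratic form as a function on the disjoint union of a point and `[0, T]` with
values in the operators from the state at a point to costates. -/
noncomputable def columns : Kernels V T →L[ℝ]
    Op V (Costate V T) × C(Icc (0 : ℝ) T, Op V (Costate V T)) :=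
  ContinuousLinearMap.prod
    (column ∘L ContinuousLinearMap.prod (ContinuousLinearMap.fst ℝ _ _)
      ((adjointOp V).compLeftContinuous ℝ (Icc (0 : ℝ) T) ∘L ContinuousLinearMap.fst ℝ _ _ ∘L
        ContinuousLinearMap.snd ℝ _ _) ∘L Kernels.toProd)
    (((column ∘L ContinuousLinearMap.inl ℝ _ _).compLeftContinuous ℝ (Icc (0 : ℝ) T) ∘L
        ContinuousLinearMap.fst ℝ _ _ +
      (column ∘L ContinuousLinearMap.inr ℝ _ _).compLeftContinuous ℝ (Icc (0 : ℝ) T) ∘L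
        ContinuousLinearMap.snd ℝ _ _) ∘L ContinuousLinearMap.snd ℝ _ _ ∘L Kernels.toProd)

open Kernels

theorem columns_fst_fst (y : Kernels V T) (v : V) : ((columns y).1.toCLM v).1 = P₀ y v :=
  column_fst _ v

theorem columns_fst_snd (y : Kernels V T) (v : V) (r : Icc (0 : ℝ) T) :
    ((columns y).1.toCLM v).2 r = adjoint (P₁ y r) v := column_snd _ v r

theorem columns_snd_fst (y : Kernels V T) (ξ : Icc (0 : ℝ) T) (v : V) :
    (((columns y).2 ξ).toCLM v).1 = P₁ y ξ v := by
  change ((column (y.toProd.2.1 ξ, 0) + column (0, y.toProd.2.2 ξ)).toCLM v).1 = _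
  rw [← map_add, column_fst]
  simp [P₁]

theorem columns_snd_snd (y : Kernels V T) (ξ : Icc (0 : ℝ) T) (v : V) (r : Icc (0 : ℝ) T) :
    (((columns y).2 ξ).toCLM v).2 r = K y ξ r v := by
  change ((column (y.toProd.2.1 ξ, 0) + column (0, y.toProd.2.2 ξ)).toCLM v).2 r = _
  rw [← map_add, column_snd]
  simp [K]

/-- A costate as a functional. -/
noncomputable def innerCLM : Costate V T →L[ℝ] Op V ℝ × C(Icc (0 : ℝ) T, Op V ℝ) :=
  ContinuousLinearMap.prod
    (Op.ofCLM ∘L innerSL ℝ ∘L ContinuousLinearMap.fst ℝ _ _)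
    ((Op.ofCLM ∘L innerSL ℝ).compLeftContinuous ℝ (Icc (0 : ℝ) T) ∘L ContinuousLinearMap.snd ℝ _ _)

omit [CompleteSpace V] in
theorem innerCLM_fst (p : Costate V T) : (innerCLM p).1.toCLM = innerSL ℝ p.1 := rfl

omit [CompleteSpace V] in
theorem innerCLM_snd (p : Costate V T) (ξ : Icc (0 : ℝ) T) :
    ((innerCLM p).2 ξ).toCLM = innerSL ℝ (p.2 ξ) := rfl

end Columns
end VolterraLQ
end

section
open MeasureTheory Set ContinuousLinearMap
open scoped ENNReal NNReal Topology

namespace VolterraLQ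

/-! ### The fundamental identity: completing the square -/

section Energy

variable {V U Ω : Type*} [NormedAddCommGroup V] [InnerProductSpace ℝ V] [CompleteSpace V]
  [NormedAddCommGroup U] [InnerProductSpace ℝ U] [CompleteSpace U] [MeasurableSpace Ω]

-- The components of the Riccati field, as functions of the point of the state on which they act,
-- have the shape `L ∘ P - M ∘ N - C`. Paired with the state they yield a feedback term, a memory
-- term and a remainder.
omit [CompleteSpace V] in
theorem pairing_comp_sub_comp_sub {W W' Z : Type*} [NormedAddCommGroup W] [NormedSpace ℝ W]
    [NormedAddCommGroup W'] [NormedSpace ℝ W'] [CompleteSpace W] [CompleteSpace W']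
    [MetricSpace Z] [CompactSpace Z] [MeasurableSpace Z] [BorelSpace Z]
    {σ : ℝ → Z} {μ : Measure Ω} {π : Ω → Z} {f : Ω → V} {x : ℝ → V} {τ t : ℝ}
    (hσ : Continuous σ) (hx : Continuous x) (hπ : Measurable π) (hf : Integrable f μ)
    (L M : W →L[ℝ] W') (G₀ H₀ : V →L[ℝ] W) (A : V →L[ℝ] W') {G₁ H₁ : Z → V →L[ℝ] W}
    {C : Z → V →L[ℝ] W'} (hG : Continuous G₁) (hH : Continuous H₁) (hC : Continuous C) :
    pairing σ μ π f x τ t (L ∘L G₀ - M ∘L H₀ - A) (fun z => L ∘L G₁ z - M ∘L H₁ z - C z) =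
      L (pairing σ μ π f x τ t G₀ G₁) - M (pairing σ μ π f x τ t H₀ H₁) -
        pairing σ μ π f x τ t A C := by
  have h1 : Continuous fun z => L ∘L G₁ z := continuous_const.clm_comp hG
  have h2 : Continuous fun z => M ∘L H₁ z := continuous_const.clm_comp hH
  rw [pairing_sub (G₁ := fun z => L ∘L G₁ z - M ∘L H₁ z) hσ hx hπ hf _ _ (h1.sub h2) hC,
    pairing_sub hσ hx hπ hf _ _ h1 h2,
    pairing_clm_comp hσ hx hπ hf _ _ hG, pairing_clm_comp hσ hx hπ hf _ _ hH]

open Kernels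

namespace Data

variable (D : Data V U)

/-- The part of the velocity at time `t` that is due to the memory. -/
noncomputable def memory (μ : Measure Ω) (π : Ω → Icc (0 : ℝ) D.T) (f : Ω → V) (x : ℝ → V)
    (τ t : ℝ) : V :=
  pairing D.σ μ π f x τ t 0 fun ξ => D.N (t - ξ)

/-- `x` is the trajectory on `[τ, T]` with history `f` at the points `π` and with control `u`. -/
structure IsTraj (μ : Measure Ω) (π : Ω → Icc (0 : ℝ) D.T) (f : Ω → V) (τ : ℝ) (u : ℝ → U)
    (x : ℝ → V) : Prop where
  continuous : Continuous x
  intervalIntegrable : IntervalIntegrable u volume τ D.T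
  eqn : ∀ t ∈ Icc τ D.T, x t = x τ + ∫ s in τ..t, (D.memory μ π f x τ s + D.B (u s))

/-- The derivative of the quadratic form with kernels `y` in the direction of the state. -/
noncomputable def costate (μ : Measure Ω) (π : Ω → Icc (0 : ℝ) D.T) (f : Ω → V) (x : ℝ → V)
    (τ t : ℝ) (y : Kernels V D.T) : Costate V D.T :=
  pairing D.σ μ π f x τ t (columns y).1.toCLM fun ξ => ((columns y).2 ξ).toCLM

/-- The quadratic form with kernels `y` at the state at time `t`. -/
noncomputable def form (μ : Measure Ω) (π : Ω → Icc (0 : ℝ) D.T) (f : Ω → V) (x : ℝ → V)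
    (τ t : ℝ) (y : Kernels V D.T) : ℝ :=
  pairing D.σ μ π f x τ t (innerSL ℝ (D.costate μ π f x τ t y).1)
    fun ξ => innerSL ℝ ((D.costate μ π f x τ t y).2 ξ)

variable {D} {μ : Measure Ω} {π : Ω → Icc (0 : ℝ) D.T} {f : Ω → V} {τ t s : ℝ} {u : ℝ → U}
  {x : ℝ → V} {y : ℝ → Kernels V D.T}

theorem costate_fst (hx : Continuous x) (hπ : Measurable π) (hf : Integrable f μ)
    (y : Kernels V D.T) :
    (D.costate μ π f x τ t y).1 = pairing D.σ μ π f x τ t (P₀ y) (P₁ y) := by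
  have := pairing_clm_comp (τ := τ) (t := t) (D.continuous_σ continuous_id : Continuous D.σ) hx hπ hf
    (ContinuousLinearMap.fst ℝ V C(Icc (0 : ℝ) D.T, V)) (columns y).1.toCLM
    (G₁ := fun ξ => ((columns y).2 ξ).toCLM) (Op.toCLM.continuous.comp (columns y).2.continuous)
  refine Eq.trans this.symm ?_
  congr 1
  · ext v
    exact columns_fst_fst y v
  · funext ξ
    ext v
    exact columns_snd_fst y ξ v

theorem costate_snd (hx : Continuous x) (hπ : Measurable π) (hf : Integrable f μ)
    (y : Kernels V D.T) (r : Icc (0 : ℝ) D.T) :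
    (D.costate μ π f x τ t y).2 r =
      pairing D.σ μ π f x τ t (adjoint (P₁ y r)) fun ξ => K y ξ r := by
  have := pairing_clm_comp (τ := τ) (t := t) (D.continuous_σ continuous_id : Continuous D.σ) hx hπ hf
    (ContinuousMap.evalCLM ℝ r ∘L ContinuousLinearMap.snd ℝ V C(Icc (0 : ℝ) D.T, V))
    (columns y).1.toCLM
    (G₁ := fun ξ => ((columns y).2 ξ).toCLM) (Op.toCLM.continuous.comp (columns y).2.continuous)
  refine Eq.trans this.symm ?_
  congr 1
  · ext v
    exact columns_fst_snd y v r
  · funext ξ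
    ext v
    exact columns_snd_snd y ξ v r

theorem continuous_memory (hx : Continuous x) (hπ : Measurable π) (hf : Integrable f μ) :
    Continuous fun t => D.memory μ π f x τ t :=
  continuous_pairing (D.continuous_σ continuous_id : Continuous D.σ) hx hπ hf continuous_const (by fun_prop)

theorem continuous_costate (hx : Continuous x) (hπ : Measurable π) (hf : Integrable f μ)
    (hy : Continuous y) : Continuous fun t => D.costate μ π f x τ t (y t) := by
  have h := columns.continuous.comp hy
  refine continuous_pairing (D.continuous_σ continuous_id : Continuous D.σ) hx hπ hf
    (G₀ := fun t => (columns (y t)).1.toCLM) (G₁ := fun t ξ => ((columns (y t)).2 ξ).toCLM)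
    (Op.toCLM.continuous.comp h.fst) (Op.toCLM.continuous.comp ?_)
  exact (by fun_prop : Continuous fun q : C(Icc (0 : ℝ) D.T, Op V (Costate V D.T)) ×
    Icc (0 : ℝ) D.T => q.1 q.2).comp ((h.snd.comp continuous_fst).prodMk continuous_snd)

theorem IsTraj.intervalIntegrable_velocity (h : D.IsTraj μ π f τ u x) (hπ : Measurable π)
    (hf : Integrable f μ) :
    IntervalIntegrable (fun s => D.memory μ π f x τ s + D.B (u s)) volume τ D.T :=
  ((continuous_memory h.continuous hπ hf).intervalIntegrable _ _).add
    (intervalIntegrable_clm_apply continuous_const h.intervalIntegrable)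

variable (D) in
/-- The derivative of the costate along a trajectory, in raw form. -/
noncomputable def costateRate (μ : Measure Ω) (π : Ω → Icc (0 : ℝ) D.T) (f : Ω → V) (τ : ℝ)
    (u : ℝ → U) (x : ℝ → V) (y : ℝ → Kernels V D.T) (s : ℝ) : Costate V D.T :=
  (columns (y s)).1.toCLM (D.memory μ π f x τ s + D.B (u s)) +
    ((columns (y s)).2 (D.σ s)).toCLM (x s) + D.costate μ π f x τ s (D.field s (y s))

theorem intervalIntegrable_costateRate (h : D.IsTraj μ π f τ u x) (hπ : Measurable π)
    (hf : Integrable f μ) (hy : Continuous y) :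
    IntervalIntegrable (D.costateRate μ π f τ u x y) volume τ D.T := by
  have hc := columns.continuous.comp hy
  have hx := h.continuous
  refine ((intervalIntegrable_clm_apply (A := fun s => (columns (y s)).1.toCLM)
    (Op.toCLM.continuous.comp hc.fst) (h.intervalIntegrable_velocity hπ hf)).add
    (Continuous.intervalIntegrable ?_ _ _)).add (Continuous.intervalIntegrable ?_ _ _)
  · refine Continuous.clm_apply (f := fun s => ((columns (y s)).2 (D.σ s)).toCLM)
      (Op.toCLM.continuous.comp ?_) hx
    exact (by fun_prop : Continuous fun q : C(Icc (0 : ℝ) D.T, Op V (Costate V D.T)) ×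
      Icc (0 : ℝ) D.T => q.1 q.2).comp (hc.snd.prodMk (D.continuous_σ continuous_id : Continuous D.σ))
  · exact continuous_costate hx hπ hf (by fun_prop)

theorem costate_eq_add_integral (h : D.IsTraj μ π f τ u x) (hπ : Measurable π)
    (hf : Integrable f μ) (hy : D.IsRiccati τ y) (ht : t ∈ Icc τ D.T) :
    D.costate μ π f x τ t (y t) = D.costate μ π f x τ τ (y τ) +
      ∫ s in τ..t, D.costateRate μ π f τ u x y s := by
  refine pairing_eq_pairing_add_integral (G := fun t => columns (y t))
    (g := fun s => columns (D.field s (y s))) (D.continuous_σ continuous_id : Continuous D.σ) h.continuous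
    (h.intervalIntegrable_velocity hπ hf) h.eqn hπ hf
    ((columns.continuous.comp hy.continuous_field).intervalIntegrable _ _) (fun t ht => ?_) ht
  rw [hy.eq_add_integral ht, map_add, ← columns.intervalIntegral_comp_comm
    (hy.continuous_field.intervalIntegrable _ _)]

variable (D) in
/-- The deviation of the control from the feedback law. -/
noncomputable def deviation (μ : Measure Ω) (π : Ω → Icc (0 : ℝ) D.T) (f : Ω → V) (τ : ℝ)
    (u : ℝ → U) (x : ℝ → V) (y : ℝ → Kernels V D.T) (s : ℝ) : U :=
  u s + adjoint D.B (D.costate μ π f x τ s (y s)).1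

/-- The Riccati equations are made for this cancellation: the terms with `memory` and with `P₁ (σ s)
(x s)` disappear, and `S p` joins `B u` to form `B` of the deviation. With zero deviation, this and
the next lemma are the adjoint equations of the maximum principle. -/
theorem costateRate_fst (hx : Continuous x) (hπ : Measurable π)
    (hf : Integrable f μ) (hy : D.IsRiccati τ y) (hs : s ∈ Icc τ D.T) :
    (D.costateRate μ π f τ u x y s).1 = P₀ (y s) (D.B (D.deviation μ π f τ u x y s)) -
      (D.costate μ π f x τ s (y s)).2 (D.σ s) - D.Q (x s) := by
  have hσ : Continuous D.σ := D.continuous_σ continuous_id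
  have hc₁ : Continuous fun ξ => P₁ (y s) ξ := by fun_prop
  have hc₂ : Continuous fun ξ => K (y s) ξ (D.σ s) := by fun_prop
  have hc₃ : Continuous fun ξ => K (y s) ξ (D.σ s) + 0 := by fun_prop
  have hN : Continuous fun ξ : Icc (0 : ℝ) D.T => D.N (s - ξ) := by fun_prop
  have h0 : D.field₀ s (y s) = (P₀ (y s) ∘L D.S) ∘L P₀ (y s) - P₀ (y s) ∘L 0 -
      (adjoint (P₁ (y s) (D.σ s)) + (D.Q + P₁ (y s) (D.σ s))) := by
    rw [field₀, hy.adjoint_P₀ hs, comp_zero, comp_assoc]; abel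
  have h1 : P₁ (D.field s (y s)) = fun ξ => (P₀ (y s) ∘L D.S) ∘L P₁ (y s) ξ -
      P₀ (y s) ∘L D.N (s - ξ) - (K (y s) ξ (D.σ s) + 0) := by
    funext ξ
    rw [P₁_field, field₁, comp_assoc, add_zero]
  have h2 : (D.costate μ π f x τ s (D.field s (y s))).1 =
      P₀ (y s) (D.S (D.costate μ π f x τ s (y s)).1) - P₀ (y s) (D.memory μ π f x τ s) -
      ((D.costate μ π f x τ s (y s)).2 (D.σ s) + (D.Q (x s) + P₁ (y s) (D.σ s) (x s))) := by
    rw [costate_fst hx hπ hf, P₀_field, h0, h1,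
      pairing_comp_sub_comp_sub hσ hx hπ hf _ _ _ _ _ hc₁ hN hc₃,
      pairing_add hσ hx hπ hf _ _ hc₂ continuous_const, pairing_zero_right,
      costate_fst hx hπ hf, costate_snd hx hπ hf]
    rfl
  rw [costateRate, Prod.fst_add, Prod.fst_add, columns_fst_fst, columns_snd_fst, h2, deviation]
  simp only [map_add, S, ContinuousLinearMap.comp_apply]
  abel

theorem costateRate_snd (hx : Continuous x) (hπ : Measurable π)
    (hf : Integrable f μ) (hy : D.IsRiccati τ y) (hs : s ∈ Icc τ D.T) (r : Icc (0 : ℝ) D.T) :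
    (D.costateRate μ π f τ u x y s).2 r =
      adjoint (P₁ (y s) r) (D.B (D.deviation μ π f τ u x y s)) -
      adjoint (D.N (s - r)) (D.costate μ π f x τ s (y s)).1 := by
  have hσ : Continuous D.σ := D.continuous_σ continuous_id
  have hc₁ : Continuous fun ξ => P₁ (y s) ξ := by fun_prop
  have hN : Continuous fun ξ : Icc (0 : ℝ) D.T => D.N (s - ξ) := by fun_prop
  -- The component at `r` of a costate sees the present through the adjoint of `P₁`; the symmetries
  -- of `P₀` and `K` bring the adjoint equation into the same shape as the equation for `K`.
  have h0 : adjoint (D.field₁ s (y s) r) =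
      (adjoint (P₁ (y s) r) ∘L D.S - adjoint (D.N (s - r))) ∘L P₀ (y s) -
      adjoint (P₁ (y s) r) ∘L 0 - K (y s) (D.σ s) r := by
    rw [field₁, map_sub, map_sub, adjoint_comp, adjoint_comp, adjoint_comp, hy.adjoint_P₀ hs,
      hy.adjoint_K hs, adjoint_S, comp_zero, sub_zero, sub_comp, comp_assoc]
  have h1 : (fun ξ => K (D.field s (y s)) ξ r) = fun ξ =>
      (adjoint (P₁ (y s) r) ∘L D.S - adjoint (D.N (s - r))) ∘L P₁ (y s) ξ -
      adjoint (P₁ (y s) r) ∘L D.N (s - ξ) - 0 := by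
    funext ξ
    rw [K_field, field₂, sub_comp, sub_zero, sub_right_comm]; rfl
  have h2 : (D.costate μ π f x τ s (D.field s (y s))).2 r =
      (adjoint (P₁ (y s) r) ∘L D.S - adjoint (D.N (s - r))) (D.costate μ π f x τ s (y s)).1 -
      adjoint (P₁ (y s) r) (D.memory μ π f x τ s) - K (y s) (D.σ s) r (x s) := by
    rw [costate_snd hx hπ hf, P₁_field, h0, h1,
      pairing_comp_sub_comp_sub hσ hx hπ hf _ _ _ _ _ hc₁ hN continuous_const, pairing_zero_right,
      costate_fst hx hπ hf]
    rfl
  rw [costateRate, Prod.snd_add, Prod.snd_add, ContinuousMap.add_apply, ContinuousMap.add_apply,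
    columns_fst_snd, columns_snd_snd, h2, deviation]
  simp only [map_add, S, ContinuousLinearMap.comp_apply, sub_apply]
  abel

/-- The rate consists of the present column of the kernels applied to `z = B` of the deviation, and
of adjoints of `N` applied to `p`. Moving these operators to the other side of the inner product
turns the pairing with the state back into the present costate and the memory. -/
theorem pairing_costateRate (hx : Continuous x) (hπ : Measurable π)
    (hf : Integrable f μ) (hy : D.IsRiccati τ y) (hs : s ∈ Icc τ D.T) :
    pairing D.σ μ π f x τ s (innerSL ℝ (D.costateRate μ π f τ u x y s).1)
        (fun ξ => innerSL ℝ ((D.costateRate μ π f τ u x y s).2 ξ)) =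
      inner ℝ (D.B (D.deviation μ π f τ u x y s)) (D.costate μ π f x τ s (y s)).1 -
      inner ℝ (D.costate μ π f x τ s (y s)).1 (D.memory μ π f x τ s) -
      inner ℝ (D.Q (x s) + (D.costate μ π f x τ s (y s)).2 (D.σ s)) (x s) := by
  have hσ : Continuous D.σ := D.continuous_σ continuous_id
  have hc₁ : Continuous fun ξ => P₁ (y s) ξ := by fun_prop
  have hN : Continuous fun ξ : Icc (0 : ℝ) D.T => D.N (s - ξ) := by fun_prop
  set z := D.B (D.deviation μ π f τ u x y s) with hz
  set p := D.costate μ π f x τ s (y s) with hp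
  have h0 : innerSL ℝ (D.costateRate μ π f τ u x y s).1 =
      innerSL ℝ z ∘L P₀ (y s) - innerSL ℝ p.1 ∘L 0 - innerSL ℝ (D.Q (x s) + p.2 (D.σ s)) := by
    ext v
    have := adjoint_inner_left (P₀ (y s)) v z
    rw [hy.adjoint_P₀ hs] at this
    rw [costateRate_fst hx hπ hf hy hs]
    simp [this, ← hz, ← hp]
    ring
  have h1 : (fun ξ => innerSL ℝ ((D.costateRate μ π f τ u x y s).2 ξ)) = fun ξ =>
      innerSL ℝ z ∘L P₁ (y s) ξ - innerSL ℝ p.1 ∘L D.N (s - ξ) - 0 := by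
    funext ξ
    ext v
    rw [costateRate_snd hx hπ hf hy hs]
    simp [adjoint_inner_left, ← hz, ← hp]
  rw [h0, h1, pairing_comp_sub_comp_sub hσ hx hπ hf _ _ _ _ _ hc₁ hN continuous_const,
    pairing_zero_right]
  simp only [hp, costate_fst hx hπ hf]
  rfl

theorem form_terminal (hx : Continuous x) (hπ : Measurable π) (hf : Integrable f μ) :
    D.form μ π f x τ D.T D.terminal = inner ℝ (x D.T) (D.Q₀ (x D.T)) := by
  have h1 : (D.costate μ π f x τ D.T D.terminal).1 = D.Q₀ (x D.T) := by
    rw [costate_fst hx hπ hf]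
    exact pairing_zero_right _
  have h2 : ∀ r, (D.costate μ π f x τ D.T D.terminal).2 r = 0 := fun r => by
    rw [costate_snd hx hπ hf]
    refine (pairing_zero_right _).trans ?_
    change adjoint (0 : V →L[ℝ] V) _ = 0
    simp
  simp only [form, h2, map_zero, pairing_zero_right, h1]
  exact real_inner_comm _ _

/-- The fundamental identity: the cost is the value of the quadratic form, plus the square of the
deviation of the control from the feedback law. -/
theorem form_add_integral_deviation (h : D.IsTraj μ π f τ u x) (hπ : Measurable π)
    (hu : IntervalIntegrable (fun s => ‖u s‖ ^ 2) volume τ D.T)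
    (hf : Integrable f μ) (hy : D.IsRiccati τ y) (hτ : τ ≤ D.T) :
    (∫ s in τ..D.T, (inner ℝ (x s) (D.Q (x s)) + ‖u s‖ ^ 2)) + inner ℝ (x D.T) (D.Q₀ (x D.T)) =
      D.form μ π f x τ τ (y τ) + ∫ s in τ..D.T, ‖D.deviation μ π f τ u x y s‖ ^ 2 := by
  have hx := h.continuous
  have hrate := intervalIntegrable_costateRate h hπ hf hy.continuous
  have hi : IntervalIntegrable (fun s => innerCLM (D.costateRate μ π f τ u x y s)) volume τ D.T := by
    rw [intervalIntegrable_iff] at hrate ⊢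
    exact innerCLM.integrable_comp hrate
  -- A second use of the product rule: the first differentiated the costate, this one differentiates
  -- the pairing of the costate with the state.
  have key := pairing_eq_pairing_add_integral
    (G := fun t => innerCLM (D.costate μ π f x τ t (y t)))
    (g := fun s => innerCLM (D.costateRate μ π f τ u x y s)) (D.continuous_σ continuous_id : Continuous D.σ) hx
    (h.intervalIntegrable_velocity hπ hf) h.eqn hπ hf hi (fun t ht => ?_)
    (t := D.T) ⟨hτ, le_rfl⟩
  swap
  · rw [costate_eq_add_integral h hπ hf hy ht, map_add]
    congr 1
    have h3 : uIcc τ t ⊆ uIcc τ D.T := by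
      rw [uIcc_of_le ht.1, uIcc_of_le hτ]; exact Icc_subset_Icc_right ht.2
    exact (innerCLM.intervalIntegral_comp_comm (hrate.mono_set h3)).symm
  have h4 : D.form μ π f x τ D.T (y D.T) = inner ℝ (x D.T) (D.Q₀ (x D.T)) := by
    rw [hy.apply_T hτ, form_terminal hx hπ hf]
  have hp : Continuous fun s => adjoint D.B (D.costate μ π f x τ s (y s)).1 :=
    (adjoint D.B).continuous.comp (continuous_costate hx hπ hf hy.continuous).fst
  have hd : IntervalIntegrable (fun s => ‖D.deviation μ π f τ u x y s‖ ^ 2) volume τ D.T := by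
    have h5 : (fun s => ‖D.deviation μ π f τ u x y s‖ ^ 2) = fun s => ‖u s‖ ^ 2 +
        2 * inner ℝ (adjoint D.B (D.costate μ π f x τ s (y s)).1) (u s) +
        ‖adjoint D.B (D.costate μ π f x τ s (y s)).1‖ ^ 2 := by
      funext s
      rw [deviation, norm_add_sq_real, real_inner_comm]
    rw [h5]
    refine (hu.add (IntervalIntegrable.const_mul ?_ 2)).add
      ((hp.norm.pow 2).intervalIntegrable _ _)
    exact intervalIntegrable_clm_apply (A := fun s => innerSL ℝ _) ((innerSL ℝ).continuous.comp hp)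
      h.intervalIntegrable
  have hc : IntervalIntegrable (fun s => inner ℝ (x s) (D.Q (x s)) + ‖u s‖ ^ 2) volume τ D.T :=
    (Continuous.intervalIntegrable (by fun_prop) _ _).add hu
  have h6 : ∫ s in τ..D.T, ((innerCLM (D.costate μ π f x τ s (y s))).1.toCLM
        (D.memory μ π f x τ s + D.B (u s)) +
      ((innerCLM (D.costate μ π f x τ s (y s))).2 (D.σ s)).toCLM (x s) +
      pairing D.σ μ π f x τ s (innerCLM (D.costateRate μ π f τ u x y s)).1.toCLM
        fun ξ => ((innerCLM (D.costateRate μ π f τ u x y s)).2 ξ).toCLM) =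
      ∫ s in τ..D.T, (‖D.deviation μ π f τ u x y s‖ ^ 2 -
        (inner ℝ (x s) (D.Q (x s)) + ‖u s‖ ^ 2)) := by
    -- The memory terms and the terms with the costate at `σ s` cancel. What remains is `⟨p, B u⟩ +
    -- ⟨B d, p⟩ - ⟨Q x, x⟩` with `d = u + B* p`, that is, `|d|² - |u|² - ⟨Q x, x⟩`.
    refine intervalIntegral.integral_congr fun s hs => ?_
    rw [uIcc_of_le hτ] at hs
    simp only [innerCLM_fst, innerCLM_snd]
    rw [pairing_costateRate hx hπ hf hy hs]
    set p := D.costate μ π f x τ s (y s) with hp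
    simp only [innerSL_apply_apply, inner_add_left, deviation, ← hp, map_add]
    rw [real_inner_comm (D.Q (x s)), norm_add_sq_real, ← adjoint_inner_left D.B (u s) p.1,
      ← adjoint_inner_right D.B (u s) p.1, ← adjoint_inner_right D.B _ p.1,
      real_inner_self_eq_norm_sq, real_inner_comm (u s)]
    ring
  have h7 : D.form μ π f x τ D.T (y D.T) = D.form μ π f x τ τ (y τ) + _ := key
  rw [h6, intervalIntegral.integral_sub hd hc, h4] at h7
  rw [h7]
  ring

end Data

end Energy
end VolterraLQ
end

section
open MeasureTheory Set ContinuousLinearMap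
open scoped ENNReal NNReal Topology

namespace VolterraLQ

/-! ### Linear Volterra equations as linear differential equations -/

section LinearVolterra

variable {V Ω : Type*} [NormedAddCommGroup V] [NormedSpace ℝ V] [CompleteSpace V]
  [MeasurableSpace Ω] {Z : Type*} [MetricSpace Z] [CompactSpace Z] [MeasurableSpace Z]
  [BorelSpace Z] {σ : ℝ → Z} {μ : Measure Ω} {π : Ω → Z} {f : Ω → V}

/-- Linear Volterra equations with a given history are solvable. -/
theorem exists_linear_volterra_solution {T : ℝ} (hT : 0 ≤ T) (hσ : Continuous σ) (hπ : Measurable π)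
    (hf : Integrable f μ) {τ a m : ℝ} (hτ : τ ∈ Icc 0 T) {A : ℝ → V →L[ℝ] V} (hA : Continuous A)
    {M : ℝ → Z → V →L[ℝ] V} (hM : Continuous fun p : ℝ × Z => M p.1 p.2)
    (ha : ∀ t ∈ Icc 0 T, ‖A t‖ ≤ a) (hm : ∀ t ∈ Icc 0 T, ∀ z, ‖M t z‖ ≤ m) (x₀ : V) :
    ∃ x : ℝ → V, Continuous x ∧
      (∀ t ∈ Icc τ T, x t = x₀ + ∫ s in τ..t, pairing σ μ π f x τ s (A s) (M s)) ∧
      ∀ t ∈ Icc τ T, ‖x t‖ ≤ gronwallBound ‖x₀‖ (a + m + 1) (m * ∫ ω, ‖f ω‖ ∂μ) (T - τ) := by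
  have hsub : ∀ t ∈ Icc τ T, t ∈ Icc 0 T := fun t ht => ⟨hτ.1.trans ht.1, ht.2⟩
  have ha0 : 0 ≤ a := (norm_nonneg _).trans (ha τ hτ)
  have hm0 : 0 ≤ m * ∫ ω, ‖f ω‖ ∂μ := by
    rw [← integral_const_mul]
    exact integral_nonneg fun ω => mul_nonneg
      ((norm_nonneg _).trans (hm τ hτ (π ω))) (norm_nonneg _)
  let ρ : ℝ → Icc (0 : ℝ) T := projIcc 0 T hT
  have hρ : Continuous ρ := continuous_projIcc
  have hm' : 0 ≤ m := (norm_nonneg _).trans (hm τ hτ (σ 0))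
  let k : ℝ → C(Icc (0 : ℝ) T, Op V V) := ContinuousMap.curry
    ⟨fun p : ℝ × Icc (0 : ℝ) T => Op.ofCLM (M p.2 (σ p.1)), Op.ofCLM.continuous.comp
      (hM.comp ((continuous_subtype_val.comp continuous_snd).prodMk (hσ.comp continuous_fst)))⟩
  have hk : Continuous k := ContinuousMap.continuous _
  have hkn : ∀ t, ‖k t‖ ≤ m := fun t => (ContinuousMap.norm_le _ hm').2 fun θ => hm θ θ.2 _
  -- The state is augmented by a forecast: at time `t` the second component is the function `θ ↦
  -- ∫_τ^t M θ (σ r) (x r) dr`, the contribution of the past so far to the velocity at time `θ`. The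
  -- current memory is its value at `ρ t`, and its own rate is `θ ↦ M θ (σ t) (x t)`, so the delay
  -- disappears.
  let F : ℝ → (V × C(Icc (0 : ℝ) T, V)) →L[ℝ] V × C(Icc (0 : ℝ) T, V) := fun t =>
    (A t ∘L ContinuousLinearMap.fst ℝ _ _ +
      ContinuousMap.evalCLM ℝ (ρ t) ∘L ContinuousLinearMap.snd ℝ _ _).prod
      ((slice (k t)).toCLM ∘L ContinuousLinearMap.fst ℝ _ _)
  have hF : Continuous fun p : ℝ × (V × C(Icc (0 : ℝ) T, V)) => F p.1 p.2 := by
    have h1 : Continuous fun p : ℝ × (V × C(Icc (0 : ℝ) T, V)) => A p.1 p.2.1 + p.2.2 (ρ p.1) := by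
      fun_prop
    have h2 : Continuous fun p : ℝ × (V × C(Icc (0 : ℝ) T, V)) => (slice (k p.1)).toCLM p.2.1 :=
      (Op.toCLM.continuous.comp (sliceCLM.continuous.comp (hk.comp continuous_fst))).clm_apply
        (by fun_prop)
    exact h1.prodMk h2
  have hFn : ∀ t ∈ Icc τ T, ‖F t‖ ≤ a + m + 1 := fun t ht => by
    refine ContinuousLinearMap.opNorm_le_bound _ (by positivity) fun p => ?_
    have h1 : ‖A t p.1‖ ≤ a * ‖p‖ :=
      ((A t).le_of_opNorm_le (ha t (hsub t ht)) _).trans (by gcongr; exact norm_fst_le p)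
    have h2 : ‖p.2 (ρ t)‖ ≤ ‖p‖ := (p.2.norm_coe_le_norm _).trans (norm_snd_le p)
    have h3 : ‖(slice (k t)).toCLM p.1‖ ≤ m * ‖p‖ :=
      ((slice (k t)).toCLM.le_of_opNorm_le ((norm_slice_le _).trans (hkn t)) _).trans
        (by gcongr; exact norm_fst_le p)
    have h4 := norm_nonneg p
    refine max_le ((norm_add_le _ _).trans ((add_le_add h1 h2).trans ?_)) (h3.trans ?_)
    · nlinarith
    · nlinarith
  let h : ℝ → V := fun t => ∫ ω, M t (π ω) (f ω) ∂μ
  have hh : Continuous h := by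
    let g : C(ℝ, C(Z, Op V V)) :=
      ContinuousMap.curry ⟨fun p : ℝ × Z => Op.ofCLM (M p.1 p.2), Op.ofCLM.continuous.comp hM⟩
    exact (historyCLM V hπ hf).continuous.comp g.continuous
  have hhn : ∀ t ∈ Icc τ T, ‖((h t, 0) : V × C(Icc (0 : ℝ) T, V))‖ ≤ m * ∫ ω, ‖f ω‖ ∂μ :=
    fun t ht => by
    refine max_le ?_ (norm_zero.trans_le hm0)
    rw [← integral_const_mul]
    exact norm_integral_le_of_norm_le (hf.norm.const_mul _)
      (.of_forall fun ω => (M t (π ω)).le_of_opNorm_le (hm t (hsub t ht) _) _)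
  obtain ⟨y, hyc, hy, hyn⟩ := exists_linear_integral_solution (g := fun t => (h t, 0)) hF
    (hh.prodMk continuous_const) hτ.2 hFn hhn (x₀, 0)
  have hnorm : ‖((x₀, 0) : V × C(Icc (0 : ℝ) T, V))‖ = ‖x₀‖ := by
    rw [Prod.norm_mk, norm_zero, max_eq_left (norm_nonneg _)]
  have hint : ∀ t, IntervalIntegrable (fun s => F s (y s) + (h s, 0)) volume τ t := fun t =>
    ((hF.comp (continuous_id.prodMk hyc)).add (hh.prodMk continuous_const)).intervalIntegrable _ _
  have hx : Continuous fun t => (y t).1 := hyc.fst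
  refine ⟨fun t => (y t).1, hx, fun t ht => ?_, fun t ht => (_root_.norm_fst_le _).trans ?_⟩
  · have hL : ∀ L : (V × C(Icc (0 : ℝ) T, V)) →L[ℝ] V, ∀ s ∈ Icc τ T,
        L (y s) = L (x₀, 0) + ∫ r in τ..s, L (F r (y r) + (h r, 0)) := fun L s hs => by
      rw [L.intervalIntegral_comp_comm (hint s), ← map_add, ← hy s hs]
    -- The forecast for a fixed time is integrated first and only then evaluated at that time.
    have hfut : ∀ s ∈ Icc τ T, (y s).2 (ρ s) = ∫ r in τ..s, M s (σ r) (y r).1 := fun s hs => by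
      refine (hL (ContinuousMap.evalCLM ℝ (ρ s) ∘L ContinuousLinearMap.snd ℝ _ _) s hs).trans
        ((zero_add _).trans (intervalIntegral.integral_congr fun r _ => ?_))
      change M (ρ s) (σ r) (y r).1 + 0 = _
      rw [add_zero]
      congr 2
      exact congrArg Subtype.val (projIcc_of_mem hT (hsub s hs))
    refine (hL (ContinuousLinearMap.fst ℝ _ _) t ht).trans
      (congrArg (x₀ + ·) (intervalIntegral.integral_congr fun s hs => ?_))
    rw [uIcc_of_le ht.1] at hs
    change A s (y s).1 + (y s).2 (ρ s) + h s = A s (y s).1 + (h s + _)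
    rw [hfut s ⟨hs.1, hs.2.trans ht.2⟩]
    abel
  · rw [← hnorm]
    exact hyn t ht

end LinearVolterra

/-! ### The closed loop, the free motion, and two-sided bounds for the form -/

section Bound

variable {V U Ω : Type*} [NormedAddCommGroup V] [InnerProductSpace ℝ V] [CompleteSpace V]
  [NormedAddCommGroup U] [InnerProductSpace ℝ U] [CompleteSpace U] [MeasurableSpace Ω]

open Kernels

namespace Data

variable {D : Data V U} {μ : Measure Ω} {π : Ω → Icc (0 : ℝ) D.T} {f : Ω → V} {τ t s : ℝ} {u : ℝ → U}
  {x : ℝ → V} {y : ℝ → Kernels V D.T}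

theorem form_initial (hx : Continuous x) (hπ : Measurable π) (hf : Integrable f μ)
    (y : Kernels V D.T) : D.form μ π f x τ τ y =
    inner ℝ (P₀ y (x τ) + ∫ ω, P₁ y (π ω) (f ω) ∂μ) (x τ) +
      ∫ ω', inner ℝ (adjoint (P₁ y (π ω')) (x τ) + ∫ ω, K y (π ω) (π ω') (f ω) ∂μ) (f ω') ∂μ := by
  simp only [form, pairing, costate_fst hx hπ hf, costate_snd hx hπ hf,
    intervalIntegral.integral_same, add_zero, innerSL_apply_apply]

/-- The feedback law yields a trajectory. -/
theorem exists_closed_loop (hτ : τ ∈ Icc 0 D.T) (hπ : Measurable π) (hf : Integrable f μ)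
    (hy : Continuous y) (x₀ : V) : ∃ (x : ℝ → V) (u : ℝ → U), x τ = x₀ ∧ Continuous u ∧
      D.IsTraj μ π f τ u x ∧ ∀ s, D.deviation μ π f τ u x y s = 0 := by
  have hσ : Continuous D.σ := D.continuous_σ continuous_id
  -- Inserting `u = -B* p`, with `p` the pairing of the state with `P₀` and `P₁`, leaves a linear
  -- Volterra equation with these coefficients.
  have hA : Continuous fun s => -(D.S ∘L P₀ (y s)) := by fun_prop
  have hM : Continuous fun p : ℝ × Icc (0 : ℝ) D.T =>
    D.N (p.1 - p.2) - D.S ∘L P₁ (y p.1) p.2 := by fun_prop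
  obtain ⟨a, ha⟩ := isCompact_Icc.exists_bound_of_continuousOn (hA.continuousOn (s := Icc 0 D.T))
  obtain ⟨m, hm⟩ := (isCompact_Icc.prod isCompact_univ).exists_bound_of_continuousOn
    (hM.continuousOn (s := Icc 0 D.T ×ˢ univ))
  obtain ⟨x, hx, hxe, -⟩ := exists_linear_volterra_solution D.T_nonneg hσ hπ hf hτ hA hM ha
    (fun t ht z => hm (t, z) ⟨ht, mem_univ _⟩) x₀
  have hx₀ : x τ = x₀ := by simpa using hxe τ ⟨le_rfl, hτ.2⟩
  have hu : Continuous fun s => -adjoint D.B (D.costate μ π f x τ s (y s)).1 :=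
    ((adjoint D.B).continuous.comp (continuous_costate hx hπ hf hy).fst).neg
  refine ⟨x, _, hx₀, hu, ⟨hx, hu.intervalIntegrable _ _, fun t ht => ?_⟩, fun s => ?_⟩
  · rw [hxe t ht, hx₀]
    refine congrArg (x₀ + ·) (intervalIntegral.integral_congr fun s _ => ?_)
    have hc₁ : Continuous fun ξ => P₁ (y s) ξ := by fun_prop
    have hc₂ : Continuous fun ξ => D.S ∘L P₁ (y s) ξ := by fun_prop
    have hN : Continuous fun ξ : Icc (0 : ℝ) D.T => D.N (s - ξ) := by fun_prop
    dsimp only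
    rw [← zero_sub, pairing_sub hσ hx hπ hf _ _ hN hc₂, pairing_clm_comp hσ hx hπ hf _ _ hc₁,
      costate_fst hx hπ hf, map_neg, ← sub_eq_add_neg]
    rfl
  · rw [deviation, neg_add_cancel]

/-- The trajectory without control. -/
theorem exists_free (hτ : τ ∈ Icc 0 D.T) (hπ : Measurable π) (hf : Integrable f μ) (x₀ : V) :
    ∃ x : ℝ → V, x τ = x₀ ∧ D.IsTraj μ π f τ 0 x ∧
      ∀ t ∈ Icc τ D.T, ‖x t‖ ≤ gronwallBound ‖x₀‖ (0 + D.c + 1) (D.c * ∫ ω, ‖f ω‖ ∂μ) D.T := by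
  obtain ⟨x, hx, hxe, hxn⟩ := exists_linear_volterra_solution D.T_nonneg
    (D.continuous_σ continuous_id : Continuous D.σ) hπ hf hτ (A := fun _ => 0) continuous_const
    (M := fun t ξ => D.N (t - ξ)) (by fun_prop) (a := 0) (by simp)
    (fun t _ z => D.norm_N_le _) x₀
  have hx₀ : x τ = x₀ := by simpa using hxe τ ⟨le_rfl, hτ.2⟩
  refine ⟨x, hx₀, ⟨hx, continuous_zero.intervalIntegrable _ _, fun t ht => ?_⟩, fun t ht => (hxn t ht).trans ?_⟩
  · rw [hxe t ht, hx₀]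
    simp [memory]
  · exact gronwallBound_mono (norm_nonneg _)
      (mul_nonneg D.c_nonneg (integral_nonneg fun _ => norm_nonneg _))
      (by linarith [D.c_nonneg]) (by linarith [hτ.1])

/-- Along the closed loop the deviation vanishes, so the form equals a cost, which is nonnegative.
The path `x` is only a carrier of its initial value, on which alone the form at time `τ` depends. -/
theorem form_nonneg (hτ : τ ∈ Icc 0 D.T) (hπ : Measurable π) (hf : Integrable f μ)
    (hy : D.IsRiccati τ y) (x₀ : V) : ∃ x : ℝ → V, Continuous x ∧ x τ = x₀ ∧
      0 ≤ D.form μ π f x τ τ (y τ) := by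
  obtain ⟨x, u, hx₀, hu, h, hd⟩ := exists_closed_loop hτ hπ hf hy.continuous x₀
  refine ⟨x, h.continuous, hx₀, ?_⟩
  have key := form_add_integral_deviation h hπ ((hu.norm.pow 2).intervalIntegrable _ _) hf hy hτ.2
  have h0 : ∫ s in τ..D.T, ‖D.deviation μ π f τ u x y s‖ ^ 2 = 0 := by simp [hd]
  rw [h0, add_zero] at key
  rw [← key]
  refine add_nonneg (intervalIntegral.integral_nonneg hτ.2 fun s _ => ?_)
    (D.isPositive_Q₀.inner_nonneg_right _)
  have := D.isPositive_Q.inner_nonneg_right (x s)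
  positivity

/-- The form is at most the cost of the zero control, and the free trajectory is bounded by
Grönwall. The bound does not involve the kernels. -/
theorem form_le (hτ : τ ∈ Icc 0 D.T) (hπ : Measurable π) (hf : Integrable f μ)
    (hy : D.IsRiccati τ y) (x₀ : V) : ∃ x : ℝ → V, Continuous x ∧ x τ = x₀ ∧
      D.form μ π f x τ τ (y τ) ≤ (D.T * ‖D.Q‖ + ‖D.Q₀‖) *
        gronwallBound ‖x₀‖ (0 + D.c + 1) (D.c * ∫ ω, ‖f ω‖ ∂μ) D.T ^ 2 := by
  obtain ⟨x, hx₀, h, hxn⟩ := exists_free (D := D) hτ hπ hf x₀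
  refine ⟨x, h.continuous, hx₀, ?_⟩
  have hx := h.continuous
  set R := gronwallBound ‖x₀‖ (0 + D.c + 1) (D.c * ∫ ω, ‖f ω‖ ∂μ) D.T with hR
  have key := form_add_integral_deviation h hπ (by simp) hf hy hτ.2
  have h0 : 0 ≤ ∫ s in τ..D.T, ‖D.deviation μ π f τ 0 x y s‖ ^ 2 :=
    intervalIntegral.integral_nonneg hτ.2 fun s _ => by positivity
  have hle : ∀ (A : V →L[ℝ] V), ∀ t ∈ Icc τ D.T, inner ℝ (x t) (A (x t)) ≤ ‖A‖ * R ^ 2 :=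
    fun A t ht => by
    have h1 := hxn t ht
    calc inner ℝ (x t) (A (x t)) ≤ ‖x t‖ * ‖A (x t)‖ := real_inner_le_norm _ _
      _ ≤ ‖x t‖ * (‖A‖ * ‖x t‖) := by gcongr; exact A.le_opNorm _
      _ = ‖A‖ * ‖x t‖ ^ 2 := by ring
      _ ≤ ‖A‖ * R ^ 2 := by gcongr
  have h1 : ∫ s in τ..D.T, (inner ℝ (x s) (D.Q (x s)) + ‖(0 : ℝ → U) s‖ ^ 2) ≤
      (D.T - τ) * (‖D.Q‖ * R ^ 2) := by
    rw [← smul_eq_mul, ← intervalIntegral.integral_const]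
    refine intervalIntegral.integral_mono_on hτ.2 (Continuous.intervalIntegrable ?_ _ _)
      (by simp) fun s hs => by simpa using hle D.Q s hs
    simp only [Pi.zero_apply]
    fun_prop
  have h2 := hle D.Q₀ D.T ⟨hτ.2, le_rfl⟩
  have h3 : (D.T - τ) * (‖D.Q‖ * R ^ 2) ≤ D.T * (‖D.Q‖ * R ^ 2) := by
    have := hτ.1
    gcongr
    linarith
  nlinarith

end Data

end Bound
end VolterraLQ
end

/-! ### The a-priori bound and global solvability of the Riccati system -/

section
open MeasureTheory Set ContinuousLinearMap
open scoped ENNReal NNReal Topology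

namespace VolterraLQ

theorem gronwallBound_le_gronwallBound {δ δ' K ε ε' x : ℝ} (hK : 0 < K) (hx : 0 ≤ x) (hδ : δ ≤ δ')
    (hε : ε ≤ ε') : gronwallBound δ K ε x ≤ gronwallBound δ' K ε' x := by
  simp only [gronwallBound_of_K_ne_0 hK.ne']
  have h1 : 1 ≤ Real.exp (K * x) := Real.one_le_exp (by positivity)
  have h2 : 0 ≤ Real.exp (K * x) - 1 := by linarith
  gcongr

theorem opNorm_le_of_inner_le {V : Type*} [NormedAddCommGroup V] [InnerProductSpace ℝ V]
    {A : V →L[ℝ] V} {C : ℝ} (hC : 0 ≤ C)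
    (h : ∀ v w, ‖v‖ ≤ 1 → ‖w‖ ≤ 1 → inner ℝ (A v) w ≤ C) : ‖A‖ ≤ C := by
  refine ContinuousLinearMap.opNorm_le_of_unit_norm hC fun v hv => ?_
  by_cases h0 : A v = 0
  · rwa [h0, norm_zero]
  have hn : ‖A v‖ ≠ 0 := norm_ne_zero_iff.2 h0
  have := h v ((‖A v‖)⁻¹ • A v) hv.le (by rw [norm_smul, norm_inv, norm_norm, inv_mul_cancel₀ hn])
  rwa [inner_smul_right, real_inner_self_eq_norm_sq, sq, inv_mul_cancel_left₀ hn] at this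

section Global

variable {V U Ω : Type*} [NormedAddCommGroup V] [InnerProductSpace ℝ V] [CompleteSpace V]
  [NormedAddCommGroup U] [InnerProductSpace ℝ U] [CompleteSpace U] [MeasurableSpace Ω]

open Kernels

/-- The quadratic form with kernels `y` at the state with present `x` and history `f`. -/
noncomputable def Kernels.quadratic {T : ℝ} (y : Kernels V T) (μ : Measure Ω)
    (π : Ω → Icc (0 : ℝ) T) (f : Ω → V) (x : V) : ℝ :=
  inner ℝ (P₀ y x + ∫ ω, P₁ y (π ω) (f ω) ∂μ) x +
    ∫ ω', inner ℝ (adjoint (P₁ y (π ω')) x + ∫ ω, K y (π ω) (π ω') (f ω) ∂μ) (f ω') ∂μ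

/-- The quadratic form at a history that is concentrated at two points. -/
theorem Kernels.quadratic_count {T : ℝ} (y : Kernels V T) (ξ r : Icc (0 : ℝ) T) (a b x : V) :
    y.quadratic (Measure.count : Measure Bool) (fun i => cond i ξ r) (fun i => cond i a b) x =
      inner ℝ (P₀ y x) x + 2 * inner ℝ (P₁ y ξ a) x + 2 * inner ℝ (P₁ y r b) x +
      inner ℝ (K y ξ ξ a) a + inner ℝ (K y r r b) b + inner ℝ (K y r ξ b) a +
      inner ℝ (K y ξ r a) b := by
  simp only [quadratic, integral_count, Fintype.sum_bool, cond_true, cond_false, inner_add_left,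
    adjoint_inner_left]
  rw [real_inner_comm _ x, real_inner_comm _ x]
  ring

namespace Data

variable {D : Data V U} {μ : Measure Ω} {π : Ω → Icc (0 : ℝ) D.T} {f : Ω → V} {τ t s : ℝ} {u : ℝ → U}
  {x : ℝ → V} {y : ℝ → Kernels V D.T}

theorem quadratic_nonneg (hτ : τ ∈ Icc 0 D.T) (hπ : Measurable π) (hf : Integrable f μ)
    (hy : D.IsRiccati τ y) (x₀ : V) : 0 ≤ (y τ).quadratic μ π f x₀ := by
  obtain ⟨x, hx, rfl, h⟩ := form_nonneg hτ hπ hf hy x₀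
  rwa [form_initial hx hπ hf] at h

theorem quadratic_le (hτ : τ ∈ Icc 0 D.T) (hπ : Measurable π) (hf : Integrable f μ)
    (hy : D.IsRiccati τ y) (x₀ : V) : (y τ).quadratic μ π f x₀ ≤ (D.T * ‖D.Q‖ + ‖D.Q₀‖) *
        gronwallBound ‖x₀‖ (0 + D.c + 1) (D.c * ∫ ω, ‖f ω‖ ∂μ) D.T ^ 2 := by
  obtain ⟨x, hx, rfl, h⟩ := form_le hτ hπ hf hy x₀
  rwa [form_initial hx hπ hf] at h

variable (D) in
/-- An a-priori bound for solutions of the Riccati system. -/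
noncomputable def bound : ℝ :=
  -- The first `2` bounds a present state `v ± w` with `v`, `w` in the unit ball; the second bounds
  -- the total mass of a history made of two atoms in the unit ball.
  (D.T * ‖D.Q‖ + ‖D.Q₀‖) * gronwallBound 2 (0 + D.c + 1) (D.c * 2) D.T ^ 2

theorem bound_nonneg : 0 ≤ D.bound := by
  have := D.T_nonneg
  unfold bound
  positivity

theorem quadratic_count_mem (hτ : τ ∈ Icc 0 D.T) (hy : D.IsRiccati τ y) (ξ r : Icc (0 : ℝ) D.T)
    {a b x : V} (ha : ‖a‖ ≤ 1) (hb : ‖b‖ ≤ 1) (hx : ‖x‖ ≤ 2) :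
    (y τ).quadratic (Measure.count : Measure Bool) (fun i => cond i ξ r) (fun i => cond i a b) x ∈
      Icc 0 D.bound := by
  have hπ : Measurable fun i => cond i ξ r := measurable_of_finite _
  have hf : Integrable (fun i => cond i a b) (Measure.count : Measure Bool) := .of_finite
  refine ⟨quadratic_nonneg hτ hπ hf hy x, (quadratic_le hτ hπ hf hy x).trans ?_⟩
  have hT := D.T_nonneg
  have hc := D.c_nonneg
  have h1 : ∫ i, ‖(cond i a b : V)‖ ∂(Measure.count : Measure Bool) ≤ 2 := by
    simp only [integral_count, Fintype.sum_bool, cond_true, cond_false]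
    linarith
  have h2 : 0 ≤ gronwallBound ‖x‖ (0 + D.c + 1)
      (D.c * ∫ i, ‖(cond i a b : V)‖ ∂(Measure.count : Measure Bool)) D.T := by
    refine (norm_nonneg x).trans ?_
    have := gronwallBound_mono (δ := ‖x‖) (K := 0 + D.c + 1)
      (ε := D.c * ∫ i, ‖(cond i a b : V)‖ ∂(Measure.count : Measure Bool)) (norm_nonneg _)
      (mul_nonneg hc (integral_nonneg fun _ => norm_nonneg _)) (by linarith) hT
    rwa [gronwallBound_x0] at this
  unfold bound
  gcongr
  exact gronwallBound_le_gronwallBound (by linarith) hT hx (by gcongr)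

/-- Polarization. Since the form takes values in `[0, bound]` on the test states, so does four times
a kernel coefficient, up to sign: reversing the sign of one of the two test vectors and subtracting
isolates `⟨P₀ v, w⟩`, `⟨P₁ v, w⟩` or `⟨K v, w⟩`. Atoms may sit anywhere in `[0, T]`, also beyond
`τ`, which is why the full norm of the kernels is controlled. Only a solution on `[τ, T]` is needed,
so this serves as the a-priori bound. -/
theorem norm_le_bound (hτ : τ ∈ Icc 0 D.T) (hy : D.IsRiccati τ y) : ‖y τ‖ ≤ D.bound := by
  have hB := D.bound_nonneg
  have hmem : τ ∈ Icc τ D.T := ⟨le_rfl, hτ.2⟩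
  have ξ₀ : Icc (0 : ℝ) D.T := ⟨τ, hτ⟩
  refine Kernels.norm_le hB ?_ (fun ξ => ?_) fun ξ r => ?_
  · refine opNorm_le_of_inner_le hB fun v w hv hw => ?_
    have h1 := quadratic_count_mem hτ hy ξ₀ ξ₀ (a := 0) (b := 0) (x := v + w) (by simp) (by simp)
      ((norm_add_le _ _).trans (by linarith))
    have h2 := quadratic_count_mem hτ hy ξ₀ ξ₀ (a := 0) (b := 0) (x := v - w) (by simp) (by simp)
      ((norm_sub_le _ _).trans (by linarith))
    rw [quadratic_count] at h1 h2
    have h3 : inner ℝ (P₀ (y τ) w) v = inner ℝ (P₀ (y τ) v) w := by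
      rw [← adjoint_inner_right, hy.adjoint_P₀ hmem, real_inner_comm]
    simp only [map_add, map_sub, map_zero, inner_add_left, inner_add_right, inner_sub_left,
      inner_sub_right, inner_zero_left, mem_Icc] at h1 h2
    linarith [h1.2, h2.1]
  · refine opNorm_le_of_inner_le hB fun v w hv hw => ?_
    have h1 := quadratic_count_mem hτ hy ξ ξ (a := v) (b := 0) (x := w) hv (by simp) (by linarith)
    have h2 := quadratic_count_mem hτ hy ξ ξ (a := -v) (b := 0) (x := w) (by rwa [norm_neg])
      (by simp) (by linarith)
    rw [quadratic_count] at h1 h2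
    simp only [map_neg, map_zero, inner_neg_left, inner_neg_right, inner_zero_left,
      inner_zero_right, mem_Icc] at h1 h2
    linarith [h1.2, h2.1]
  · refine opNorm_le_of_inner_le hB fun v w hv hw => ?_
    have h1 := quadratic_count_mem hτ hy ξ r (a := v) (b := w) (x := 0) hv hw (by simp)
    have h2 := quadratic_count_mem hτ hy ξ r (a := v) (b := -w) (x := 0) hv (by rwa [norm_neg])
      (by simp)
    have h3 : inner ℝ (K (y τ) r ξ w) v = inner ℝ (K (y τ) ξ r v) w := by
      rw [← adjoint_inner_right, hy.adjoint_K hmem, real_inner_comm]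
    rw [quadratic_count] at h1 h2
    simp only [map_neg, map_zero, inner_neg_left, inner_neg_right, inner_zero_right, mem_Icc] at h1 h2
    linarith [h1.2, h2.1]

variable (D) in
/-- Global solvability of the Riccati system. -/
theorem exists_isRiccati : ∃ y, D.IsRiccati 0 y := by
  obtain ⟨y, hyc, hy⟩ := exists_backward_solution_of_apriori (f := D.field) (a := 0) (b := D.T)
    (D.continuous_field continuous_fst continuous_snd) D.T_nonneg
    (fun R => ⟨_, fun t _ x y hx hy => D.norm_field_sub_le t hx hy⟩)
    (fun R => ⟨_, fun t _ x hx => D.norm_field_le t hx⟩) D.terminal D.bound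
    (fun t₁ ht₁ y hyc hy => norm_le_bound ht₁ ⟨hyc, hy⟩)
  exact ⟨y, hyc, hy⟩

theorem IsRiccati.mono (hy : D.IsRiccati τ y) (h : τ ≤ s) : D.IsRiccati s y :=
  ⟨hy.continuous, fun t ht => hy.eqn t ⟨h.trans ht.1, ht.2⟩⟩

end Data

end Global
end VolterraLQ
end

section
open MeasureTheory Set ContinuousLinearMap
open scoped ENNReal NNReal Topology

namespace VolterraLQ

/-! ### Linear equations whose forcing is translated by a parameter -/

section Parameter

variable {Y E : Type*} [NormedAddCommGroup Y] [NormedSpace ℝ Y] [CompleteSpace Y]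
  [NormedAddCommGroup E] [NormedSpace ℝ E] [CompleteSpace E] {T : ℝ}

/-- The integral over `[0, ξ]` as a continuous linear map on `C([0, T], Y)`. -/
noncomputable def integralCLM (Y : Type*) [NormedAddCommGroup Y] [NormedSpace ℝ Y] (hT : 0 ≤ T)
    (ξ : Icc (0 : ℝ) T) : C(Icc (0 : ℝ) T, Y) →L[ℝ] Y :=
  LinearMap.mkContinuous
    { toFun := fun h => ∫ θ in (0 : ℝ)..ξ, h (projIcc 0 T hT θ)
      map_add' := fun g h => intervalIntegral.integral_add
        ((g.continuous.comp continuous_projIcc).intervalIntegrable _ _)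
        ((h.continuous.comp continuous_projIcc).intervalIntegrable _ _)
      map_smul' := fun c h => intervalIntegral.integral_smul c _ } |(ξ : ℝ) - 0| fun h => by
    rw [mul_comm]
    exact intervalIntegral.norm_integral_le_of_norm_le_const fun θ _ => h.norm_coe_le_norm _

omit [CompleteSpace Y] in
theorem integral_projIcc (hT : 0 ≤ T) (ξ : Icc (0 : ℝ) T) (h : ℝ → Y) :
    ∫ θ in (0 : ℝ)..ξ, h (projIcc 0 T hT θ) = ∫ θ in (0 : ℝ)..ξ, h θ := by
  refine intervalIntegral.integral_congr fun θ hθ => ?_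
  rw [uIcc_of_le ξ.2.1] at hθ
  rw [projIcc_of_mem hT ⟨hθ.1, hθ.2.trans ξ.2.2⟩]

/-- The integral is a difference of two values of a primitive of `N`, so it is differentiable
although `N` is only continuous. -/
theorem hasDerivAt_integral_sub {N : ℝ → E} (hN : Continuous N) (ξ t : ℝ) :
    HasDerivAt (fun t => ∫ θ in (0 : ℝ)..ξ, N (t - θ)) (N t - N (t - ξ)) t := by
  have h : (fun t => ∫ θ in (0 : ℝ)..ξ, N (t - θ)) =
      fun t => (∫ s in (0 : ℝ)..t, N s) - ∫ s in (0 : ℝ)..(t - ξ), N s := by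
    funext t
    rw [intervalIntegral.integral_comp_sub_left, sub_zero,
      intervalIntegral.integral_interval_sub_left (hN.intervalIntegrable _ _)
        (hN.intervalIntegrable _ _)]
  rw [h]
  have h1 : ∀ t, HasDerivAt (fun t => ∫ s in (0 : ℝ)..t, N s) (N t) t :=
    fun t => (hN.integral_hasStrictDerivAt 0 t).hasDerivAt
  exact (h1 t).sub ((h1 (t - ξ)).comp_sub_const t ξ)

/-- Solutions of linear differential equations, with forcing terms that depend on a parameter by
translation, are differentiable in the parameter. -/
theorem exists_parameter_derivative (hT : 0 ≤ T) {A : ℝ → Y →L[ℝ] Y}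
    (hA : Continuous fun p : ℝ × Y => A p.1 p.2) {c : ℝ} (hc : ∀ t ∈ Icc 0 T, ‖A t‖ ≤ c)
    (L : Y →L[ℝ] E →L[ℝ] Y) {N : ℝ → E} (hN : Continuous N) {φ φ' : ℝ → Y} (hφ : Continuous φ)
    (hφ' : Continuous φ') (hder : ∀ t ∈ Ioo 0 T, HasDerivAt φ (φ' t) t)
    {κ : ℝ → Icc (0 : ℝ) T → Y} (hκ : ∀ ξ, Continuous fun t => κ t ξ)
    (hκT : ∀ ξ, κ T ξ = 0) (hκ' : ∀ ξ : Icc (0 : ℝ) T, ∀ t ∈ Ioo 0 T,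
      HasDerivAt (fun t => κ t ξ) (A t (κ t ξ) - L (φ t) (N (t - ξ))) t) :
    ∃ η : ℝ → C(Icc (0 : ℝ) T, Y), Continuous η ∧ ∀ t ∈ Icc 0 T, ∀ ξ : Icc (0 : ℝ) T,
      κ t ξ = κ t ⟨0, left_mem_Icc.2 hT⟩ + ∫ θ in (0 : ℝ)..ξ, η t (projIcc 0 T hT θ) := by
  have hc0 : 0 ≤ c := (norm_nonneg _).trans (hc 0 (left_mem_Icc.2 hT))
  let lift : ℝ → C(Icc (0 : ℝ) T, Y) →L[ℝ] C(Icc (0 : ℝ) T, Y) := fun t =>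
    (A t).compLeftContinuous ℝ (Icc (0 : ℝ) T)
  have hlift : Continuous fun p : ℝ × C(Icc (0 : ℝ) T, Y) => lift p.1 p.2 :=
    ContinuousMap.continuous_of_continuous_uncurry _ (hA.comp (by fun_prop :
      Continuous fun q : (ℝ × C(Icc (0 : ℝ) T, Y)) × Icc (0 : ℝ) T => (q.1.1, q.1.2 q.2)))
  have hliftn : ∀ t ∈ Icc 0 T, ‖lift t‖ ≤ c := fun t ht =>
    ContinuousLinearMap.opNorm_le_bound _ hc0 fun h =>
      (ContinuousMap.norm_le _ (by positivity)).2 fun θ =>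
        ((A t).le_of_opNorm_le (hc t ht) _).trans (by gcongr; exact h.norm_coe_le_norm θ)
  have hψ : ∀ {ψ : ℝ → Y}, Continuous ψ →
      Continuous fun p : ℝ × Icc (0 : ℝ) T => L (ψ p.1) (N (p.1 - p.2)) := fun hψ =>
    (L.continuous.comp (hψ.comp continuous_fst)).clm_apply (by fun_prop)
  -- Formally the derivative `η` in the parameter satisfies `η' = A η + L φ N'(t - θ)` with `η(T) =
  -- 0`. With `F = L φ N(t - θ)`, the difference `e = η - F` satisfies `e' = A e + A F - L φ' N(t -
  -- θ)` and `e(T) = -F(T)`, where `N'` no longer appears; `G` is the forcing of this equation.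
  let F : C(ℝ, C(Icc (0 : ℝ) T, Y)) := ContinuousMap.curry
    ⟨fun p : ℝ × Icc (0 : ℝ) T => L (φ p.1) (N (p.1 - p.2)), hψ hφ⟩
  let G : C(ℝ, C(Icc (0 : ℝ) T, Y)) := ContinuousMap.curry
    ⟨fun p : ℝ × Icc (0 : ℝ) T => A p.1 (L (φ p.1) (N (p.1 - p.2))) - L (φ' p.1) (N (p.1 - p.2)),
      (hA.comp (continuous_fst.prodMk (hψ hφ))).sub (hψ hφ')⟩
  obtain ⟨e, hec, he⟩ := exists_linear_backward_solution hlift G.continuous hT hliftn (-F T)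
  refine ⟨fun t => e t + F t, hec.add F.continuous, fun t₁ ht₁ ξ => ?_⟩
  let ι := integralCLM Y hT ξ
  let n : ℝ → E := fun t => ∫ θ in (0 : ℝ)..ξ, N (t - θ)
  have hn : ∀ t, HasDerivAt n (N t - N (t - ξ)) t := fun t => hasDerivAt_integral_sub hN ξ t
  have hnc : Continuous n := continuous_iff_continuousAt.2 fun t => (hn t).continuousAt
  have hLN : ∀ (ψ : Y) t, ∫ θ in (0 : ℝ)..ξ, L ψ (N (t - θ)) = L ψ (n t) := fun ψ t =>
    (L ψ).intervalIntegral_comp_comm (Continuous.intervalIntegrable (by fun_prop) _ _)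
  have hιF : ∀ t, ι (F t) = L (φ t) (n t) := fun t =>
    (integral_projIcc hT ξ fun θ => L (φ t) (N (t - θ))).trans (hLN _ _)
  have hιA : ∀ t h, ι (lift t h) = A t (ι h) := fun t h =>
    (A t).intervalIntegral_comp_comm ((h.continuous.comp continuous_projIcc).intervalIntegrable _ _)
  have hιG : ∀ t, ι (G t) = A t (L (φ t) (n t)) - L (φ' t) (n t) := fun t => by
    rw [← hLN, ← hLN, ← (A t).intervalIntegral_comp_comm
      (Continuous.intervalIntegrable (by fun_prop) _ _), ← intervalIntegral.integral_sub
      (Continuous.intervalIntegrable (by fun_prop) _ _)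
      (Continuous.intervalIntegrable (by fun_prop) _ _)]
    exact integral_projIcc hT ξ fun θ => A t (L (φ t) (N (t - θ))) - L (φ' t) (N (t - θ))
  have hde : ∀ t ∈ Ioo 0 T, HasDerivAt e (lift t (e t) + G t) t := fun t ht => by
    have hcont : Continuous fun s => lift s (e s) + G s :=
      (hlift.comp (continuous_id.prodMk hec)).add G.continuous
    have h1 : HasDerivAt (fun t => -F T - ∫ s in t..T, (lift s (e s) + G s))
        (- -(lift t (e t) + G t)) t :=
      (intervalIntegral.integral_hasDerivAt_left (hcont.intervalIntegrable _ _)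
        (hcont.stronglyMeasurableAtFilter _ _) hcont.continuousAt).const_sub _
    rw [neg_neg] at h1
    refine h1.congr_of_eventuallyEq ?_
    filter_upwards [Ioo_mem_nhds ht.1 ht.2] with s hs using he s ⟨hs.1.le, hs.2.le⟩
  let ξ₀ : Icc (0 : ℝ) T := ⟨0, left_mem_Icc.2 hT⟩
  -- The defect of the claimed formula, with the integral of `F` already evaluated as `L φ n`. It
  -- solves the homogeneous equation with zero terminal value and therefore vanishes.
  let w : ℝ → Y := fun t => κ t ξ₀ + ι (e t) + L (φ t) (n t) - κ t ξ
  have hwc : Continuous w := (((hκ ξ₀).add (ι.continuous.comp hec)).add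
    ((L.continuous.comp hφ).clm_apply hnc)).sub (hκ ξ)
  have hAw : Continuous fun t => A t (w t) := hA.comp (continuous_id.prodMk hwc)
  have hw : ∀ t ∈ Ioo 0 T, HasDerivAt w (A t (w t)) t := fun t ht => by
    have h1 := (((hκ' ξ₀ t ht).add (ι.hasFDerivAt.comp_hasDerivAt t (hde t ht))).add
      (L.hasDerivAt_of_bilinear (fun _ => hder t ht) fun _ => hn t)).sub (hκ' ξ t ht)
    refine h1.congr_deriv ?_
    simp only [w, map_add, map_sub, hιA, hιG, ξ₀, sub_zero]
    abel
  have hwT : w T = 0 := by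
    have h1 : e T = -F T := by
      rw [he T (right_mem_Icc.2 hT), intervalIntegral.integral_same, sub_zero]
    simp only [w, hκT, h1, map_neg, hιF]
    abel
  have hw0 : w t₁ = 0 := by
    refine eq_zero_of_linear_backward_equation hA ht₁.2
      (fun t ht => hc t ⟨ht₁.1.trans ht.1, ht.2⟩) hwc fun t ht => ?_
    rw [intervalIntegral.integral_eq_sub_of_hasDerivAt_of_le ht.2 hwc.continuousOn
      (fun s hs => hw s ⟨(ht₁.1.trans ht.1).trans_lt hs.1, hs.2⟩) (hAw.intervalIntegrable _ _),
      hwT]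
    simp
  have h2 : κ t₁ ξ = κ t₁ ξ₀ + (ι (e t₁) + L (φ t₁) (n t₁)) := by
    rw [← add_assoc]
    exact (sub_eq_zero.1 hw0).symm
  rw [h2, ← hιF, ← map_add]
  rfl

end Parameter
end VolterraLQ
end

/-! ### Differentiability of the kernels in the history variable -/

section
open MeasureTheory Set ContinuousLinearMap
open scoped ENNReal NNReal Topology

namespace VolterraLQ

theorem hasDerivWithinAt_of_eq_add_integral {F : Type*} [NormedAddCommGroup F] [NormedSpace ℝ F]
    [CompleteSpace F] {f g : ℝ → F} (hg : Continuous g) {c : F} {a b : ℝ}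
    (hf : ∀ s ∈ Icc a b, f s = c + ∫ r in a..s, g r) {t : ℝ} (ht : t ∈ Icc a b) :
    HasDerivWithinAt f (g t) (Icc a b) t :=
  ((hg.integral_hasStrictDerivAt a t).hasDerivAt.const_add c).hasDerivWithinAt.congr hf (hf t ht)

theorem exists_norm_bilinear_le {X E Y : Type*} [NormedAddCommGroup X] [NormedSpace ℝ X]
    [NormedAddCommGroup E] [NormedSpace ℝ E] [NormedAddCommGroup Y] [NormedSpace ℝ Y]
    (L : X →L[ℝ] E →L[ℝ] Y) {p : ℝ → X} (hp : Continuous p) (a b : ℝ) :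
    ∃ c, 0 ≤ c ∧ ∀ t ∈ Icc a b, ∀ v, ‖L (p t) v‖ ≤ c * ‖v‖ := by
  obtain ⟨c, hc⟩ := isCompact_Icc.exists_bound_of_continuousOn
    ((L.continuous.comp hp).continuousOn (s := Icc a b))
  exact ⟨max c 0, le_max_right _ _, fun t ht v =>
    (L (p t)).le_of_opNorm_le ((hc t ht).trans (le_max_left _ _)) v⟩

section Regularity

variable {V U : Type*} [NormedAddCommGroup V] [InnerProductSpace ℝ V] [CompleteSpace V]
  [NormedAddCommGroup U] [InnerProductSpace ℝ U] [CompleteSpace U] {T : ℝ}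

open Kernels

/-- Composition of operators. -/
noncomputable def compOp (V : Type*) [NormedAddCommGroup V] [NormedSpace ℝ V] :
    Op V V →L[ℝ] Op (Op V V) (Op V V) := ContinuousLinearMap.compL ℝ V V V

/-- Composition with an operator in each component. -/
noncomputable def rightMul (V : Type*) [NormedAddCommGroup V] [NormedSpace ℝ V] (T : ℝ) :
    (Op V V × C(Icc (0 : ℝ) T, Op V V)) →L[ℝ] Op V V →L[ℝ] Op V V × C(Icc (0 : ℝ) T, Op V V) :=
  Op.toCLM ∘L column ∘L (ContinuousLinearMap.prodMap (compOp V)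
    ((compOp V).compLeftContinuous ℝ (Icc (0 : ℝ) T)))

omit [CompleteSpace V] in
theorem rightMul_fst (p : Op V V × C(Icc (0 : ℝ) T, Op V V)) (M : Op V V) :
    (rightMul V T p M).1 = Op.ofCLM (p.1.toCLM ∘L M.toCLM) :=
  column_fst (V := Op V V) (W := Op V V) _ M

omit [CompleteSpace V] in
theorem rightMul_snd (p : Op V V × C(Icc (0 : ℝ) T, Op V V)) (M : Op V V) (r : Icc (0 : ℝ) T) :
    (rightMul V T p M).2 r = Op.ofCLM ((p.2 r).toCLM ∘L M.toCLM) :=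
  column_snd (V := Op V V) (W := Op V V) _ M r

/-- The kernels that act on the present state. -/
noncomputable def presentCLM : Kernels V T →L[ℝ] Op V V × C(Icc (0 : ℝ) T, Op V V) :=
  (ContinuousLinearMap.fst ℝ _ _ ∘L toProd).prod
    ((adjointOp V).compLeftContinuous ℝ (Icc (0 : ℝ) T) ∘L ContinuousLinearMap.fst ℝ _ _ ∘L
        ContinuousLinearMap.snd ℝ _ _ ∘L toProd)

/-- The kernels that act on the state at `ξ`. -/
noncomputable def pastCLM (ξ : Icc (0 : ℝ) T) :
    Kernels V T →L[ℝ] Op V V × C(Icc (0 : ℝ) T, Op V V) :=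
  (ContinuousMap.evalCLM ℝ ξ ∘L ContinuousLinearMap.fst ℝ _ _ ∘L
    ContinuousLinearMap.snd ℝ _ _ ∘L toProd).prod
    (ContinuousMap.evalCLM ℝ ξ ∘L ContinuousLinearMap.snd ℝ _ _ ∘L
    ContinuousLinearMap.snd ℝ _ _ ∘L toProd)

theorem presentCLM_fst (y : Kernels V T) : (presentCLM y).1 = Op.ofCLM (P₀ y) := rfl

theorem presentCLM_snd (y : Kernels V T) (r : Icc (0 : ℝ) T) :
    (presentCLM y).2 r = Op.ofCLM (adjoint (P₁ y r)) := rfl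

omit [CompleteSpace V] in
theorem pastCLM_fst (y : Kernels V T) (ξ : Icc (0 : ℝ) T) :
    (pastCLM ξ y).1 = Op.ofCLM (P₁ y ξ) := rfl

omit [CompleteSpace V] in
theorem pastCLM_snd (y : Kernels V T) (ξ r : Icc (0 : ℝ) T) :
    (pastCLM ξ y).2 r = Op.ofCLM (K y ξ r) := rfl

namespace Data

variable {D : Data V U} {y : ℝ → Kernels V D.T} {τ t : ℝ}

theorem IsRiccati.hasDerivWithinAt (hy : D.IsRiccati τ y) (ht : t ∈ Icc τ D.T) :
    HasDerivWithinAt y (D.field t (y t)) (Icc τ D.T) t :=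
  hasDerivWithinAt_of_eq_add_integral hy.continuous_field (fun _ hs => hy.eq_add_integral hs) ht

variable (D) in
/-- The coefficient of the linear equation for the columns. -/
noncomputable def columnCoeff (t : ℝ) (y : Kernels V D.T) :
    Op V V × C(Icc (0 : ℝ) D.T, Op V V) :=
  (Op.ofCLM (P₀ y ∘L D.S), ⟨fun r => Op.ofCLM (adjoint (P₁ y r) ∘L D.S - adjoint (D.N (t - r))),
    Op.ofCLM.continuous.comp (by fun_prop)⟩)

theorem continuous_columnCoeff (hy : Continuous y) :
    Continuous fun t => D.columnCoeff t (y t) := by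
  refine Continuous.prodMk (Op.ofCLM.continuous.comp (by fun_prop))
    (ContinuousMap.continuous_of_continuous_uncurry _ (Op.ofCLM.continuous.comp
      (by fun_prop : Continuous fun q : ℝ × Icc (0 : ℝ) D.T =>
        adjoint (P₁ (y q.1) q.2) ∘L D.S - adjoint (D.N (q.1 - q.2)))))

variable (D) in
noncomputable def columnGenerator (t : ℝ) (y : Kernels V D.T) :
    (Op V V × C(Icc (0 : ℝ) D.T, Op V V)) →L[ℝ] Op V V × C(Icc (0 : ℝ) D.T, Op V V) :=
  rightMul V D.T (D.columnCoeff t y) ∘L ContinuousLinearMap.fst ℝ _ _ -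
    ContinuousLinearMap.inl ℝ _ _ ∘L ContinuousMap.evalCLM ℝ (D.σ t) ∘L
      ContinuousLinearMap.snd ℝ _ _

/-- Once a solution `y` is known, its left factors in the quadratic terms count as coefficients, and
the column at `ξ` satisfies a linear equation. The generator does not depend on `ξ`; the forcing
does so only through the translate `N (t - ξ)`. -/
theorem pastCLM_field (t : ℝ) (y : Kernels V D.T) (ξ : Icc (0 : ℝ) D.T) :
    pastCLM ξ (D.field t y) = D.columnGenerator t y (pastCLM ξ y) -
      rightMul V D.T (presentCLM y) (Op.ofCLM (D.N (t - ξ))) := by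
  have e : D.columnGenerator t y (pastCLM ξ y) =
    rightMul V D.T (D.columnCoeff t y) (Op.ofCLM (P₁ y ξ)) - (Op.ofCLM (K y ξ (D.σ t)), 0) := rfl
  refine Prod.ext ?_ (ContinuousMap.ext fun r => ?_)
  · rw [e, Prod.fst_sub, Prod.fst_sub, rightMul_fst, rightMul_fst, pastCLM_fst, P₁_field, field₁,
      presentCLM_fst, columnCoeff, sub_right_comm]
    rfl
  · rw [e, Prod.snd_sub, Prod.snd_sub, ContinuousMap.sub_apply, ContinuousMap.sub_apply,
      rightMul_snd, rightMul_snd, pastCLM_snd, K_field, field₂, sub_right_comm, ← comp_assoc,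
      ← sub_comp]
    simp [columnCoeff, presentCLM_snd]

theorem continuous_columnGenerator (hy : Continuous y) :
    Continuous fun p : ℝ × (Op V V × C(Icc (0 : ℝ) D.T, Op V V)) =>
      D.columnGenerator p.1 (y p.1) p.2 := by
  refine Continuous.sub (f := fun p : ℝ × (Op V V × C(Icc (0 : ℝ) D.T, Op V V)) =>
      rightMul V D.T (D.columnCoeff p.1 (y p.1)) p.2.1)
    (g := fun p : ℝ × (Op V V × C(Icc (0 : ℝ) D.T, Op V V)) =>
      ((p.2.2 (D.σ p.1), 0) : Op V V × C(Icc (0 : ℝ) D.T, Op V V))) ?_ ?_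
  · exact ((rightMul V D.T).continuous.comp ((continuous_columnCoeff hy).comp
      continuous_fst)).clm_apply continuous_snd.fst
  · fun_prop

theorem exists_norm_columnGenerator_le (hy : Continuous y) :
    ∃ c, ∀ t ∈ Icc 0 D.T, ‖D.columnGenerator t (y t)‖ ≤ c := by
  obtain ⟨c, hc0, hc⟩ := exists_norm_bilinear_le (rightMul V D.T) (continuous_columnCoeff hy) 0 D.T
  refine ⟨c + 1, fun t ht => ContinuousLinearMap.opNorm_le_bound _ (by positivity) fun p => ?_⟩
  have h1 : ‖rightMul V D.T (D.columnCoeff t (y t)) p.1‖ ≤ c * ‖p‖ :=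
    (hc t ht _).trans (by gcongr; exact _root_.norm_fst_le p)
  have h2 : ‖((p.2 (D.σ t), 0) : Op V V × C(Icc (0 : ℝ) D.T, Op V V))‖ ≤ ‖p‖ := by
    rw [Prod.norm_mk, norm_zero, max_eq_left (norm_nonneg _)]
    exact (p.2.norm_coe_le_norm _).trans (_root_.norm_snd_le p)
  refine (norm_sub_le (rightMul V D.T (D.columnCoeff t (y t)) p.1)
    ((p.2 (D.σ t), 0) : Op V V × C(Icc (0 : ℝ) D.T, Op V V))).trans ?_
  linarith

/-- The kernels are differentiable in the second variable. -/
theorem IsRiccati.exists_parameter_derivative (hy : D.IsRiccati 0 y) :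
    ∃ η : ℝ → C(Icc (0 : ℝ) D.T, Op V V × C(Icc (0 : ℝ) D.T, Op V V)), Continuous η ∧
      ∀ t ∈ Icc 0 D.T, ∀ ξ : Icc (0 : ℝ) D.T, pastCLM ξ (y t) =
        pastCLM (D.σ 0) (y t) + ∫ θ in (0 : ℝ)..ξ, η t (D.σ θ) := by
  obtain ⟨c, hc⟩ := exists_norm_columnGenerator_le hy.continuous
  have hder : ∀ t ∈ Ioo 0 D.T, HasDerivAt y (D.field t (y t)) t := fun t ht =>
    (hy.hasDerivWithinAt ⟨ht.1.le, ht.2.le⟩).hasDerivAt (Icc_mem_nhds ht.1 ht.2)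
  obtain ⟨η, hη, h⟩ := VolterraLQ.exists_parameter_derivative D.T_nonneg
    (continuous_columnGenerator hy.continuous) hc (rightMul V D.T)
    (N := fun t => Op.ofCLM (D.N t)) (Op.ofCLM.continuous.comp D.continuous_N)
    (φ := fun t => presentCLM (y t)) (φ' := fun t => presentCLM (D.field t (y t)))
    (presentCLM.continuous.comp hy.continuous) (presentCLM.continuous.comp hy.continuous_field)
    (fun t ht => presentCLM.hasFDerivAt.comp_hasDerivAt t (hder t ht))
    (κ := fun t ξ => pastCLM ξ (y t)) (fun ξ => (pastCLM ξ).continuous.comp hy.continuous)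
    (fun ξ => by rw [hy.apply_T D.T_nonneg]; rfl) (fun ξ t ht => by
      rw [← pastCLM_field]
      exact (pastCLM ξ).hasFDerivAt.comp_hasDerivAt t (hder t ht))
  refine ⟨η, hη, fun t ht ξ => ?_⟩
  rw [h t ht ξ, ← D.σ_coe ⟨0, left_mem_Icc.2 D.T_nonneg⟩]
  rfl

theorem IsRiccati.exists_partial_derivatives (hy : D.IsRiccati 0 y) :
    ∃ (p : ℝ → ℝ → V →L[ℝ] V) (k : ℝ → ℝ → ℝ → V →L[ℝ] V),
      (Continuous fun q : ℝ × ℝ => p q.1 q.2) ∧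
      (Continuous fun q : ℝ × ℝ × ℝ => k q.1 q.2.1 q.2.2) ∧
      ∀ t ∈ Icc 0 D.T, ∀ ξ ∈ Icc 0 D.T,
        HasDerivWithinAt (fun ξ => P₁ (y t) (D.σ ξ)) (p t ξ) (Icc 0 D.T) ξ ∧
        ∀ r, HasDerivWithinAt (fun ξ => K (y t) (D.σ ξ) (D.σ r)) (k t ξ r) (Icc 0 D.T) ξ := by
  obtain ⟨η, hη, h⟩ := hy.exists_parameter_derivative
  have hηc : Continuous fun q : ℝ × ℝ => η q.1 (D.σ q.2) := by fun_prop
  refine ⟨fun t ξ => (η t (D.σ ξ)).1.toCLM, fun t ξ r => ((η t (D.σ ξ)).2 (D.σ r)).toCLM,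
    Op.toCLM.continuous.comp hηc.fst, Op.toCLM.continuous.comp (by fun_prop), fun t ht ξ hξ => ?_⟩
  have h0 : HasDerivWithinAt (fun ξ => pastCLM (D.σ ξ) (y t)) (η t (D.σ ξ)) (Icc 0 D.T) ξ :=
    hasDerivWithinAt_of_eq_add_integral (g := fun θ => η t (D.σ θ)) (by fun_prop) (fun s hs => by
      rw [h t ht (D.σ s), D.coe_σ hs]) hξ
  exact ⟨(Op.toCLM ∘L ContinuousLinearMap.fst ℝ (Op V V)
      C(Icc (0 : ℝ) D.T, Op V V)).hasFDerivAt.comp_hasDerivWithinAt ξ h0,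
    fun r => (Op.toCLM ∘L ContinuousMap.evalCLM ℝ (D.σ r) ∘L ContinuousLinearMap.snd ℝ (Op V V)
      C(Icc (0 : ℝ) D.T, Op V V)).hasFDerivAt.comp_hasDerivWithinAt ξ h0⟩

end Data

end Regularity
end VolterraLQ
end

section
open MeasureTheory Set ContinuousLinearMap
open scoped ENNReal NNReal Topology

namespace VolterraLQ

/-! ### Continuous differentiability from partial derivatives -/

section Partial

variable {E F : Type*} [NormedAddCommGroup E] [NormedSpace ℝ E] [NormedAddCommGroup F]
  [NormedSpace ℝ F]

/-- A function of a real variable and of another one is differentiable if it has a partial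
derivative in the real variable that is continuous, and a partial derivative in the other one. -/
theorem hasFDerivWithinAt_of_partial {f g : ℝ × E → F} {f₂ : E →L[ℝ] F} {s₁ : Set ℝ} {s₂ : Set E}
    {p : ℝ × E} (hs₁ : Convex ℝ s₁) (hp : p ∈ s₁ ×ˢ s₂) (hg : ContinuousAt g p)
    (h₁ : ∀ y ∈ s₂, ∀ x ∈ s₁, HasDerivWithinAt (fun x => f (x, y)) (g (x, y)) s₁ x)
    (h₂ : HasFDerivWithinAt (fun y => f (p.1, y)) f₂ s₂ p.2) :
    HasFDerivWithinAt f ((ContinuousLinearMap.fst ℝ ℝ E).smulRight (g p) +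
      f₂ ∘L ContinuousLinearMap.snd ℝ ℝ E) (s₁ ×ˢ s₂) p := by
  -- Move in the second variable first, then in the real one. The mean value inequality on the
  -- convex set `s₁` handles the latter uniformly in the second variable, because `g` is continuous
  -- at `p`.
  have hA : (fun q : ℝ × E => f q - f (p.1, q.2) - (q.1 - p.1) • g p) =o[𝓝[s₁ ×ˢ s₂] p]
      fun q => q - p := by
    refine Asymptotics.isLittleO_iff.2 fun ε hε => ?_
    obtain ⟨δ, hδ, hδg⟩ := Metric.continuousAt_iff.1 hg ε hε
    filter_upwards [self_mem_nhdsWithin, mem_nhdsWithin_of_mem_nhds (Metric.ball_mem_nhds p hδ)]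
      with q hq hqδ
    have hq1 : dist q.1 p.1 < δ := (le_max_left _ _).trans_lt hqδ
    have hq2 : dist q.2 p.2 < δ := (le_max_right _ _).trans_lt hqδ
    have key := Convex.norm_image_sub_le_of_norm_hasDerivWithin_le
      (f := fun x => f (x, q.2) - x • g p) (f' := fun x => g (x, q.2) - (1 : ℝ) • g p) (C := ε)
      (s := s₁ ∩ Metric.ball p.1 δ) (x := p.1) (y := q.1)
      (fun x hx => ((h₁ q.2 hq.2 x hx.1).mono inter_subset_left).sub
        ((hasDerivAt_id x).hasDerivWithinAt.smul_const (g p)))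
      (fun x hx => by
        rw [one_smul, ← dist_eq_norm]
        exact (hδg (x := (x, q.2)) (max_lt hx.2 hq2)).le)
      (hs₁.inter (convex_ball _ _)) ⟨hp.1, Metric.mem_ball_self hδ⟩ ⟨hq.1, hq1⟩
    have e : f q - f (p.1, q.2) - (q.1 - p.1) • g p =
        f (q.1, q.2) - q.1 • g p - (f (p.1, q.2) - p.1 • g p) := by
      rw [sub_smul]; abel
    rw [e]
    exact key.trans (by gcongr; exact le_max_left _ _)
  have ht : Filter.Tendsto Prod.snd (𝓝[s₁ ×ˢ s₂] p) (𝓝[s₂] p.2) :=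
    tendsto_nhdsWithin_iff.2 ⟨continuous_snd.continuousAt.mono_left nhdsWithin_le_nhds,
      eventually_nhdsWithin_of_forall fun q hq => hq.2⟩
  have hB : (fun q : ℝ × E => f (p.1, q.2) - f (p.1, p.2) - f₂ (q.2 - p.2)) =o[𝓝[s₁ ×ˢ s₂] p]
      fun q => q - p :=
    ((hasFDerivWithinAt_iff_isLittleO.1 h₂).comp_tendsto ht).trans_isBigO
      (Asymptotics.isBigO_of_le _ fun q => le_max_right _ _)
  rw [hasFDerivWithinAt_iff_isLittleO]
  refine (hA.add hB).congr_left fun q => ?_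
  simp
  abel

/-- The linear map on `ℝ × ℝ` with given partial derivatives. -/
noncomputable def gradient₂ (a b : F) : ℝ × ℝ →L[ℝ] F :=
  (ContinuousLinearMap.fst ℝ ℝ ℝ).smulRight a + (ContinuousLinearMap.snd ℝ ℝ ℝ).smulRight b

/-- The linear map on `ℝ × ℝ × ℝ` with given partial derivatives. -/
noncomputable def gradient₃ (a b c : F) : ℝ × ℝ × ℝ →L[ℝ] F :=
  (ContinuousLinearMap.fst ℝ ℝ (ℝ × ℝ)).smulRight a +
    gradient₂ b c ∘L ContinuousLinearMap.snd ℝ ℝ (ℝ × ℝ)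

theorem gradient₂_apply (a b : F) : gradient₂ a b (1, 0) = a := by simp [gradient₂]

theorem gradient₃_apply (a b c : F) : gradient₃ a b c (1, 0, 0) = a := by simp [gradient₃, gradient₂]

theorem continuous_gradient₂ {X : Type*} [TopologicalSpace X] {a b : X → F} (ha : Continuous a)
    (hb : Continuous b) : Continuous fun x => gradient₂ (a x) (b x) :=
  ((smulRightL ℝ (ℝ × ℝ) F (ContinuousLinearMap.fst ℝ ℝ ℝ)).continuous.comp ha).add
    ((smulRightL ℝ (ℝ × ℝ) F (ContinuousLinearMap.snd ℝ ℝ ℝ)).continuous.comp hb)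

theorem continuous_gradient₃ {X : Type*} [TopologicalSpace X] {a b c : X → F} (ha : Continuous a)
    (hb : Continuous b) (hc : Continuous c) : Continuous fun x => gradient₃ (a x) (b x) (c x) :=
  ((smulRightL ℝ (ℝ × ℝ × ℝ) F (ContinuousLinearMap.fst ℝ ℝ (ℝ × ℝ))).continuous.comp ha).add
    ((continuous_gradient₂ hb hc).clm_comp continuous_const)

theorem hasFDerivWithinAt_gradient₂ {f a b : ℝ × ℝ → F} {s₁ s₂ : Set ℝ} (hs₁ : Convex ℝ s₁)
    (ha : Continuous a)
    (h₁ : ∀ x ∈ s₁, ∀ y ∈ s₂, HasDerivWithinAt (fun x => f (x, y)) (a (x, y)) s₁ x)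
    (h₂ : ∀ x ∈ s₁, ∀ y ∈ s₂, HasDerivWithinAt (fun y => f (x, y)) (b (x, y)) s₂ y)
    {p : ℝ × ℝ} (hp : p ∈ s₁ ×ˢ s₂) :
    HasFDerivWithinAt f (gradient₂ (a p) (b p)) (s₁ ×ˢ s₂) p := by
  refine (hasFDerivWithinAt_of_partial hs₁ hp ha.continuousAt (fun y hy x hx => h₁ x hx y hy)
    (h₂ p.1 hp.1 p.2 hp.2).hasFDerivWithinAt).congr_fderiv ?_
  ext <;> simp [gradient₂]

theorem hasFDerivWithinAt_gradient₃ {f a b c : ℝ × ℝ × ℝ → F} {s₁ s₂ s₃ : Set ℝ}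
    (hs₁ : Convex ℝ s₁) (hs₂ : Convex ℝ s₂) (ha : Continuous a) (hb : Continuous b)
    (h₁ : ∀ x ∈ s₁, ∀ y ∈ s₂, ∀ z ∈ s₃,
      HasDerivWithinAt (fun x => f (x, y, z)) (a (x, y, z)) s₁ x)
    (h₂ : ∀ x ∈ s₁, ∀ y ∈ s₂, ∀ z ∈ s₃,
      HasDerivWithinAt (fun y => f (x, y, z)) (b (x, y, z)) s₂ y)
    (h₃ : ∀ x ∈ s₁, ∀ y ∈ s₂, ∀ z ∈ s₃,
      HasDerivWithinAt (fun z => f (x, y, z)) (c (x, y, z)) s₃ z)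
    {p : ℝ × ℝ × ℝ} (hp : p ∈ s₁ ×ˢ s₂ ×ˢ s₃) :
    HasFDerivWithinAt f (gradient₃ (a p) (b p) (c p)) (s₁ ×ˢ s₂ ×ˢ s₃) p :=
  hasFDerivWithinAt_of_partial hs₁ hp ha.continuousAt
    (fun y hy x hx => h₁ x hx y.1 hy.1 y.2 hy.2)
    (hasFDerivWithinAt_gradient₂ (f := fun q => f (p.1, q)) (a := fun q => b (p.1, q))
      (b := fun q => c (p.1, q)) hs₂ (by fun_prop) (h₂ p.1 hp.1) (h₃ p.1 hp.1) hp.2)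

theorem contDiffOn_one_of_hasFDerivWithinAt {f : E → F} {f' : E → E →L[ℝ] F} {s : Set E}
    (hs : UniqueDiffOn ℝ s) (hf' : Continuous f') (h : ∀ x ∈ s, HasFDerivWithinAt f (f' x) s x) :
    ContDiffOn ℝ 1 f s := by
  rw [show (1 : WithTop ℕ∞) = 0 + 1 from rfl, contDiffOn_succ_iff_hasFDerivWithinAt_of_uniqueDiffOn hs]
  exact ⟨by simp, f', contDiffOn_zero.2 hf'.continuousOn, h⟩

end Partial

/-! ### Unique differentiability on the domains of the kernels -/

section Domains

variable {T : ℝ}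

theorem dom₂_subset : dom₂ T ⊆ Icc 0 T ×ˢ Icc 0 T := fun _ hp =>
  ⟨⟨hp.1.trans hp.2.1, hp.2.2⟩, hp.1, hp.2.1.trans hp.2.2⟩

theorem dom₃_subset : dom₃ T ⊆ Icc 0 T ×ˢ Icc 0 T ×ˢ Icc 0 T := fun _ hp =>
  ⟨⟨hp.1.trans hp.2.1, hp.2.2.2.2⟩, ⟨hp.1, hp.2.1.trans hp.2.2.2.2⟩, hp.2.2.1,
    hp.2.2.2.1.trans hp.2.2.2.2⟩

/-- The domain is convex and, because `T > 0`, has interior points, such as the one given. -/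
theorem uniqueDiffOn_dom₂ (hT : 0 < T) : UniqueDiffOn ℝ (dom₂ T) := by
  refine uniqueDiffOn_convex ?_ ⟨(2 * T / 3, T / 3), mem_interior.2
    ⟨{p | 0 < p.2 ∧ p.2 < p.1 ∧ p.1 < T}, fun p hp => ⟨hp.1.le, hp.2.1.le, hp.2.2.le⟩, ?_, ?_⟩⟩
  · rintro x ⟨h1, h2, h3⟩ y ⟨k1, k2, k3⟩ a b ha hb hab
    refine ⟨add_nonneg (mul_nonneg ha h1) (mul_nonneg hb k1),
      add_le_add (mul_le_mul_of_nonneg_left h2 ha) (mul_le_mul_of_nonneg_left k2 hb), ?_⟩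
    calc a * x.1 + b * y.1 ≤ a * T + b * T := by gcongr
      _ = T := by rw [← add_mul, hab, one_mul]
  · exact (isOpen_lt continuous_const continuous_snd).inter
      ((isOpen_lt continuous_snd continuous_fst).inter (isOpen_lt continuous_fst continuous_const))
  · exact ⟨by positivity, by dsimp only; linarith, by dsimp only; linarith⟩

theorem uniqueDiffOn_dom₃ (hT : 0 < T) : UniqueDiffOn ℝ (dom₃ T) := by
  refine uniqueDiffOn_convex ?_ ⟨(2 * T / 3, T / 3, T / 3), mem_interior.2
    ⟨{p | 0 < p.2.1 ∧ p.2.1 < p.1 ∧ 0 < p.2.2 ∧ p.2.2 < p.1 ∧ p.1 < T},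
      fun p hp => ⟨hp.1.le, hp.2.1.le, hp.2.2.1.le, hp.2.2.2.1.le, hp.2.2.2.2.le⟩, ?_, ?_⟩⟩
  · rintro x ⟨h1, h2, h3, h4, h5⟩ y ⟨k1, k2, k3, k4, k5⟩ a b ha hb hab
    refine ⟨add_nonneg (mul_nonneg ha h1) (mul_nonneg hb k1),
      add_le_add (mul_le_mul_of_nonneg_left h2 ha) (mul_le_mul_of_nonneg_left k2 hb),
      add_nonneg (mul_nonneg ha h3) (mul_nonneg hb k3),
      add_le_add (mul_le_mul_of_nonneg_left h4 ha) (mul_le_mul_of_nonneg_left k4 hb), ?_⟩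
    calc a * x.1 + b * y.1 ≤ a * T + b * T := by gcongr
      _ = T := by rw [← add_mul, hab, one_mul]
  · exact (isOpen_lt continuous_const continuous_snd.fst).inter
      ((isOpen_lt continuous_snd.fst continuous_fst).inter
      ((isOpen_lt continuous_const continuous_snd.snd).inter
      ((isOpen_lt continuous_snd.snd continuous_fst).inter
        (isOpen_lt continuous_fst continuous_const))))
  · exact ⟨by positivity, by dsimp only; linarith, by positivity, by dsimp only; linarith,
      by dsimp only; linarith⟩

end Domains

/-! ### The kernels are `C¹` up to the boundary -/

section Smooth

variable {V U : Type*} [NormedAddCommGroup V] [InnerProductSpace ℝ V] [CompleteSpace V]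
  [NormedAddCommGroup U] [InnerProductSpace ℝ U] [CompleteSpace U]

open Kernels

namespace Data.IsRiccati

variable {D : Data V U} {y : ℝ → Kernels V D.T} {t : ℝ}

theorem hasDerivWithinAt_P₀ (hy : D.IsRiccati 0 y) (ht : t ∈ Icc 0 D.T) :
    HasDerivWithinAt (fun t => P₀ (y t)) (D.field₀ t (y t)) (Icc 0 D.T) t :=
  (P₀L (V := V) (T := D.T)).hasFDerivAt.comp_hasDerivWithinAt t (hy.hasDerivWithinAt ht)

theorem hasDerivWithinAt_P₁ (hy : D.IsRiccati 0 y) (ht : t ∈ Icc 0 D.T) (ξ : Icc (0 : ℝ) D.T) :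
    HasDerivWithinAt (fun t => P₁ (y t) ξ) (D.field₁ t (y t) ξ) (Icc 0 D.T) t :=
  (P₁L (V := V) ξ).hasFDerivAt.comp_hasDerivWithinAt t (hy.hasDerivWithinAt ht)

theorem hasDerivWithinAt_K (hy : D.IsRiccati 0 y) (ht : t ∈ Icc 0 D.T) (ξ r : Icc (0 : ℝ) D.T) :
    HasDerivWithinAt (fun t => K (y t) ξ r) (D.field₂ t (y t) ξ r) (Icc 0 D.T) t :=
  (KL (V := V) ξ r).hasFDerivAt.comp_hasDerivWithinAt t (hy.hasDerivWithinAt ht)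

theorem contDiffOn_P₀ (hy : D.IsRiccati 0 y) (hT : 0 < D.T) :
    ContDiffOn ℝ 1 (fun t => P₀ (y t)) (Icc 0 D.T) := by
  rw [contDiffOn_one_iff_derivWithin (uniqueDiffOn_Icc hT)]
  refine ⟨fun t ht => (hy.hasDerivWithinAt_P₀ ht).differentiableWithinAt,
    ContinuousOn.congr (f := fun t => D.field₀ t (y t)) ?_ fun t ht =>
      (hy.hasDerivWithinAt_P₀ ht).derivWithin (uniqueDiffOn_Icc hT t ht)⟩
  have := hy.continuous
  exact Continuous.continuousOn (by fun_prop)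

/-- Regularity of `P₁`, with the derivative in the first variable. -/
theorem exists_hasFDerivWithinAt_P₁ (hy : D.IsRiccati 0 y) :
    ∃ f' : ℝ × ℝ → ℝ × ℝ →L[ℝ] V →L[ℝ] V, Continuous f' ∧
      (∀ p, f' p (1, 0) = D.field₁ p.1 (y p.1) (D.σ p.2)) ∧ ∀ p ∈ dom₂ D.T,
        HasFDerivWithinAt (fun p : ℝ × ℝ => P₁ (y p.1) (D.σ p.2)) (f' p) (dom₂ D.T) p := by
  obtain ⟨a, k, ha, -, h⟩ := hy.exists_partial_derivatives
  have hyc := hy.continuous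
  have hc : Continuous fun p : ℝ × ℝ => D.field₁ p.1 (y p.1) (D.σ p.2) := by fun_prop
  refine ⟨fun p => gradient₂ (D.field₁ p.1 (y p.1) (D.σ p.2)) (a p.1 p.2),
    continuous_gradient₂ hc ha, fun p => gradient₂_apply _ _, fun p hp => ?_⟩
  -- Having kernels also for `ξ > τ` pays off: regularity holds on the full square, a product set,
  -- and is then restricted to the triangle.
  have h1 := hasFDerivWithinAt_gradient₂ (f := fun p : ℝ × ℝ => P₁ (y p.1) (D.σ p.2))
    (b := fun p => a p.1 p.2) (convex_Icc 0 D.T) hc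
    (fun t ht ξ _ => hy.hasDerivWithinAt_P₁ ht (D.σ ξ))
    (fun t ht ξ hξ => (h t ht ξ hξ).1) (dom₂_subset hp)
  exact h1.mono dom₂_subset

/-- Regularity of `K`, with the derivative in the first variable. -/
theorem exists_hasFDerivWithinAt_K (hy : D.IsRiccati 0 y) :
    ∃ f' : ℝ × ℝ × ℝ → ℝ × ℝ × ℝ →L[ℝ] V →L[ℝ] V, Continuous f' ∧
      (∀ p, f' p (1, 0, 0) = D.field₂ p.1 (y p.1) (D.σ p.2.1) (D.σ p.2.2)) ∧ ∀ p ∈ dom₃ D.T,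
        HasFDerivWithinAt (fun p : ℝ × ℝ × ℝ => K (y p.1) (D.σ p.2.1) (D.σ p.2.2)) (f' p)
          (dom₃ D.T) p := by
  obtain ⟨a, k, -, hk, h⟩ := hy.exists_partial_derivatives
  have hyc := hy.continuous
  have hc : Continuous fun p : ℝ × ℝ × ℝ => D.field₂ p.1 (y p.1) (D.σ p.2.1) (D.σ p.2.2) := by
    fun_prop
  have hk' : Continuous fun p : ℝ × ℝ × ℝ => adjoint (k p.1 p.2.2 p.2.1) :=
    continuous_adjoint (hk.comp (continuous_fst.prodMk
      (continuous_snd.snd.prodMk continuous_snd.fst)))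
  -- The derivative in the last variable is the adjoint of the one in the middle variable, by the
  -- symmetry of `K`.
  have h3 : ∀ t ∈ Icc 0 D.T, ∀ ξ ∈ Icc 0 D.T, ∀ r ∈ Icc 0 D.T,
      HasDerivWithinAt (fun r => K (y t) (D.σ ξ) (D.σ r)) (adjoint (k t r ξ)) (Icc 0 D.T) r := by
    intro t ht ξ _ r hr
    have h1 := (adjointCLM V).hasFDerivAt.comp_hasDerivWithinAt r ((h t ht r hr).2 ξ)
    refine h1.congr (fun s _ => ?_) ?_
    · exact (hy.adjoint_K ht _ _).symm
    · exact (hy.adjoint_K ht _ _).symm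
  refine ⟨fun p => gradient₃ (D.field₂ p.1 (y p.1) (D.σ p.2.1) (D.σ p.2.2)) (k p.1 p.2.1 p.2.2)
    (adjoint (k p.1 p.2.2 p.2.1)), continuous_gradient₃ hc hk hk', fun p => gradient₃_apply _ _ _,
    fun p hp => ?_⟩
  have h1 := hasFDerivWithinAt_gradient₃
    (f := fun p : ℝ × ℝ × ℝ => K (y p.1) (D.σ p.2.1) (D.σ p.2.2))
    (c := fun p => adjoint (k p.1 p.2.2 p.2.1)) (convex_Icc 0 D.T) (convex_Icc 0 D.T) hc hk
    (fun t ht ξ _ r _ => hy.hasDerivWithinAt_K ht (D.σ ξ) (D.σ r))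
    (fun t ht ξ hξ r _ => (h t ht ξ hξ).2 r) h3 (dom₃_subset hp)
  exact h1.mono dom₃_subset

end Data.IsRiccati

end Smooth
end VolterraLQ
end

/-! ### Return to the Euclidean problem with `L²` histories and controls -/

section
open MeasureTheory Set ContinuousLinearMap
open scoped ENNReal NNReal Topology

namespace VolterraLQ

section Quadratic

variable {V Ω : Type*} [NormedAddCommGroup V] [InnerProductSpace ℝ V] [CompleteSpace V]
  [MeasurableSpace Ω] {T : ℝ}

open Kernels

theorem Kernels.quadratic_eq (y : Kernels V T) {μ : Measure Ω} {π : Ω → Icc (0 : ℝ) T} {f : Ω → V}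
    (hπ : Measurable π) (hf : Integrable f μ) (x : V) :
    y.quadratic μ π f x = inner ℝ x (P₀ y x) + inner ℝ x (∫ ω, P₁ y (π ω) (f ω) ∂μ) +
      inner ℝ (∫ ω, P₁ y (π ω) (f ω) ∂μ) x +
      ∫ r, ∫ ω, inner ℝ (f r) (K y (π ω) (π r) (f ω)) ∂μ ∂μ := by
  have hP : Continuous fun ξ => P₁ y ξ := by fun_prop
  let k : C(Icc (0 : ℝ) T, C(Icc (0 : ℝ) T, Op V V)) := ContinuousMap.curry
    ⟨fun p => Op.ofCLM (K y p.2 p.1), Op.ofCLM.continuous.comp (by fun_prop)⟩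
  have hk : Continuous fun r => ∫ ω, K y (π ω) r (f ω) ∂μ :=
    (historyCLM V hπ hf).continuous.comp k.continuous
  have i1 := integrable_history hπ hf (G₁ := fun r => innerSL ℝ (adjoint (P₁ y r) x)) (by fun_prop)
  have i2 := integrable_history hπ hf (G₁ := fun r => innerSL ℝ (∫ ω, K y (π ω) r (f ω) ∂μ))
    ((innerSL ℝ).continuous.comp hk)
  have e : ∫ ω', inner ℝ (adjoint (P₁ y (π ω')) x + ∫ ω, K y (π ω) (π ω') (f ω) ∂μ) (f ω') ∂μ =
      inner ℝ x (∫ ω, P₁ y (π ω) (f ω) ∂μ) +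
      ∫ r, ∫ ω, inner ℝ (f r) (K y (π ω) (π r) (f ω)) ∂μ ∂μ := by
    simp only [inner_add_left]
    refine (integral_add i1 i2).trans (congrArg₂ _ ?_ (integral_congr_ae (.of_forall fun r => ?_)))
    · rw [← integral_inner (integrable_history hπ hf hP)]
      simp only [innerSL_apply_apply, adjoint_inner_left]
    · have hK : Continuous fun ξ => K y ξ (π r) := by fun_prop
      change inner ℝ (∫ ω, K y (π ω) (π r) (f ω) ∂μ) (f r) = _
      rw [real_inner_comm]
      exact (integral_inner (integrable_history hπ hf hK) _).symm
  rw [quadratic, e, inner_add_left, real_inner_comm (P₀ y x)]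
  ring

end Quadratic

section Restrict

variable {F : Type*} [NormedAddCommGroup F] [NormedSpace ℝ F] {a b : ℝ}

theorem integral_restrict_Ioo (hab : a ≤ b) (f : ℝ → F) :
    ∫ s, f s ∂(volume.restrict (Ioo a b)) = ∫ s in a..b, f s := by
  rw [intervalIntegral.integral_of_le hab, integral_Ioc_eq_integral_Ioo]

omit [NormedSpace ℝ F] in
theorem integrable_Lp_two (f : Lp F 2 (volume.restrict (Ioo a b))) :
    Integrable f (volume.restrict (Ioo a b)) :=
  (Lp.memLp f).integrable one_le_two

omit [NormedSpace ℝ F] in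
theorem intervalIntegrable_iff_restrict_Ioo (hab : a ≤ b) {f : ℝ → F} :
    IntervalIntegrable f volume a b ↔ Integrable f (volume.restrict (Ioo a b)) := by
  rw [intervalIntegrable_iff_integrableOn_Ioc_of_le hab, integrableOn_Ioc_iff_integrableOn_Ioo]
  rfl

theorem intervalIntegral_congr_Ioo {f g : ℝ → F}
    (h : f =ᵐ[volume.restrict (Ioo a b)] g) {t : ℝ} (ht : t ∈ Icc a b) :
    ∫ s in a..t, f s = ∫ s in a..t, g s := by
  rw [← integral_restrict_Ioo ht.1, ← integral_restrict_Ioo ht.1]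
  exact integral_congr_ae (ae_restrict_of_ae_restrict_of_subset (Ioo_subset_Ioo_right ht.2) h)

end Restrict

section Main

variable {n m : ℕ} {D : Data (Vec n) (Vec m)} {N : ℝ → Vec n →L[ℝ] Vec n} {τ : ℝ}

open Kernels

theorem quadForm_eq (hτ : τ ∈ Icc 0 D.T) (y : Kernels (Vec n) D.T) (X : StateSpace n τ) :
    quadForm τ (P₀ y) (fun ξ => P₁ y (D.σ ξ)) (fun ξ r => K y (D.σ ξ) (D.σ r)) X =
      y.quadratic (volume.restrict (Ioo 0 τ)) D.σ X.2 X.1 := by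
  rw [Kernels.quadratic_eq y (D.continuous_σ continuous_id : Continuous D.σ).measurable
    (integrable_Lp_two X.2)]
  simp only [quadForm, integral_restrict_Ioo hτ.1]

/-- In an actual trajectory only lags between `0` and `T` occur, so neither the extension of `N` nor
the projection `σ` has any effect. -/
theorem memory_eq (hN : ∀ t ∈ Icc 0 D.T, D.N t = N t) (hτ : τ ∈ Icc 0 D.T) (X : StateSpace n τ)
    (x : ℝ → Vec n) {s : ℝ} (hs : s ∈ Icc τ D.T) :
    D.memory (volume.restrict (Ioo 0 τ)) D.σ X.2 x τ s =
      (∫ r in τ..s, N (s - r) (x r)) + ∫ r in (0 : ℝ)..τ, N (s - r) (X.2 r) := by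
  have h : ∀ r ∈ Icc 0 s, D.N (s - D.σ r) = N (s - r) := fun r hr => by
    rw [D.coe_σ ⟨hr.1, hr.2.trans hs.2⟩, hN]
    exact ⟨sub_nonneg.2 hr.2, (sub_le_self _ hr.1).trans hs.2⟩
  rw [Data.memory, pairing, zero_apply, zero_add, integral_restrict_Ioo hτ.1, add_comm]
  congr 1
  · refine intervalIntegral.integral_congr fun r hr => ?_
    rw [uIcc_of_le hs.1] at hr
    rw [h r ⟨hτ.1.trans hr.1, hr.2⟩]
  · refine intervalIntegral.integral_congr fun r hr => ?_
    rw [uIcc_of_le hτ.1] at hr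
    rw [h r ⟨hr.1, hr.2.trans hs.1⟩]

theorem integral_velocity_eq (hN : ∀ t ∈ Icc 0 D.T, D.N t = N t) (hτ : τ ∈ Icc 0 D.T)
    (X : StateSpace n τ) (u : ℝ → Vec m) {x x' : ℝ → Vec n} (hx : EqOn x x' (Icc τ D.T)) {t : ℝ}
    (ht : t ∈ Icc τ D.T) :
    ∫ s in τ..t, (D.memory (volume.restrict (Ioo 0 τ)) D.σ X.2 x τ s + D.B (u s)) =
    ∫ s in τ..t, ((∫ r in τ..s, N (s - r) (x' r)) + D.B (u s) +
      ∫ r in (0 : ℝ)..τ, N (s - r) (X.2 r)) := by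
  refine intervalIntegral.integral_congr fun s hs => ?_
  rw [uIcc_of_le ht.1] at hs
  have hs' : s ∈ Icc τ D.T := ⟨hs.1, hs.2.trans ht.2⟩
  have h : ∫ r in τ..s, N (s - r) (x r) = ∫ r in τ..s, N (s - r) (x' r) :=
    intervalIntegral.integral_congr fun r hr => by
      rw [uIcc_of_le hs.1] at hr
      rw [hx ⟨hr.1, hr.2.trans hs'.2⟩]
  rw [memory_eq hN hτ X x hs', h]
  abel

theorem cost_congr (hτ : τ ≤ D.T) (u : L2 m τ D.T) {x x' : ℝ → Vec n}
    (hx : EqOn x x' (Icc τ D.T)) : cost D.T D.Q D.Q₀ τ u x = cost D.T D.Q D.Q₀ τ u x' := by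
  rw [cost, cost, hx ⟨hτ, le_rfl⟩]
  congr 1
  refine intervalIntegral.integral_congr fun s hs => ?_
  rw [uIcc_of_le hτ] at hs
  rw [hx hs]

/-- The cost exceeds the form by the integral of a square. The trajectory is given only on `[τ, T]`
and is first extended continuously by its end values. -/
theorem quadratic_le_cost (hN : ∀ t ∈ Icc 0 D.T, D.N t = N t) {y : ℝ → Kernels (Vec n) D.T}
    (hy : D.IsRiccati τ y) (hτ : τ ∈ Icc 0 D.T) {X : StateSpace n τ} {u : L2 m τ D.T}
    {x : ℝ → Vec n} (h : IsTrajectory D.T N D.B τ X u x) :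
    (y τ).quadratic (volume.restrict (Ioo 0 τ)) D.σ X.2 X.1 ≤ cost D.T D.Q D.Q₀ τ u x := by
  have hσ : Measurable D.σ := (D.continuous_σ continuous_id).measurable
  have hf := integrable_Lp_two X.2
  let x' : ℝ → Vec n := IccExtend hτ.2 ((Icc τ D.T).domRestrict x)
  have hx' : EqOn x' x (Icc τ D.T) := fun t ht => IccExtend_of_mem _ _ ht
  have hx'c : Continuous x' := h.continuousOn.domRestrict.Icc_extend'
  have hx0 : x' τ = X.1 := by
    rw [hx' ⟨le_rfl, hτ.2⟩, h.eqn τ ⟨le_rfl, hτ.2⟩, intervalIntegral.integral_same, add_zero]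
  have htr : D.IsTraj (volume.restrict (Ioo 0 τ)) D.σ X.2 τ u x' :=
    ⟨hx'c, (intervalIntegrable_iff_restrict_Ioo hτ.2).2 (integrable_Lp_two u), fun t ht => by
      rw [integral_velocity_eq hN hτ X u hx' ht, hx' ht, hx0, h.eqn t ht]⟩
  have hu : IntervalIntegrable (fun s => ‖u s‖ ^ 2) volume τ D.T :=
    (intervalIntegrable_iff_restrict_Ioo hτ.2).2
      ((memLp_two_iff_integrable_sq_norm (Lp.aestronglyMeasurable u)).1 (Lp.memLp u))
  have key := Data.form_add_integral_deviation htr hσ hu hf hy hτ.2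
  rw [Data.form_initial hx'c hσ hf, hx0] at key
  rw [cost_congr hτ.2 u hx'.symm, cost, key]
  exact le_add_of_nonneg_right (intervalIntegral.integral_nonneg hτ.2 fun s _ => by positivity)

/-- The feedback control has zero deviation. It is continuous, hence in `L²`; its class agrees with
it almost everywhere, which changes neither the trajectory nor the cost. -/
theorem quadratic_mem_costValues (hN : ∀ t ∈ Icc 0 D.T, D.N t = N t)
    {y : ℝ → Kernels (Vec n) D.T} (hy : D.IsRiccati τ y) (hτ : τ ∈ Icc 0 D.T)
    (X : StateSpace n τ) : (y τ).quadratic (volume.restrict (Ioo 0 τ)) D.σ X.2 X.1 ∈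
      costValues D.T N D.B D.Q D.Q₀ τ X := by
  have hσ : Measurable D.σ := (D.continuous_σ continuous_id).measurable
  have hf := integrable_Lp_two X.2
  obtain ⟨x, v, hx0, hv, htr, hd⟩ := Data.exists_closed_loop hτ hσ hf hy.continuous X.1
  have hvL : MemLp v 2 (volume.restrict (Ioo τ D.T)) := by
    obtain ⟨C, hC⟩ := isCompact_Icc.exists_bound_of_continuousOn (hv.continuousOn (s := Icc τ D.T))
    refine MemLp.of_bound hv.aestronglyMeasurable C ?_
    filter_upwards [ae_restrict_mem measurableSet_Ioo] with s hs using hC s (Ioo_subset_Icc_self hs)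
  have hu := hvL.coeFn_toLp
  refine ⟨hvL.toLp v, x, ⟨htr.continuous.continuousOn, fun t ht => ?_⟩, ?_⟩
  · rw [htr.eqn t ht, integral_velocity_eq hN hτ X v (eqOn_refl x _) ht, hx0]
    congr 1
    refine intervalIntegral_congr_Ioo ?_ ht
    filter_upwards [hu] with s hs
    rw [hs]
  · have key := Data.form_add_integral_deviation htr hσ ((hv.norm.pow 2).intervalIntegrable _ _)
      hf hy hτ.2
    rw [Data.form_initial htr.continuous hσ hf, hx0] at key
    have h0 : ∫ s in τ..D.T, ‖D.deviation (volume.restrict (Ioo 0 τ)) D.σ X.2 τ v x y s‖ ^ 2 = 0 := by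
      simp [hd]
    rw [h0, add_zero] at key
    rw [Kernels.quadratic, ← key, cost]
    congr 1
    refine intervalIntegral_congr_Ioo ?_ ⟨hτ.2, le_rfl⟩
    filter_upwards [hu] with s hs
    rw [hs]

theorem isLeast_quadForm (hN : ∀ t ∈ Icc 0 D.T, D.N t = N t) {y : ℝ → Kernels (Vec n) D.T}
    (hy : D.IsRiccati τ y) (hτ : τ ∈ Icc 0 D.T) (X : StateSpace n τ) :
    IsLeast (costValues D.T N D.B D.Q D.Q₀ τ X) (quadForm τ (P₀ (y τ))
      (fun ξ => P₁ (y τ) (D.σ ξ)) (fun ξ r => K (y τ) (D.σ ξ) (D.σ r)) X) := by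
  rw [quadForm_eq hτ]
  refine ⟨quadratic_mem_costValues hN hy hτ X, ?_⟩
  rintro _ ⟨u, x, h, rfl⟩
  exact quadratic_le_cost hN hy hτ h

/-- Continuous kernels on `[0, T]` extend to the real line. -/
theorem exists_data {V U : Type*} [NormedAddCommGroup V] [InnerProductSpace ℝ V] [CompleteSpace V]
    [NormedAddCommGroup U] [InnerProductSpace ℝ U] [CompleteSpace U] {T : ℝ} (hT : 0 ≤ T)
    {N : ℝ → V →L[ℝ] V} (hN : ContinuousOn N (Icc 0 T)) (B : U →L[ℝ] V) {Q Q₀ : V →L[ℝ] V}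
    (hQ : Q.IsPositive) (hQ₀ : Q₀.IsPositive) : ∃ D : Data V U, D.T = T ∧
      (∀ t ∈ Icc 0 T, D.N t = N t) ∧ D.B = B ∧ D.Q = Q ∧ D.Q₀ = Q₀ := by
  obtain ⟨c, hc⟩ := isCompact_Icc.exists_bound_of_continuousOn hN
  exact ⟨⟨T, hT, IccExtend hT ((Icc 0 T).domRestrict N), hN.domRestrict.Icc_extend', c,
    fun t => hc _ (projIcc 0 T hT t).2, B, Q, Q₀, hQ, hQ₀⟩, rfl,
    fun t ht => IccExtend_of_mem hT ((Icc 0 T).domRestrict N) ht, rfl, rfl, rfl⟩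

end Main
end VolterraLQ
end

/-! ### The main theorem -/

open VolterraLQ ContinuousLinearMap in
theorem mainTheorem1 (n m : ℕ) (T : ℝ) (hT : 0 < T)
    (N : ℝ → Vec n →L[ℝ] Vec n) (hN : ContinuousOn N (Set.Icc 0 T))
    (B : Vec m →L[ℝ] Vec n) (Q Q₀ : Vec n →L[ℝ] Vec n) (hQ : Q.IsPositive) (hQ₀ : Q₀.IsPositive) :
    ∃ (P₀ : ℝ → Vec n →L[ℝ] Vec n) (P₁ : ℝ → ℝ → Vec n →L[ℝ] Vec n)
      (K : ℝ → ℝ → ℝ → Vec n →L[ℝ] Vec n),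
      -- the kernels are continuously differentiable, up to the boundary of their domains
      ContDiffOn ℝ 1 P₀ (Set.Icc 0 T) ∧
      ContDiffOn ℝ 1 (fun p : ℝ × ℝ => P₁ p.1 p.2) (dom₂ T) ∧
      ContDiffOn ℝ 1 (fun p : ℝ × ℝ × ℝ => K p.1 p.2.1 p.2.2) (dom₃ T) ∧
      -- symmetry
      (∀ τ ∈ Set.Icc 0 T, adjoint (P₀ τ) = P₀ τ) ∧
      (∀ τ ∈ Set.Icc 0 T, ∀ ξ ∈ Set.Icc 0 τ, ∀ r ∈ Set.Icc 0 τ,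
        K τ ξ r = adjoint (K τ r ξ)) ∧
      -- the minimum of the cost is attained, and it is the quadratic form with these kernels
      (∀ τ ∈ Set.Icc 0 T, ∀ X : StateSpace n τ,
        IsLeast (costValues T N B Q Q₀ τ X) (valueFunction T N B Q Q₀ τ X) ∧
        valueFunction T N B Q Q₀ τ X = quadForm τ (P₀ τ) (P₁ τ) (K τ) X) ∧
      -- the Riccati system
      (∀ τ ∈ Set.Icc 0 T,
        derivWithin P₀ (Set.Icc 0 T) τ - P₀ τ ∘L B ∘L adjoint B ∘L P₀ τ + Q
          + P₁ τ τ + adjoint (P₁ τ τ) = 0) ∧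
      (∀ τ ∈ Set.Icc 0 T, ∀ ξ ∈ Set.Icc 0 τ,
        dτ₂ T P₁ τ ξ - P₀ τ ∘L B ∘L adjoint B ∘L P₁ τ ξ + P₀ τ ∘L N (τ - ξ) + K τ ξ τ = 0) ∧
      (∀ τ ∈ Set.Icc 0 T, ∀ ξ ∈ Set.Icc 0 τ, ∀ r ∈ Set.Icc 0 τ,
        dτ₃ T K τ ξ r - adjoint (P₁ τ r) ∘L B ∘L adjoint B ∘L P₁ τ ξ
          + adjoint (P₁ τ r) ∘L N (τ - ξ) + adjoint (N (τ - r)) ∘L P₁ τ ξ = 0) ∧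
      -- the terminal conditions
      P₀ T = Q₀ ∧
      (∀ ξ ∈ Set.Icc 0 T, P₁ T ξ = 0) ∧
      (∀ ξ ∈ Set.Icc 0 T, ∀ r ∈ Set.Icc 0 T, K T ξ r = 0) := by
  obtain ⟨D, rfl, hDN, rfl, rfl, rfl⟩ := exists_data hT.le hN B hQ hQ₀
  obtain ⟨y, hy⟩ := D.exists_isRiccati
  obtain ⟨f₁, hf₁, hf₁', h₁⟩ := hy.exists_hasFDerivWithinAt_P₁
  obtain ⟨f₂, hf₂, hf₂', h₂⟩ := hy.exists_hasFDerivWithinAt_K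
  have hsub : ∀ τ ∈ Set.Icc 0 D.T, ∀ ξ ∈ Set.Icc 0 τ, D.N (τ - D.σ ξ) = N (τ - ξ) :=
    fun τ hτ ξ hξ => by
      rw [D.coe_σ ⟨hξ.1, hξ.2.trans hτ.2⟩, hDN]
      exact ⟨sub_nonneg.2 hξ.2, (sub_le_self _ hξ.1).trans hτ.2⟩
  refine ⟨fun τ => (y τ).P₀, fun τ ξ => (y τ).P₁ (D.σ ξ), fun τ ξ r => (y τ).K (D.σ ξ) (D.σ r),
    hy.contDiffOn_P₀ hT, contDiffOn_one_of_hasFDerivWithinAt (uniqueDiffOn_dom₂ hT) hf₁ h₁,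
    contDiffOn_one_of_hasFDerivWithinAt (uniqueDiffOn_dom₃ hT) hf₂ h₂,
    fun τ hτ => hy.adjoint_P₀ hτ, fun τ hτ ξ _ r _ => (hy.adjoint_K hτ _ _).symm,
    fun τ hτ X => ?_, fun τ hτ => ?_, fun τ hτ ξ hξ => ?_, fun τ hτ ξ hξ r hr => ?_, ?_, ?_, ?_⟩
  · have h := isLeast_quadForm hDN (hy.mono hτ.1) hτ X
    have hv : valueFunction D.T N D.B D.Q D.Q₀ τ X = _ := h.csInf_eq
    exact ⟨hv ▸ h, hv⟩
  -- The constructed equation has `adjoint (P₀ τ)` as its last quadratic factor; symmetry of `P₀`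
  -- turns it into the stated one.
  · rw [(hy.hasDerivWithinAt_P₀ hτ).derivWithin (uniqueDiffOn_Icc hT τ hτ), Data.field₀,
      hy.adjoint_P₀ hτ, Data.S, comp_assoc]
    abel
  · have hp : (τ, ξ) ∈ dom₂ D.T := ⟨hξ.1, hξ.2, hτ.2⟩
    rw [dτ₂, (h₁ _ hp).fderivWithin (uniqueDiffOn_dom₂ hT _ hp), hf₁', Data.field₁,
      hsub τ hτ ξ hξ, Data.S, comp_assoc]
    abel
  · have hp : (τ, ξ, r) ∈ dom₃ D.T := ⟨hξ.1, hξ.2, hr.1, hr.2, hτ.2⟩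
    rw [dτ₃, (h₂ _ hp).fderivWithin (uniqueDiffOn_dom₃ hT _ hp), hf₂', Data.field₂,
      hsub τ hτ ξ hξ, hsub τ hτ r hr, Data.S, comp_assoc]
    abel
  · dsimp only
    rw [hy.apply_T hT.le]
    rfl
  · intro ξ _
    dsimp only
    rw [hy.apply_T hT.le]
    rfl
  · intro ξ _ r _
    dsimp only
    rw [hy.apply_T hT.le]
    rfl
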